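/- Let $k\ge 0$ and $l\ge 1$ be integers. Let $\mathcal X,\mathcal Y,\hat{\mathcal X}_1,\dots,\hat{\mathcal X}_{k+l}$ be finite alphabets, let $(X_t,Y_t)_{t\ge1}$ be i.i.d. with law $P(x,y)$ on $\mathcal X\times\mathcal Y$, and let $d_i:\mathcal X\times\hat{\mathcal X}_i\to[0,\infty)$ and $D_i\in\mathbb R$ for $1\le i\le k+l$. Consider the network with one encoder, which observes $(X^n,Y^n)$, and Users $1,\dots,k+l$, where the side information $Y^n$ is also available to Users $1,\dots,k$ but not to Users $k+1,\dots,k+l$. The encoder sends a message $T_1$ to User $1$ and a message $T_{k+l+1}$ directly to User $k+l$, both functions of $(X^n,Y^n)$. For $1\le i<k+l$, User $i$ sends to User $i+1$ a message $T_{i+1}$, which is a function of $(T_i,Y^n)$ if $i\le k$ and of $T_i$ alone if $i>k$. For $1\le i<k+l$, User $i$ forms a reconstruction $\hat X_i^n\in\hat{\mathcal X}_i^n$ as a function of $(T_i,Y^n)$ if $i\le k$ and of $T_i$ alone if $i>k$; User $k+l$ forms $\hat X_{k+l}^n\in\hat{\mathcal X}_{k+l}^n$ as a function of $(T_{k+l},T_{k+l+1})$.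 A rate vector $(R_1,\dots,R_{k+l+1})\in\mathbb R^{k+l+1}$ is achievable if for every $\epsilon>0$ and all sufficiently large $n$ there is such a code of block length $n$ in which $T_i$ takes values in a set of at most $2^{nR_i}$ elements for $1\le i\le k+l+1$, and $\mathbb E\big[\frac1n\sum_{t=1}^n d_i(X_t,\hat X_{i,t})\big]\le D_i+\epsilon$ for $1\le i\le k+l$. The achievable region is the closure of the set of achievable rate vectors. Then the achievable region is the set of all $(R_1,\dots,R_{k+l+1})$ that satisfy, with mutual informations in bits, \begin{align*} R_i&\ge I(X;\hat X_i,\hat X_{i+1},\dots,\hat X_{k+l-1},U\mid Y), && 1\le i\le k,\\ R_j&\ge I(X,Y;\hat X_j,\dots,\hat X_{k+l-1},U), && k+1\le j\le k+l,\\ R_{k+l+1}&\ge I(X;\hat X_{k+l}\mid U) \end{align*} for some joint distribution $P(x,y)P(\hat x_1,\dots,\hat x_{k+l},u\mid x,y)$, with $U$ an auxiliary random variable on a finite alphabet $\mathcal U$, for which $\mathbb E\,d_i(X,\hat X_i)\le D_i$ for $1\le i\le k+l$ (for $j=k+l$ the second bound reads $R_{k+l}\ge I(X,Y;U)$). Moreover,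 the region is unchanged if the alphabet of $U$ is required to satisfy $$|\mathcal U|\le|\mathcal X|\,|\mathcal Y|\,|\hat{\mathcal X}_1|\cdots|\hat{\mathcal X}_{k+l}|+k+l.$$ -/

import Mathlib

noncomputable section

namespace TriangularNetwork

/-! ### Information measures on a finite probability space -/

open Classical in
/-- The probability `P(A = a)` when the finite sample space `Ω` has probability mass function `q`. -/
def prob {Ω α : Type*} [Fintype Ω] (q : Ω → ℝ) (A : Ω → α) (a : α) : ℝ :=
  ∑ ω : Ω with A ω = a, q ω

/-- The mutual information `I(A; B) = E log₂ (p(A, B) / (p(A) p(B)))`, in bits. -/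
def mutualInfo {Ω α β : Type*} [Fintype Ω] (q : Ω → ℝ) (A : Ω → α) (B : Ω → β) : ℝ :=
  ∑ ω, q ω * Real.logb 2
    (prob q (fun ω' => (A ω', B ω')) (A ω, B ω) / (prob q A (A ω) * prob q B (B ω)))

/-- The conditional mutual information
`I(A; B | C) = E log₂ (p(A, B | C) / (p(A | C) p(B | C)))`
`= E log₂ (p(A, B, C) p(C) / (p(A, C) p(B, C)))`, in bits. -/
def condMutualInfo {Ω α β γ : Type*} [Fintype Ω] (q : Ω → ℝ)
    (A : Ω → α) (B : Ω → β) (C : Ω → γ) : ℝ :=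
  ∑ ω, q ω * Real.logb 2
    (prob q (fun ω' => (A ω', B ω', C ω')) (A ω, B ω, C ω) * prob q C (C ω) /
      (prob q (fun ω' => (A ω', C ω')) (A ω, C ω) *
        prob q (fun ω' => (B ω', C ω')) (B ω, C ω)))

/-! ### Codes for the network

There are `k + l` users, numbered here from `0` to `k + l - 1`; users `0, …, k - 1` observe the side
information `Yⁿ`, users `k, …, k + l - 1` do not.  Link `i < k + l` enters user `i`; it comes from
the encoder if `i = 0` and from user `i - 1` otherwise.  Link `k + l` goes directly from the
encoder to the last user, `k + l - 1`. -/

/-- What user `i` sees of the side information sequence `y`. -/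
def sideView {σ : Type*} (k : ℕ) (y : σ) (i : ℕ) : Option σ :=
  if i < k then some y else none

/-- What user `i` out of `N` users sees of the message `t` on the direct link. -/
def directView {σ : Type*} (N : ℕ) (t : σ) (i : ℕ) : Option σ :=
  if i + 1 = N then some t else none

/-- A code of block length `n`, with the message set `Fin (M i)` on link `i`. -/
structure Code (k l n : ℕ) (𝒳 𝒴 : Type*) (𝒳h : Fin (k + l) → Type*)
    (M : Fin (k + l + 1) → ℕ) where
  /-- The message from the encoder to the first user. -/
  enc : (Fin n → 𝒳) → (Fin n → 𝒴) → Fin (M ⟨0, by omega⟩)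
  /-- The message from the encoder to the last user. -/
  direct : (Fin n → 𝒳) → (Fin n → 𝒴) → Fin (M (Fin.last (k + l)))
  /-- The message that user `i` forwards to user `i + 1`, as a function of what user `i` sees of the
  side information and of the message it received. -/
  relay : (i : ℕ) → (hi : i + 1 < k + l) →
    Option (Fin n → 𝒴) → Fin (M ⟨i, by omega⟩) → Fin (M ⟨i + 1, by omega⟩)
  /-- The reconstruction of user `i`, as a function of what it sees of the side information, of the
  message received from its predecessor, and of what it sees of the direct message. -/
  dec : (i : Fin (k + l)) → Option (Fin n → 𝒴) → Fin (M i.castSucc) →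
    Option (Fin (M (Fin.last (k + l)))) → Fin n → 𝒳h i

namespace Code

/-- The message that enters user `i` when the encoder observes `(x, y)`. -/
def msg {k l n : ℕ} {𝒳 𝒴 : Type*} {𝒳h : Fin (k + l) → Type*} {M : Fin (k + l + 1) → ℕ}
    (c : Code k l n 𝒳 𝒴 𝒳h M) (x : Fin n → 𝒳) (y : Fin n → 𝒴) :
    (i : ℕ) → (hi : i < k + l) → Fin (M ⟨i, by omega⟩)
  | 0, _ => c.enc x y
  | i + 1, hi => c.relay i hi (sideView k y i) (c.msg x y i (by omega))

/-- The reconstruction sequence of user `i`. -/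
def recon {k l n : ℕ} {𝒳 𝒴 : Type*} {𝒳h : Fin (k + l) → Type*} {M : Fin (k + l + 1) → ℕ}
    (c : Code k l n 𝒳 𝒴 𝒳h M) (x : Fin n → 𝒳) (y : Fin n → 𝒴) (i : Fin (k + l)) :
    Fin n → 𝒳h i :=
  c.dec i (sideView k y i) (c.msg x y i i.isLt) (directView (k + l) (c.direct x y) i)

/-- The expected per-letter distortion `E[(1/n) ∑ₜ dᵢ(Xₜ, X̂ᵢₜ)]` of user `i` when the pairs
`(Xₜ, Yₜ)` are i.i.d. with probability mass function `P`. -/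
def expDistortion {k l n : ℕ} {𝒳 𝒴 : Type*} [Fintype 𝒳] [Fintype 𝒴]
    {𝒳h : Fin (k + l) → Type*} {M : Fin (k + l + 1) → ℕ} (c : Code k l n 𝒳 𝒴 𝒳h M)
    (P : 𝒳 × 𝒴 → ℝ) (d : (i : Fin (k + l)) → 𝒳 → 𝒳h i → ℝ) (i : Fin (k + l)) : ℝ :=
  ∑ x : Fin n → 𝒳, ∑ y : Fin n → 𝒴,
    (∏ t, P (x t, y t)) * ((1 / (n : ℝ)) * ∑ t, d i (x t) (c.recon x y i t))

end Code

/-- The rate vector `R` is achievable at distortions `D`: for every `ε > 0` and every sufficiently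
large `n` there is a code of block length `n` with at most `2 ^ (n Rᵢ)` messages on each link `i`
and expected distortion at most `Dᵢ + ε` at each user `i`. -/
def Achievable {k l : ℕ} {𝒳 𝒴 : Type*} [Fintype 𝒳] [Fintype 𝒴] {𝒳h : Fin (k + l) → Type*}
    (P : 𝒳 × 𝒴 → ℝ) (d : (i : Fin (k + l)) → 𝒳 → 𝒳h i → ℝ) (D : Fin (k + l) → ℝ)
    (R : Fin (k + l + 1) → ℝ) : Prop :=
  ∀ ε : ℝ, 0 < ε → ∃ n₀ : ℕ, ∀ n : ℕ, n₀ ≤ n →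
    ∃ (M : Fin (k + l + 1) → ℕ) (c : Code k l n 𝒳 𝒴 𝒳h M),
      (∀ i, (M i : ℝ) ≤ (2 : ℝ) ^ ((n : ℝ) * R i)) ∧
      ∀ i, c.expDistortion P d i ≤ D i + ε

/-- The operational achievable region: the closure of the set of achievable rate vectors. -/
def achievableRegion {k l : ℕ} {𝒳 𝒴 : Type*} [Fintype 𝒳] [Fintype 𝒴]
    {𝒳h : Fin (k + l) → Type*} (P : 𝒳 × 𝒴 → ℝ) (d : (i : Fin (k + l)) → 𝒳 → 𝒳h i → ℝ)
    (D : Fin (k + l) → ℝ) : Set (Fin (k + l + 1) → ℝ) :=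
  closure {R | Achievable P d D R}

/-! ### The single-letter region -/

/-- The alphabet of `(X, Y, (X̂ᵢ)ᵢ, U)` when `U` takes `m` values. -/
abbrev Joint {N : ℕ} (𝒳 𝒴 : Type*) (𝒳h : Fin N → Type*) (m : ℕ) : Type _ :=
  𝒳 × 𝒴 × ((i : Fin N) → 𝒳h i) × Fin m

namespace Joint

/-- The source letter. -/
def X {N m : ℕ} {𝒳 𝒴 : Type*} {𝒳h : Fin N → Type*} (ω : Joint 𝒳 𝒴 𝒳h m) : 𝒳 := ω.1

/-- The side information letter. -/
def Y {N m : ℕ} {𝒳 𝒴 : Type*} {𝒳h : Fin N → Type*} (ω : Joint 𝒳 𝒴 𝒳h m) : 𝒴 := ω.2.1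

/-- The reconstruction letter of user `i`. -/
def Xhat {N m : ℕ} {𝒳 𝒴 : Type*} {𝒳h : Fin N → Type*} (i : Fin N) (ω : Joint 𝒳 𝒴 𝒳h m) : 𝒳h i :=
  ω.2.2.1 i

/-- The auxiliary letter. -/
def U {N m : ℕ} {𝒳 𝒴 : Type*} {𝒳h : Fin N → Type*} (ω : Joint 𝒳 𝒴 𝒳h m) : Fin m := ω.2.2.2

/-- The reconstruction letters of all users from user `i` on, except the last user, together with
the auxiliary letter: `(X̂ᵢ, …, X̂_{N-2}, U)` with users numbered from `0` to `N - 1`. -/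
def tailU {N m : ℕ} {𝒳 𝒴 : Type*} {𝒳h : Fin N → Type*} (i : Fin N) (ω : Joint 𝒳 𝒴 𝒳h m) :
    ((j : {j : Fin N // i ≤ j ∧ (j : ℕ) + 1 < N}) → 𝒳h j) × Fin m :=
  (fun j => Xhat j.1 ω, U ω)

end Joint

/-- The rate vectors that satisfy the single-letter bounds for some joint distribution
`P(x, y) P(x̂, u | x, y)`, given by its probability mass function `q`, with an auxiliary variable `U`
that takes values in a set of `m` elements, and with expected distortions at most `D`. -/
def infoRegion {k l : ℕ} {𝒳 𝒴 : Type*} [Fintype 𝒳] [Fintype 𝒴]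
    {𝒳h : Fin (k + l) → Type*} [∀ i, Fintype (𝒳h i)]
    (P : 𝒳 × 𝒴 → ℝ) (d : (i : Fin (k + l)) → 𝒳 → 𝒳h i → ℝ) (D : Fin (k + l) → ℝ)
    (m : ℕ) : Set (Fin (k + l + 1) → ℝ) :=
  {R | ∃ q ∈ stdSimplex ℝ (Joint 𝒳 𝒴 𝒳h m),
    (∀ x y, prob q (fun ω => (Joint.X ω, Joint.Y ω)) (x, y) = P (x, y)) ∧
    (∀ i : Fin (k + l), (i : ℕ) < k →
      condMutualInfo q Joint.X (Joint.tailU i) Joint.Y ≤ R i.castSucc) ∧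
    (∀ j : Fin (k + l), k ≤ (j : ℕ) →
      mutualInfo q (fun ω => (Joint.X ω, Joint.Y ω)) (Joint.tailU j) ≤ R j.castSucc) ∧
    (∀ j : Fin (k + l), (j : ℕ) + 1 = k + l →
      condMutualInfo q Joint.X (Joint.Xhat j) Joint.U ≤ R (Fin.last (k + l))) ∧
    (∀ i : Fin (k + l), ∑ ω, q ω * d i (Joint.X ω) (Joint.Xhat i ω) ≤ D i)}

end TriangularNetwork

end

/-!
For the converse, let `U` consist of a uniform random time, the message that the last user receives
from its predecessor, and the source pairs before that time. User `i` can then produce all the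
letters `X̂ᵢ, …, X̂_{k+l-2}, U` from its own message and its side information, so that its rate
dominates the corresponding mutual information by the chain rule. Reweighting the values of `U` by
the theorem of Fenchel and Eggleston bounds its alphabet, and the bounded region is compact enough
to let the slack in the distortions tend to `0`.

For achievability, words are built in layers from the last user back to the first: the word of
user `i` carries `U` and the letters of the users `i, …, k + l - 2`, and extends the word of user
`i + 1`. Random codebooks cover almost every source block, while given `Yⁿ` only a short list of
words of each layer remains possible. Users with side information are sent the index in that list,
which saves the rate `I(Y; X̂ᵢ, …, U)`, and the other users are sent the index in the whole
codebook. The direct link describes `X̂_{k+l-1}` by a codebook that depends on the word for `U`.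
-/

noncomputable section

namespace TriangularNetwork

open Real Finset Filter Topology

/-! ### Entropy and mutual information -/

section Prob

variable {Ω Ω' α β γ : Type*} [Fintype Ω] [Fintype Ω'] {q : Ω → ℝ}

open Classical in
theorem prob_eq_sum_ite (q : Ω → ℝ) (A : Ω → α) (a : α) :
    prob q A a = ∑ ω, if A ω = a then q ω else 0 := by
  rw [prob, Finset.sum_filter]

theorem prob_nonneg (hq : ∀ ω, 0 ≤ q ω) (A : Ω → α) (a : α) : 0 ≤ prob q A a :=
  Finset.sum_nonneg fun ω _ => hq ω

theorem le_prob (hq : ∀ ω, 0 ≤ q ω) (A : Ω → α) (ω : Ω) : q ω ≤ prob q A (A ω) := by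
  classical
  unfold prob
  exact Finset.single_le_sum (f := q) (fun ω' _ => hq ω') (by simp)

theorem prob_pos (hq : ∀ ω, 0 ≤ q ω) (A : Ω → α) {ω : Ω} (h : 0 < q ω) :
    0 < prob q A (A ω) := h.trans_le (le_prob hq A ω)

theorem exists_of_prob_pos {A : Ω → α} {a : α} (h : 0 < prob q A a) :
    ∃ ω, A ω = a ∧ 0 < q ω := by
  classical
  unfold prob at h
  obtain ⟨ω, hω, h⟩ := Finset.exists_lt_of_sum_lt (f := fun _ => (0 : ℝ)) (by simpa using h)
  exact ⟨ω, by simpa using hω, h⟩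

theorem prob_pos_of_prob_pair_pos (hq : ∀ ω, 0 ≤ q ω) {A : Ω → α} {B : Ω → β} {a : α} {b : β}
    (h : 0 < prob q (fun ω => (A ω, B ω)) (a, b)) : 0 < prob q B b := by
  obtain ⟨ω, hω, hpos⟩ := exists_of_prob_pos h
  exact (Prod.mk.inj hω).2 ▸ prob_pos hq B hpos

theorem prob_congr {A : Ω → α} {B : Ω → β} {a : α} {b : β} (h : ∀ ω, A ω = a ↔ B ω = b) :
    prob q A a = prob q B b := by
  classical
  simp only [prob_eq_sum_ite, h]

theorem prob_unit_pair (A : Ω → α) (a : α) :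
    prob q (fun ω => ((), A ω)) ((), a) = prob q A a :=
  prob_congr fun ω => by simp

theorem sum_prob_mul [Fintype α] (q : Ω → ℝ) (A : Ω → α) (g : α → ℝ) :
    ∑ a, prob q A a * g a = ∑ ω, q ω * g (A ω) := by
  classical
  simp only [prob_eq_sum_ite, Finset.sum_mul]
  rw [Finset.sum_comm]
  refine Finset.sum_congr rfl fun ω _ => ?_
  simp [ite_mul]

theorem sum_prob [Fintype α] (q : Ω → ℝ) (A : Ω → α) : ∑ a, prob q A a = ∑ ω, q ω := by
  simpa using sum_prob_mul q A (fun _ => 1)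

theorem prob_prob (q : Ω → ℝ) (f : Ω → Ω') (A : Ω' → α) (a : α) :
    prob (prob q f) A a = prob q (fun ω => A (f ω)) a := by
  classical
  rw [prob_eq_sum_ite, prob_eq_sum_ite]
  have := sum_prob_mul q f (fun ω' => if A ω' = a then 1 else 0)
  simpa using this

theorem sum_prob_pair_right [Fintype β] (q : Ω → ℝ) (A : Ω → α) (B : Ω → β) (a : α) :
    ∑ b, prob q (fun ω => (A ω, B ω)) (a, b) = prob q A a := by
  classical
  simp only [prob_eq_sum_ite, Prod.mk.injEq]
  rw [Finset.sum_comm]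
  refine Finset.sum_congr rfl fun ω _ => ?_
  by_cases h : A ω = a <;> simp [h]

theorem sum_prob_pair_left [Fintype α] (q : Ω → ℝ) (A : Ω → α) (B : Ω → β) (b : β) :
    ∑ a, prob q (fun ω => (A ω, B ω)) (a, b) = prob q B b := by
  rw [← sum_prob_pair_right q B A b]
  exact Finset.sum_congr rfl fun a _ => prob_congr fun ω => by simp [and_comm]

theorem prob_self (q : Ω → ℝ) (ω : Ω) : prob q (fun ω' => ω') ω = q ω := by
  classical
  simp [prob_eq_sum_ite]

theorem mutualInfo_congr {α' β' : Type*} (q : Ω → ℝ) {A : Ω → α} {A' : Ω → α'} {B : Ω → β}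
    {B' : Ω → β'}
    (hA : ∀ ω ω', A ω = A ω' ↔ A' ω = A' ω') (hB : ∀ ω ω', B ω = B ω' ↔ B' ω = B' ω') :
    mutualInfo q A B = mutualInfo q A' B' := by
  unfold mutualInfo
  refine Finset.sum_congr rfl fun ω _ => ?_
  rw [prob_congr (fun ω' => hA ω' ω), prob_congr (fun ω' => hB ω' ω),
    prob_congr (B := fun ω' => (A' ω', B' ω')) (b := (A' ω, B' ω))
      (fun ω' => by simp [hA ω' ω, hB ω' ω])]

theorem condMutualInfo_congr {α' β' γ' : Type*} (q : Ω → ℝ) {A : Ω → α} {A' : Ω → α'} {B : Ω → β}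
    {B' : Ω → β'} {C : Ω → γ} {C' : Ω → γ'}
    (hA : ∀ ω ω', A ω = A ω' ↔ A' ω = A' ω') (hB : ∀ ω ω', B ω = B ω' ↔ B' ω = B' ω')
    (hC : ∀ ω ω', C ω = C ω' ↔ C' ω = C' ω') :
    condMutualInfo q A B C = condMutualInfo q A' B' C' := by
  unfold condMutualInfo
  refine Finset.sum_congr rfl fun ω _ => ?_
  rw [prob_congr (fun ω' => hC ω' ω),
    prob_congr (A := fun ω' => (A ω', B ω', C ω')) (a := (A ω, B ω, C ω))
      (B := fun ω' => (A' ω', B' ω', C' ω')) (b := (A' ω, B' ω, C' ω))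
      (fun ω' => by simp [hA ω' ω, hB ω' ω, hC ω' ω]),
    prob_congr (A := fun ω' => (A ω', C ω')) (a := (A ω, C ω))
      (B := fun ω' => (A' ω', C' ω')) (b := (A' ω, C' ω))
      (fun ω' => by simp [hA ω' ω, hC ω' ω]),
    prob_congr (A := fun ω' => (B ω', C ω')) (a := (B ω, C ω))
      (B := fun ω' => (B' ω', C' ω')) (b := (B' ω, C' ω))
      (fun ω' => by simp [hB ω' ω, hC ω' ω])]

/-- The information density of `A` and `B`: the function whose expectation is `mutualInfo`. -/
def infoDensity (q : Ω → ℝ) (A : Ω → α) (B : Ω → β) (ω : Ω) : ℝ :=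
  logb 2 (prob q (fun ω' => (A ω', B ω')) (A ω, B ω) / (prob q A (A ω) * prob q B (B ω)))

/-- The conditional information density of `A` and `B` given `C`: the function whose expectation is
`condMutualInfo`. -/
def condInfoDensity (q : Ω → ℝ) (A : Ω → α) (B : Ω → β) (C : Ω → γ) (ω : Ω) : ℝ :=
  logb 2
    (prob q (fun ω' => (A ω', B ω', C ω')) (A ω, B ω, C ω) * prob q C (C ω) /
      (prob q (fun ω' => (A ω', C ω')) (A ω, C ω) *
        prob q (fun ω' => (B ω', C ω')) (B ω, C ω)))

/-- The entropy of `A`, in bits. -/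
def entropy (q : Ω → ℝ) (A : Ω → α) : ℝ := -∑ ω, q ω * logb 2 (prob q A (A ω))

/-- The conditional entropy of `A` given `C`, in bits, as the difference `H(A, C) - H(C)`. -/
def condEntropy (q : Ω → ℝ) (A : Ω → α) (C : Ω → γ) : ℝ :=
  entropy q (fun ω => (A ω, C ω)) - entropy q C

theorem entropy_congr {A : Ω → α} {B : Ω → β} (h : ∀ ω ω', A ω = A ω' ↔ B ω = B ω') :
    entropy q A = entropy q B := by
  unfold entropy
  congr 1
  exact Finset.sum_congr rfl fun ω _ => by rw [prob_congr fun ω' => h ω' ω]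

theorem condEntropy_congr {α' γ' : Type*} {A : Ω → α} {A' : Ω → α'} {C : Ω → γ} {C' : Ω → γ'}
    (hA : ∀ ω ω', C ω = C ω' → (A ω = A ω' ↔ A' ω = A' ω'))
    (hC : ∀ ω ω', C ω = C ω' ↔ C' ω = C' ω') :
    condEntropy q A C = condEntropy q A' C' := by
  unfold condEntropy
  rw [entropy_congr hC, entropy_congr (B := fun ω => (A' ω, C' ω))]
  intro ω ω'
  simp only [Prod.mk.injEq, ← hC ω ω']
  exact and_congr_left (hA ω ω')

theorem entropy_eq_sum [Fintype α] (q : Ω → ℝ) (A : Ω → α) :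
    entropy q A = (∑ a, negMulLog (prob q A a)) / log 2 := by
  unfold entropy
  rw [← sum_prob_mul q A fun a => logb 2 (prob q A a), ← Finset.sum_neg_distrib, Finset.sum_div]
  refine Finset.sum_congr rfl fun a _ => ?_
  rw [negMulLog, logb]
  ring

theorem entropy_eq_of_prob_eq [Finite α] {q : Ω → ℝ} {q' : Ω' → ℝ} {A : Ω → α} {B : Ω' → α}
    (h : ∀ a, prob q A a = prob q' B a) : entropy q A = entropy q' B := by
  cases nonempty_fintype α
  simp only [entropy_eq_sum, h]

theorem mutualInfo_eq_entropy (hq : ∀ ω, 0 ≤ q ω) (A : Ω → α) (B : Ω → β) :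
    mutualInfo q A B = entropy q A + entropy q B - entropy q (fun ω => (A ω, B ω)) := by
  unfold mutualInfo entropy
  simp only [← Finset.sum_neg_distrib, ← Finset.sum_add_distrib, ← Finset.sum_sub_distrib]
  refine Finset.sum_congr rfl fun ω _ => ?_
  rcases (hq ω).eq_or_lt with h | h
  · simp [← h]
  have hA := prob_pos hq A h
  have hB := prob_pos hq B h
  have hAB := prob_pos hq (fun ω => (A ω, B ω)) h
  rw [logb_div hAB.ne' (by positivity), logb_mul hA.ne' hB.ne']
  ring

theorem condMutualInfo_eq_entropy (hq : ∀ ω, 0 ≤ q ω) (A : Ω → α) (B : Ω → β) (C : Ω → γ) :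
    condMutualInfo q A B C = entropy q (fun ω => (A ω, C ω)) + entropy q (fun ω => (B ω, C ω))
      - entropy q (fun ω => (A ω, B ω, C ω)) - entropy q C := by
  unfold condMutualInfo entropy
  simp only [← Finset.sum_neg_distrib, ← Finset.sum_add_distrib, ← Finset.sum_sub_distrib]
  refine Finset.sum_congr rfl fun ω _ => ?_
  rcases (hq ω).eq_or_lt with h | h
  · simp [← h]
  have hAC := prob_pos hq (fun ω => (A ω, C ω)) h
  have hBC := prob_pos hq (fun ω => (B ω, C ω)) h
  have hABC := prob_pos hq (fun ω => (A ω, B ω, C ω)) h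
  have hC := prob_pos hq C h
  rw [logb_div (by positivity) (by positivity), logb_mul hAC.ne' hBC.ne', logb_mul hABC.ne' hC.ne']
  ring

theorem mutualInfo_eq_sub_condEntropy (hq : ∀ ω, 0 ≤ q ω) (A : Ω → α) (B : Ω → β) :
    mutualInfo q A B = entropy q A - condEntropy q A B := by
  rw [mutualInfo_eq_entropy hq, condEntropy]
  ring

theorem condMutualInfo_eq_sub_condEntropy (hq : ∀ ω, 0 ≤ q ω) (A : Ω → α) (B : Ω → β)
    (C : Ω → γ) :
    condMutualInfo q A B C = condEntropy q A C - condEntropy q A fun ω => (B ω, C ω) := by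
  rw [condMutualInfo_eq_entropy hq, condEntropy, condEntropy]
  ring

/-- Gibbs' inequality, with `r` in the role of the ratio of the two densities. -/
theorem sum_mul_logb_nonpos (hq : ∀ ω, 0 ≤ q ω) {r : Ω → ℝ} (hr : ∀ ω, 0 < q ω → 0 < r ω)
    (hqr : ∑ ω, q ω * r ω ≤ ∑ ω, q ω) : ∑ ω, q ω * logb 2 (r ω) ≤ 0 := by
  have hlog : 0 < log 2 := log_pos one_lt_two
  calc ∑ ω, q ω * logb 2 (r ω) ≤ ∑ ω, q ω * ((r ω - 1) / log 2) := by
        refine Finset.sum_le_sum fun ω _ => ?_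
        rcases (hq ω).eq_or_lt with h | h
        · simp [← h]
        · have := log_le_sub_one_of_pos (hr ω h)
          rw [logb]
          gcongr
    _ = (∑ ω, q ω * r ω - ∑ ω, q ω) / log 2 := by
        rw [← Finset.sum_sub_distrib, Finset.sum_div]
        exact Finset.sum_congr rfl fun ω _ => by ring
    _ ≤ 0 := div_nonpos_of_nonpos_of_nonneg (by linarith) hlog.le

theorem sum_mul_prob_div_prob_le [Finite α] [Finite β] [Finite γ] (hq : ∀ ω, 0 ≤ q ω)
    (A : Ω → α) (B : Ω → β) (C : Ω → γ) :
    ∑ ω, q ω * (prob q (fun ω => (A ω, C ω)) (A ω, C ω) * prob q (fun ω => (B ω, C ω)) (B ω, C ω) /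
      (prob q (fun ω => (A ω, B ω, C ω)) (A ω, B ω, C ω) * prob q C (C ω))) ≤ ∑ ω, q ω := by
  cases nonempty_fintype α
  cases nonempty_fintype β
  cases nonempty_fintype γ
  set pAC := prob q (fun ω => (A ω, C ω))
  set pBC := prob q (fun ω => (B ω, C ω))
  set pABC := prob q (fun ω => (A ω, B ω, C ω))
  set pC := prob q C
  have cancel_le : ∀ a b c,
      pABC (a, b, c) * (pAC (a, c) * pBC (b, c) / (pABC (a, b, c) * pC c)) ≤
        pAC (a, c) * pBC (b, c) / pC c := by
    intro a b c
    rw [← div_div, div_right_comm, ← mul_div_assoc]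
    by_cases h : pABC (a, b, c) = 0
    · rw [h, zero_mul, zero_div]
      exact div_nonneg (mul_nonneg (prob_nonneg hq _ _) (prob_nonneg hq _ _)) (prob_nonneg hq _ _)
    · rw [mul_div_cancel_left₀ _ h]
  calc ∑ ω, q ω * (pAC (A ω, C ω) * pBC (B ω, C ω) / (pABC (A ω, B ω, C ω) * pC (C ω)))
      = ∑ a, ∑ b, ∑ c,
          pABC (a, b, c) * (pAC (a, c) * pBC (b, c) / (pABC (a, b, c) * pC c)) := by
        rw [← sum_prob_mul q (fun ω => (A ω, B ω, C ω))
          (fun v => pAC (v.1, v.2.2) * pBC (v.2.1, v.2.2) / (pABC v * pC v.2.2))]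
        simp only [Fintype.sum_prod_type, pABC]
    _ ≤ ∑ a, ∑ b, ∑ c, pAC (a, c) * pBC (b, c) / pC c := by
        gcongr with a _ b _ c _
        exact cancel_le a b c
    _ = ∑ c, (∑ a, pAC (a, c)) * (∑ b, pBC (b, c)) / pC c := by
        simp_rw [Finset.sum_mul_sum, Finset.sum_div]
        exact (Finset.sum_congr rfl fun a _ => Finset.sum_comm).trans Finset.sum_comm
    _ = ∑ c, pC c * pC c / pC c := by simp only [pAC, pBC, pC, sum_prob_pair_left]
    _ = ∑ ω, q ω := by simp only [mul_self_div_self, pC, sum_prob]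

theorem condMutualInfo_nonneg_of_finite [Finite α] [Finite β] [Finite γ]
    (hq : ∀ ω, 0 ≤ q ω) (A : Ω → α) (B : Ω → β) (C : Ω → γ) :
    0 ≤ condMutualInfo q A B C := by
  have gibbs := sum_mul_logb_nonpos hq (fun ω h => ?_) (sum_mul_prob_div_prob_le hq A B C)
  · rw [← neg_nonpos, condMutualInfo, ← Finset.sum_neg_distrib]
    refine gibbs.trans_eq' (Finset.sum_congr rfl fun ω _ => ?_)
    rw [← mul_neg, ← logb_inv, inv_div]
  · have hAC := prob_pos hq (fun ω => (A ω, C ω)) h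
    have hBC := prob_pos hq (fun ω => (B ω, C ω)) h
    have hABC := prob_pos hq (fun ω => (A ω, B ω, C ω)) h
    have hC := prob_pos hq C h
    positivity

theorem condMutualInfo_nonneg (hq : ∀ ω, 0 ≤ q ω) (A : Ω → α) (B : Ω → β) (C : Ω → γ) :
    0 ≤ condMutualInfo q A B C := by
  rw [condMutualInfo_congr q (A := A) (B := B) (C := C)
    (fun _ _ => (Set.rangeFactorization_eq_rangeFactorization_iff _ _).symm)
    (fun _ _ => (Set.rangeFactorization_eq_rangeFactorization_iff _ _).symm)
    (fun _ _ => (Set.rangeFactorization_eq_rangeFactorization_iff _ _).symm)]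
  exact condMutualInfo_nonneg_of_finite hq _ _ _

theorem condEntropy_anti (hq : ∀ ω, 0 ≤ q ω) (A : Ω → α) {B : Ω → β} {C : Ω → γ}
    (h : ∀ ω ω', B ω = B ω' → C ω = C ω') : condEntropy q A B ≤ condEntropy q A C := by
  have key := condMutualInfo_nonneg hq A B C
  rw [condMutualInfo_eq_sub_condEntropy hq,
    condEntropy_congr (C := fun ω => (B ω, C ω)) (C' := B) (fun _ _ _ => Iff.rfl)] at key
  · linarith
  · simpa using h

theorem condMutualInfo_mono_left (hq : ∀ ω, 0 ≤ q ω) {A : Ω → α} {A' : Ω → β} {α' : Type*}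
    (B : Ω → α') (C : Ω → γ) (h : ∀ ω ω', A ω = A ω' → A' ω = A' ω') :
    condMutualInfo q A' B C ≤ condMutualInfo q A B C := by
  have key := condEntropy_anti hq B (B := fun ω => (A ω, C ω)) (C := fun ω => (A' ω, C ω))
    (by simp only [Prod.mk.injEq]; exact fun ω ω' e => ⟨h ω ω' e.1, e.2⟩)
  rw [condEntropy, condEntropy, entropy_congr (B := fun ω => (A ω, B ω, C ω)),
    entropy_congr (A := fun ω => (B ω, A' ω, C ω)) (B := fun ω => (A' ω, B ω, C ω))] at key
  · rw [condMutualInfo_eq_entropy hq, condMutualInfo_eq_entropy hq]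
    linarith
  all_goals exact fun ω ω' => by simp only [Prod.mk.injEq]; tauto

theorem entropy_const (hq1 : ∑ ω, q ω = 1) (c : γ) : entropy q (fun _ : Ω => c) = 0 := by
  simp [entropy, prob, hq1]

theorem condEntropy_le_entropy (hq : ∀ ω, 0 ≤ q ω) (hq1 : ∑ ω, q ω = 1) (A : Ω → α) (B : Ω → β) :
    condEntropy q A B ≤ entropy q A := by
  refine (condEntropy_anti hq A (C := fun _ => ()) fun _ _ _ => rfl).trans_eq ?_
  rw [condEntropy, entropy_const hq1, sub_zero]
  exact entropy_congr fun ω ω' => by simp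

theorem entropy_pair_le_add (hq : ∀ ω, 0 ≤ q ω) (hq1 : ∑ ω, q ω = 1) (A : Ω → α) (B : Ω → β) :
    entropy q (fun ω => (A ω, B ω)) ≤ entropy q A + entropy q B :=
  sub_le_iff_le_add.1 (condEntropy_le_entropy hq hq1 A B)

theorem entropy_pair_self (q : Ω → ℝ) (S : Ω → α) :
    entropy q (fun ω => (ω, S ω)) = entropy q fun ω => ω :=
  entropy_congr fun ω ω' => by
    simp only [Prod.mk.injEq, and_iff_left_iff_imp]
    rintro rfl
    rfl

theorem nonempty_of_sum_eq_one (hq1 : ∑ ω, q ω = 1) : Nonempty Ω :=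
  univ_nonempty_iff.1 (nonempty_of_sum_ne_zero (hq1.trans_ne one_ne_zero))

theorem entropy_le_logb_card [Fintype α] (hq : ∀ ω, 0 ≤ q ω) (hq1 : ∑ ω, q ω = 1) (A : Ω → α) :
    entropy q A ≤ logb 2 (Fintype.card α) := by
  obtain ⟨ω₀⟩ : Nonempty Ω := nonempty_of_sum_eq_one hq1
  have hcard : (0 : ℝ) < Fintype.card α := by exact_mod_cast Fintype.card_pos_iff.2 ⟨A ω₀⟩
  have uniform_sum_le : ∑ ω, q ω * (1 / (Fintype.card α * prob q A (A ω))) ≤ ∑ ω, q ω := by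
    rw [← sum_prob_mul q A fun a => 1 / (Fintype.card α * prob q A a), hq1]
    calc ∑ a, prob q A a * (1 / (Fintype.card α * prob q A a))
        ≤ ∑ _a : α, (1 : ℝ) / Fintype.card α := by
          refine Finset.sum_le_sum fun a _ => ?_
          by_cases h : prob q A a = 0
          · simp [h]
          · exact le_of_eq (by field_simp)
      _ = 1 := by simp [hcard.ne']
  have gibbs := sum_mul_logb_nonpos hq
    (fun ω h => by have := prob_pos hq A h; positivity) uniform_sum_le
  have hsub : entropy q A - logb 2 (Fintype.card α) =
      ∑ ω, q ω * logb 2 (1 / (Fintype.card α * prob q A (A ω))) := by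
    have hconst : logb 2 (Fintype.card α) = ∑ ω, q ω * logb 2 (Fintype.card α) := by
      rw [← Finset.sum_mul, hq1, one_mul]
    rw [hconst, entropy, ← Finset.sum_neg_distrib, ← Finset.sum_sub_distrib]
    refine Finset.sum_congr rfl fun ω _ => ?_
    rcases (hq ω).eq_or_lt with h | h
    · simp [← h]
    rw [one_div, logb_inv, logb_mul hcard.ne' (prob_pos hq A h).ne']
    ring
  linarith

theorem mutualInfo_prob (q : Ω → ℝ) (f : Ω → Ω') (A : Ω' → α) (B : Ω' → β) :
    mutualInfo (prob q f) A B = mutualInfo q (fun ω => A (f ω)) (fun ω => B (f ω)) := by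
  unfold mutualInfo
  rw [sum_prob_mul q f fun ω => logb 2 (prob (prob q f) (fun ω' => (A ω', B ω')) (A ω, B ω) /
    (prob (prob q f) A (A ω) * prob (prob q f) B (B ω)))]
  simp only [prob_prob]

theorem condMutualInfo_prob (q : Ω → ℝ) (f : Ω → Ω') (A : Ω' → α) (B : Ω' → β) (C : Ω' → γ) :
    condMutualInfo (prob q f) A B C =
      condMutualInfo q (fun ω => A (f ω)) (fun ω => B (f ω)) (fun ω => C (f ω)) := by
  unfold condMutualInfo
  rw [sum_prob_mul q f fun ω => logb 2 (prob (prob q f) (fun ω' => (A ω', B ω', C ω'))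
      (A ω, B ω, C ω) * prob (prob q f) C (C ω) /
      (prob (prob q f) (fun ω' => (A ω', C ω')) (A ω, C ω) *
        prob (prob q f) (fun ω' => (B ω', C ω')) (B ω, C ω)))]
  simp only [prob_prob]

theorem continuous_prob (A : Ω → α) (a : α) : Continuous fun q : Ω → ℝ => prob q A a := by
  unfold prob
  fun_prop

theorem continuous_entropy [Finite α] (A : Ω → α) :
    Continuous fun q : Ω → ℝ => entropy q A := by
  cases nonempty_fintype α
  simp only [entropy_eq_sum]
  exact (continuous_finsetSum _ fun a _ =>
    continuous_negMulLog.comp (continuous_prob A a)).div_const _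

end Prob

/-! ### The single-letter region -/

section SingleLetter

theorem continuous_condMutualInfo {Ω α β γ : Type*} [Fintype Ω] [Finite α] [Finite β] [Finite γ]
    (A : Ω → α) (B : Ω → β) (C : Ω → γ) :
    Continuous fun q : stdSimplex ℝ Ω => condMutualInfo q.1 A B C := by
  simp only [fun q : stdSimplex ℝ Ω => condMutualInfo_eq_entropy q.2.1 A B C]
  exact ((((continuous_entropy _).comp continuous_subtype_val).add
    ((continuous_entropy _).comp continuous_subtype_val)).sub
    ((continuous_entropy _).comp continuous_subtype_val)).sub
    ((continuous_entropy _).comp continuous_subtype_val)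

theorem continuous_mutualInfo {Ω α β : Type*} [Fintype Ω] [Finite α] [Finite β] (A : Ω → α)
    (B : Ω → β) :
    Continuous fun q : stdSimplex ℝ Ω => mutualInfo q.1 A B := by
  simp only [fun q : stdSimplex ℝ Ω => mutualInfo_eq_entropy q.2.1 A B]
  exact (((continuous_entropy A).comp continuous_subtype_val).add
    ((continuous_entropy B).comp continuous_subtype_val)).sub
    ((continuous_entropy _).comp continuous_subtype_val)

/-- The letters `(X̂ᵢ, …, X̂_{N-2}, U)` of `Joint.tailU`, for random variables on any sample
space. -/
def tailOf {Ω 𝒰 : Type*} {N : ℕ} {𝒳h : Fin N → Type*} (Xh : (i : Fin N) → Ω → 𝒳h i) (U : Ω → 𝒰)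
    (i : Fin N) (ω : Ω) : ((j : {j : Fin N // i ≤ j ∧ (j : ℕ) + 1 < N}) → 𝒳h j) × 𝒰 :=
  (fun j => Xh j.1 ω, U ω)

variable {Ω 𝒰 : Type*} [Fintype Ω] {k l : ℕ} {𝒳 𝒴 : Type*}
  {𝒳h : Fin (k + l) → Type*}

/-- The bounds that define `infoRegion`, for random variables `X, Y, X̂ᵢ, U` on any finite sample
space, so that a point of the region can be exhibited on whichever space is convenient. -/
structure SatisfiesBounds (P : 𝒳 × 𝒴 → ℝ) (d : (i : Fin (k + l)) → 𝒳 → 𝒳h i → ℝ)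
    (D : Fin (k + l) → ℝ) (R : Fin (k + l + 1) → ℝ) (q : Ω → ℝ) (X : Ω → 𝒳) (Y : Ω → 𝒴)
    (Xh : (i : Fin (k + l)) → Ω → 𝒳h i) (U : Ω → 𝒰) : Prop where
  law : ∀ x y, prob q (fun ω => (X ω, Y ω)) (x, y) = P (x, y)
  rate_side : ∀ i : Fin (k + l), (i : ℕ) < k →
    condMutualInfo q X (tailOf Xh U i) Y ≤ R i.castSucc
  rate_plain : ∀ j : Fin (k + l), k ≤ (j : ℕ) →
    mutualInfo q (fun ω => (X ω, Y ω)) (tailOf Xh U j) ≤ R j.castSucc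
  rate_direct : ∀ j : Fin (k + l), (j : ℕ) + 1 = k + l →
    condMutualInfo q X (Xh j) U ≤ R (Fin.last (k + l))
  distortion : ∀ i : Fin (k + l), ∑ ω, q ω * d i (X ω) (Xh i ω) ≤ D i

theorem isClosed_satisfiesBounds [Finite 𝒳] [Finite 𝒴] [∀ i, Finite (𝒳h i)] [Finite 𝒰]
    (P : 𝒳 × 𝒴 → ℝ) (d : (i : Fin (k + l)) → 𝒳 → 𝒳h i → ℝ) (X : Ω → 𝒳) (Y : Ω → 𝒴)
    (Xh : (i : Fin (k + l)) → Ω → 𝒳h i) (U : Ω → 𝒰) :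
    IsClosed {z : stdSimplex ℝ Ω × ((Fin (k + l + 1) → ℝ) × (Fin (k + l) → ℝ)) |
      SatisfiesBounds P d z.2.2 z.2.1 z.1.1 X Y Xh U} := by
  let T := stdSimplex ℝ Ω × ((Fin (k + l + 1) → ℝ) × (Fin (k + l) → ℝ))
  have law : IsClosed {z : T | ∀ x y, prob z.1.1 (fun ω => (X ω, Y ω)) (x, y) = P (x, y)} := by
    simp only [Set.ofPred_forall]
    exact isClosed_iInter fun x => isClosed_iInter fun y => isClosed_eq
      ((continuous_prob _ _).comp (continuous_subtype_val.comp continuous_fst)) continuous_const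
  have side : IsClosed {z : T | ∀ i : Fin (k + l), (i : ℕ) < k →
      condMutualInfo z.1.1 X (tailOf Xh U i) Y ≤ z.2.1 i.castSucc} := by
    simp only [Set.ofPred_forall]
    exact isClosed_iInter fun i => isClosed_iInter fun _ => isClosed_le
      ((continuous_condMutualInfo _ _ _).comp continuous_fst) (by fun_prop)
  have plain : IsClosed {z : T | ∀ j : Fin (k + l), k ≤ (j : ℕ) →
      mutualInfo z.1.1 (fun ω => (X ω, Y ω)) (tailOf Xh U j) ≤ z.2.1 j.castSucc} := by
    simp only [Set.ofPred_forall]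
    exact isClosed_iInter fun j => isClosed_iInter fun _ => isClosed_le
      ((continuous_mutualInfo _ _).comp continuous_fst) (by fun_prop)
  have direct : IsClosed {z : T | ∀ j : Fin (k + l), (j : ℕ) + 1 = k + l →
      condMutualInfo z.1.1 X (Xh j) U ≤ z.2.1 (Fin.last (k + l))} := by
    simp only [Set.ofPred_forall]
    exact isClosed_iInter fun j => isClosed_iInter fun _ => isClosed_le
      ((continuous_condMutualInfo _ _ _).comp continuous_fst) (by fun_prop)
  have dist : IsClosed {z : T | ∀ i, ∑ ω, z.1.1 ω * d i (X ω) (Xh i ω) ≤ z.2.2 i} := by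
    simp only [Set.ofPred_forall]
    exact isClosed_iInter fun i => isClosed_le (continuous_finsetSum _ fun ω _ =>
      ((continuous_apply ω).comp (continuous_subtype_val.comp continuous_fst)).mul_const _)
      (by fun_prop)
  convert (((law.inter side).inter plain).inter direct).inter dist using 1
  ext z
  exact ⟨fun ⟨law, side, plain, direct, dist⟩ => ⟨⟨⟨⟨law, side⟩, plain⟩, direct⟩, dist⟩,
    fun ⟨⟨⟨⟨law, side⟩, plain⟩, direct⟩, dist⟩ => ⟨law, side, plain, direct, dist⟩⟩

variable {P : 𝒳 × 𝒴 → ℝ} {d : (i : Fin (k + l)) → 𝒳 → 𝒳h i → ℝ} {D : Fin (k + l) → ℝ}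
  {R : Fin (k + l + 1) → ℝ} {q : Ω → ℝ}

theorem satisfiesBounds_prob_iff {Ω' : Type*} [Fintype Ω'] {f : Ω → Ω'} {X : Ω' → 𝒳} {Y : Ω' → 𝒴}
    {Xh : (i : Fin (k + l)) → Ω' → 𝒳h i} {U : Ω' → 𝒰} :
    SatisfiesBounds P d D R (prob q f) X Y Xh U ↔ SatisfiesBounds P d D R q (fun ω => X (f ω))
      (fun ω => Y (f ω)) (fun i ω => Xh i (f ω)) (fun ω => U (f ω)) := by
  have dist_eq (i : Fin (k + l)) : ∑ ω, prob q f ω * d i (X ω) (Xh i ω) =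
      ∑ ω, q ω * d i (X (f ω)) (Xh i (f ω)) := sum_prob_mul q f fun ω => d i (X ω) (Xh i ω)
  constructor
  · rintro ⟨law, side, plain, direct, dist⟩
    simp only [prob_prob, condMutualInfo_prob, mutualInfo_prob, dist_eq]
      at law side plain direct dist
    exact ⟨law, side, plain, direct, dist⟩
  · rintro ⟨law, side, plain, direct, dist⟩
    constructor <;> simpa only [prob_prob, condMutualInfo_prob, mutualInfo_prob, dist_eq]

theorem SatisfiesBounds.congr_aux {𝒰' : Type*} {X : Ω → 𝒳} {Y : Ω → 𝒴}
    {Xh : (i : Fin (k + l)) → Ω → 𝒳h i} {U : Ω → 𝒰} {U' : Ω → 𝒰'}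
    (h : SatisfiesBounds P d D R q X Y Xh U) (hU : ∀ ω ω', U ω = U ω' ↔ U' ω = U' ω') :
    SatisfiesBounds P d D R q X Y Xh U' := by
  have tail_iff (i : Fin (k + l)) (ω ω' : Ω) :
      tailOf Xh U i ω = tailOf Xh U i ω' ↔ tailOf Xh U' i ω = tailOf Xh U' i ω' := by
    simp only [tailOf, Prod.mk.injEq, hU]
  refine ⟨h.law, fun i hi => ?_, fun j hj => ?_, fun j hj => ?_, h.distortion⟩
  · exact (h.rate_side i hi).trans_eq'
      (condMutualInfo_congr q (fun _ _ => Iff.rfl) (tail_iff i) fun _ _ => Iff.rfl)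
  · exact (h.rate_plain j hj).trans_eq' (mutualInfo_congr q (fun _ _ => Iff.rfl) (tail_iff j))
  · exact (h.rate_direct j hj).trans_eq'
      (condMutualInfo_congr q (fun _ _ => Iff.rfl) (fun _ _ => Iff.rfl) hU)

variable [Fintype 𝒳] [Fintype 𝒴] [∀ i, Fintype (𝒳h i)]

theorem mem_infoRegion_iff {m : ℕ} :
    R ∈ infoRegion P d D m ↔ ∃ q ∈ stdSimplex ℝ (Joint 𝒳 𝒴 𝒳h m),
      SatisfiesBounds P d D R q Joint.X Joint.Y Joint.Xhat Joint.U :=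
  ⟨fun ⟨q, hq, law, side, plain, direct, dist⟩ => ⟨q, hq, law, side, plain, direct, dist⟩,
    fun ⟨q, hq, law, side, plain, direct, dist⟩ => ⟨q, hq, law, side, plain, direct, dist⟩⟩

theorem SatisfiesBounds.mem_infoRegion [Fintype 𝒰] {X : Ω → 𝒳} {Y : Ω → 𝒴}
    {Xh : (i : Fin (k + l)) → Ω → 𝒳h i} {U : Ω → 𝒰}
    (h : SatisfiesBounds P d D R q X Y Xh U) (hq : q ∈ stdSimplex ℝ Ω) :
    R ∈ infoRegion P d D (Fintype.card 𝒰) := by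
  let f : Ω → Joint 𝒳 𝒴 𝒳h (Fintype.card 𝒰) := fun ω =>
    (X ω, Y ω, fun i => Xh i ω, Fintype.equivFin 𝒰 (U ω))
  refine mem_infoRegion_iff.2 ⟨prob q f, ⟨prob_nonneg hq.1 f, (sum_prob q f).trans hq.2⟩, ?_⟩
  exact satisfiesBounds_prob_iff.2
    (h.congr_aux fun _ _ => (Fintype.equivFin 𝒰).apply_eq_iff_eq.symm)

theorem isClosed_infoRegion_graph (P : 𝒳 × 𝒴 → ℝ) (d : (i : Fin (k + l)) → 𝒳 → 𝒳h i → ℝ)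
    (m : ℕ) : IsClosed {z : (Fin (k + l + 1) → ℝ) × (Fin (k + l) → ℝ) |
      z.1 ∈ infoRegion P d z.2 m} := by
  have : CompactSpace (stdSimplex ℝ (Joint 𝒳 𝒴 𝒳h m)) :=
    isCompact_iff_compactSpace.1 (isCompact_stdSimplex ℝ _)
  convert isClosedMap_snd_of_compactSpace _
    (isClosed_satisfiesBounds P d (Ω := Joint 𝒳 𝒴 𝒳h m) Joint.X Joint.Y Joint.Xhat Joint.U)
  ext z
  simp only [mem_infoRegion_iff]
  constructor
  · rintro ⟨q, hq, h⟩
    exact ⟨(⟨q, hq⟩, z), h, rfl⟩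
  · rintro ⟨⟨q, z⟩, h, rfl⟩
    exact ⟨q.1, q.2, h⟩

end SingleLetter

/-! ### Bounding the alphabet of the auxiliary variable -/

section SparseWeights

variable {ι κ : Type*}

theorem exists_add_mul_eq_zero [Finite κ] {w c : κ → ℝ} (hw : ∀ u, 0 ≤ w u)
    (hcw : ∀ u, w u = 0 → c u = 0) (hc : ∃ u, c u < 0) :
    ∃ t : ℝ, 0 ≤ t ∧ (∀ u, 0 ≤ w u + t * c u) ∧ ∃ v, w v ≠ 0 ∧ w v + t * c v = 0 := by
  classical
  cases nonempty_fintype κ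
  obtain ⟨v, hv, hmin⟩ := Finset.exists_min_image (univ.filter fun u => c u < 0)
    (fun u => w u / -c u) (by simpa [Finset.Nonempty] using hc)
  have hcv : c v < 0 := by simpa using hv
  have ht : 0 ≤ w v / -c v := div_nonneg (hw v) (by linarith)
  refine ⟨w v / -c v, ht, fun u => ?_, v, fun h => hcv.ne (hcw v h), by field_simp [hcv.ne]; ring⟩
  rcases lt_or_ge (c u) 0 with hu | hu
  · have := (le_div_iff₀ (neg_pos.2 hu)).1 (hmin u (by simpa using hu))
    linarith
  · have := mul_nonneg ht hu
    linarith [hw u]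

variable [Fintype κ]

theorem exists_ne_zero_sum_mul_eq_zero [Fintype ι] (a : ι → κ → ℝ) (s : Finset κ)
    (h : Fintype.card ι < s.card) :
    ∃ c : κ → ℝ, c ≠ 0 ∧ (∀ u ∉ s, c u = 0) ∧ ∀ i, ∑ u, c u * a i u = 0 := by
  classical
  have dependent : ¬ LinearIndepOn ℝ (fun u i => a i u) (s : Set κ) := fun hli => by
    have := hli.fintype_card_le_finrank
    simp at this
    omega
  obtain ⟨g, hg, v, hvs, hv⟩ := (not_linearIndepOn_finset_iff).1 dependent
  refine ⟨fun u => if u ∈ s then g u else 0, fun h => hv ?_, fun u hu => if_neg hu, fun i => ?_⟩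
  · simpa [hvs] using congrFun h v
  · simpa [Finset.sum_apply, ite_mul] using congrFun hg i

theorem exists_descent_direction [Fintype ι] (a : ι → κ → ℝ) (φ : κ → ℝ) {r : ι → ℝ}
    {s : Finset κ} (hr : ∀ u ∈ s, 0 < ∑ i, r i * a i u) (h : Fintype.card ι < s.card) :
    ∃ c : κ → ℝ, (∀ u ∉ s, c u = 0) ∧ (∀ i, ∑ u, c u * a i u = 0) ∧ ∑ u, c u * φ u ≤ 0 ∧
      ∃ u, c u < 0 := by
  obtain ⟨c, hc, hcs, hca, hcφ⟩ : ∃ c : κ → ℝ, c ≠ 0 ∧ (∀ u ∉ s, c u = 0) ∧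
      (∀ i, ∑ u, c u * a i u = 0) ∧ ∑ u, c u * φ u ≤ 0 := by
    obtain ⟨c, hc, hcs, hca⟩ := exists_ne_zero_sum_mul_eq_zero a s h
    rcases le_total (∑ u, c u * φ u) 0 with hφ | hφ
    · exact ⟨c, hc, hcs, hca, hφ⟩
    · exact ⟨-c, neg_ne_zero.2 hc, fun u hu => by simp [hcs u hu], by simpa using hca,
        by simpa using hφ⟩
  refine ⟨c, hcs, hca, hcφ, ?_⟩
  by_contra! hc_nonneg
  have sum_eq : ∑ u, c u * ∑ i, r i * a i u = 0 := by
    simp only [Finset.mul_sum, mul_left_comm (c _)]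
    rw [Finset.sum_comm]
    simp only [← Finset.mul_sum, hca, mul_zero, Finset.sum_const_zero]
  have nonneg (u : κ) : 0 ≤ c u * ∑ i, r i * a i u := by
    by_cases hu : u ∈ s
    · exact mul_nonneg (hc_nonneg u) (hr u hu).le
    · simp [hcs u hu]
  refine hc (funext fun u => ?_)
  by_cases hu : u ∈ s
  · have := (Finset.sum_eq_zero_iff_of_nonneg fun u _ => nonneg u).1 sum_eq u (mem_univ u)
    exact (mul_eq_zero.1 this).resolve_right (hr u hu).ne'
  · exact hcs u hu

/-- A vertex of the polytope of nonnegative weights with prescribed sums has sparse support; the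
combination `r` of these sums makes the polytope bounded. -/
theorem exists_sparse_weights [Fintype ι] (a : ι → κ → ℝ) (φ : κ → ℝ) {w₀ : κ → ℝ}
    (hw₀ : ∀ u, 0 ≤ w₀ u) {r : ι → ℝ} (hr : ∀ u, w₀ u ≠ 0 → 0 < ∑ i, r i * a i u) :
    ∃ w : κ → ℝ, (∀ u, 0 ≤ w u) ∧ (∀ i, ∑ u, w u * a i u = ∑ u, w₀ u * a i u) ∧
      ∑ u, w u * φ u ≤ ∑ u, w₀ u * φ u ∧ Fintype.card {u // w u ≠ 0} ≤ Fintype.card ι := by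
  classical
  let support (w : κ → ℝ) : Finset κ := univ.filter fun u => w u ≠ 0
  let feasible : Set (κ → ℝ) := {w | (∀ u, 0 ≤ w u) ∧ support w ⊆ support w₀ ∧
    (∀ i, ∑ u, w u * a i u = ∑ u, w₀ u * a i u) ∧ ∑ u, w u * φ u ≤ ∑ u, w₀ u * φ u}
  obtain ⟨w, ⟨hw, hws, hwa, hwφ⟩, hmin⟩ := WellFounded.has_min
    (measure fun w => (support w).card).wf feasible ⟨w₀, hw₀, subset_rfl, fun _ => rfl, le_rfl⟩
  refine ⟨w, hw, hwa, hwφ, ?_⟩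
  by_contra! hcard
  obtain ⟨c, hcs, hca, hcφ, hc⟩ := exists_descent_direction a φ (r := r) (s := support w)
    (fun u hu => hr u (by simpa [support] using hws hu)) (by rwa [← Fintype.card_subtype])
  have hcw (u : κ) (hu : w u = 0) : c u = 0 := hcs u (by simp [support, hu])
  obtain ⟨t, ht, hnonneg, v, hwv, hv⟩ := exists_add_mul_eq_zero hw hcw hc
  have support_lt : support (fun u => w u + t * c u) ⊂ support w := by
    refine ⟨fun u => ?_, fun h => ?_⟩
    · simp only [support, Finset.mem_filter, Finset.mem_univ, true_and]
      exact fun hu h => hu (by simp [h, hcw u h])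
    · have := h (show v ∈ support w by simpa [support] using hwv)
      simp [support, hv] at this
  have sum_eq (g : κ → ℝ) :
      ∑ u, (w u + t * c u) * g u = ∑ u, w u * g u + t * ∑ u, c u * g u := by
    simp only [add_mul, Finset.sum_add_distrib, mul_assoc, Finset.mul_sum]
  refine hmin (fun u => w u + t * c u) ⟨hnonneg, support_lt.1.trans hws, fun i => ?_, ?_⟩
    (Finset.card_lt_card support_lt)
  · rw [sum_eq, hca, hwa, mul_zero, add_zero]
  · rw [sum_eq]
    linarith [mul_nonpos_of_nonneg_of_nonpos ht hcφ]

end SparseWeights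

section Reweight

variable {Ω α β γ κ : Type*}

theorem prob_subtype_val {p : Ω → Prop} [Fintype {ω // p ω}] {q : Ω → ℝ}
    (hp : ∀ ω, ¬ p ω → q ω = 0) :
    prob (fun ω : {ω // p ω} => q ω) Subtype.val = q := by
  classical
  ext ω
  rw [prob_eq_sum_ite]
  by_cases h : p ω
  · rw [Finset.sum_eq_single ⟨ω, h⟩ (fun ω' _ hne => if_neg fun h => hne (Subtype.ext h)) (by simp),
      if_pos rfl]
  · rw [hp ω h]
    refine Finset.sum_eq_zero fun ω' _ => if_neg ?_
    rintro rfl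
    exact h ω'.2

/-- The weights `q` with the atoms in the fibre `U = u` rescaled by `w u`. This changes the law of
`U` but not the conditional laws given `U`. -/
def reweight (w : κ → ℝ) (U : Ω → κ) (q : Ω → ℝ) (ω : Ω) : ℝ := w (U ω) * q ω

variable [Fintype Ω]

open Classical in
/-- The contribution of the fibre `U = u` to the expectation of `f`, not normalised by the
probability of the fibre. -/
def fiberExp (q : Ω → ℝ) (U : Ω → κ) (f : Ω → ℝ) (u : κ) : ℝ :=
  ∑ ω, if U ω = u then q ω * f ω else 0

theorem sum_reweight [Fintype κ] (w : κ → ℝ) (U : Ω → κ) (q f : Ω → ℝ) :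
    ∑ ω, reweight w U q ω * f ω = ∑ u, w u * fiberExp q U f u := by
  classical
  simp only [fiberExp, reweight, Finset.mul_sum]
  rw [Finset.sum_comm]
  exact Finset.sum_congr rfl fun ω _ => by simp [mul_assoc]

theorem prob_reweight_of_factor {w : κ → ℝ} {U : Ω → κ} (q : Ω → ℝ) {A : Ω → α} {a : α} {u : κ}
    (h : ∀ ω, A ω = a → U ω = u) : prob (reweight w U q) A a = w u * prob q A a := by
  classical
  unfold prob reweight
  rw [Finset.mul_sum]
  exact Finset.sum_congr rfl fun ω hω => by simp only [h ω (by simpa using hω)]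

theorem sum_fiberExp_indicator {τ : Type*} [Fintype τ] [DecidableEq τ] (q : Ω → ℝ) (U : Ω → κ)
    (T : Ω → τ) (u : κ) :
    ∑ v, fiberExp q U (fun ω => if T ω = v then 1 else 0) u = prob q U u := by
  classical
  unfold fiberExp
  rw [Finset.sum_comm, prob_eq_sum_ite]
  exact Finset.sum_congr rfl fun ω _ => by split_ifs <;> simp

/-- The Fenchel–Eggleston form of Carathéodory's theorem: reweighting a few values of `U` suffices
to keep the law of `T` and the expectations of the `ψ i`, without increasing that of `χ`. -/
theorem exists_reweight {ι τ : Type*} [Fintype ι] [Fintype κ] [Fintype τ] {q : Ω → ℝ}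
    (hq : ∀ ω, 0 ≤ q ω) (U : Ω → κ) (T : Ω → τ) (ψ : ι → Ω → ℝ) (χ : Ω → ℝ) :
    ∃ w : κ → ℝ, (∀ u, 0 ≤ w u) ∧ (∀ v, prob (reweight w U q) T v = prob q T v) ∧
      (∀ i, ∑ ω, reweight w U q ω * ψ i ω = ∑ ω, q ω * ψ i ω) ∧
      ∑ ω, reweight w U q ω * χ ω ≤ ∑ ω, q ω * χ ω ∧
      Fintype.card {u // w u ≠ 0} ≤ Fintype.card τ + Fintype.card ι := by
  classical
  let f : τ ⊕ ι → Ω → ℝ := Sum.elim (fun v ω => if T ω = v then 1 else 0) ψ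
  let w₀ (u : κ) : ℝ := if prob q U u = 0 then 0 else 1
  have reweight_w₀ : reweight w₀ U q = q := by
    ext ω
    by_cases h : prob q U (U ω) = 0
    · simp [reweight, ((le_prob hq U ω).trans_eq h).antisymm (hq ω)]
    · simp [reweight, w₀, h]
  obtain ⟨w, hw, hwf, hwχ, hcard⟩ := exists_sparse_weights (fun i => fiberExp q U (f i))
    (fiberExp q U χ) (w₀ := w₀) (fun u => by unfold w₀; split_ifs <;> norm_num)
    (r := Sum.elim 1 0) fun u hu => by
      simpa [f, sum_fiberExp_indicator] using
        (prob_nonneg hq U u).lt_of_ne' fun h => hu (by simp [w₀, h])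
  simp only [← sum_reweight, reweight_w₀] at hwf hwχ
  refine ⟨w, hw, fun v => ?_, fun i => hwf (Sum.inr i), hwχ, by simpa using hcard⟩
  simpa [f, prob_eq_sum_ite] using hwf (Sum.inl v)

variable {w : κ → ℝ} {U : Ω → κ} {q : Ω → ℝ}

theorem mutualInfo_reweight {A : Ω → α} {B : Ω → β}
    (hA : ∀ ω, prob (reweight w U q) A (A ω) = prob q A (A ω))
    (hB : ∀ ω ω', B ω = B ω' → U ω = U ω') :
    mutualInfo (reweight w U q) A B = ∑ ω, reweight w U q ω * infoDensity q A B ω := by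
  unfold mutualInfo infoDensity
  refine Finset.sum_congr rfl fun ω _ => ?_
  by_cases hw : w (U ω) = 0
  · simp [reweight, hw]
  rw [hA, prob_reweight_of_factor q (A := B) (u := U ω) fun ω' h => hB _ _ h,
    prob_reweight_of_factor q (A := fun ω' => (A ω', B ω')) (u := U ω)
      fun ω' h => hB _ _ (Prod.mk.inj h).2, mul_left_comm, mul_div_mul_left _ _ hw]

theorem condMutualInfo_reweight {A : Ω → α} {B : Ω → β} {C : Ω → γ} (r : Ω → ℝ)
    (hr : ∀ ω, w (U ω) ≠ 0 → r ω ≠ 0)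
    (hAC : ∀ ω, prob (reweight w U q) (fun ω => (A ω, C ω)) (A ω, C ω) =
      r ω * prob q (fun ω => (A ω, C ω)) (A ω, C ω))
    (hC : ∀ ω, prob (reweight w U q) C (C ω) = r ω * prob q C (C ω))
    (hBC : ∀ ω ω', B ω = B ω' → C ω = C ω' → U ω = U ω') :
    condMutualInfo (reweight w U q) A B C =
      ∑ ω, reweight w U q ω * condInfoDensity q A B C ω := by
  unfold condMutualInfo condInfoDensity
  refine Finset.sum_congr rfl fun ω _ => ?_
  by_cases hw : w (U ω) = 0
  · simp [reweight, hw]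
  rw [hAC, hC, prob_reweight_of_factor q (A := fun ω' => (B ω', C ω')) (u := U ω)
      fun ω' h => hBC _ _ (Prod.mk.inj h).1 (Prod.mk.inj h).2,
    prob_reweight_of_factor q (A := fun ω' => (A ω', B ω', C ω')) (u := U ω)
      fun ω' h => hBC _ _ (Prod.mk.inj (Prod.mk.inj h).2).1 (Prod.mk.inj (Prod.mk.inj h).2).2,
    mul_mul_mul_comm, mul_mul_mul_comm (r ω), mul_comm (r ω),
    mul_div_mul_left _ _ (mul_ne_zero hw (hr ω hw))]

theorem prob_comp_congr [Finite α] {Ω' : Type*} [Fintype Ω'] {q : Ω → ℝ} {q' : Ω' → ℝ}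
    {T : Ω → α} {T' : Ω' → α} (h : ∀ v, prob q T v = prob q' T' v) (g : α → β) (b : β) :
    prob q (fun ω => g (T ω)) b = prob q' (fun ω => g (T' ω)) b := by
  cases nonempty_fintype α
  rw [← prob_prob q T g, ← prob_prob q' T' g, funext h]

end Reweight

section Cardinality

variable {Ω 𝒰 : Type*} [Fintype Ω] {k l : ℕ} {𝒳 𝒴 : Type*} {𝒳h : Fin (k + l) → Type*}
  {P : 𝒳 × 𝒴 → ℝ} {d : (i : Fin (k + l)) → 𝒳 → 𝒳h i → ℝ} {D : Fin (k + l) → ℝ}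
  {R : Fin (k + l + 1) → ℝ} {q : Ω → ℝ} {X : Ω → 𝒳} {Y : Ω → 𝒴}
  {Xh : (i : Fin (k + l)) → Ω → 𝒳h i} {U : Ω → 𝒰}

theorem SatisfiesBounds.restrict (h : SatisfiesBounds P d D R q X Y Xh U) {p : Ω → Prop}
    [Fintype {ω // p ω}] (hp : ∀ ω, ¬ p ω → q ω = 0) :
    SatisfiesBounds P d D R (fun ω : {ω // p ω} => q ω) (fun ω => X ω) (fun ω => Y ω)
      (fun i ω => Xh i ω) (fun ω => U ω) :=
  satisfiesBounds_prob_iff.1 (by rwa [prob_subtype_val hp])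

variable [Fintype 𝒳] [Fintype 𝒴] [∀ i, Fintype (𝒳h i)]

theorem SatisfiesBounds.exists_reweight [Fintype 𝒰] (h : SatisfiesBounds P d D R q X Y Xh U)
    (hq : ∀ ω, 0 ≤ q ω) (hl : 0 < k + l) :
    ∃ w : 𝒰 → ℝ, (∀ u, 0 ≤ w u) ∧ ∑ ω, reweight w U q ω = ∑ ω, q ω ∧
      SatisfiesBounds P d D R (reweight w U q) X Y Xh U ∧
      Fintype.card {u // w u ≠ 0} ≤
        Fintype.card 𝒳 * Fintype.card 𝒴 * (∏ i, Fintype.card (𝒳h i)) + (k + l) := by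
  classical
  let e : Fin (k + l) := ⟨k + l - 1, by omega⟩
  let ψ (i : Fin (k + l)) : Ω → ℝ := if (i : ℕ) < k then condInfoDensity q X (tailOf Xh U i) Y
    else infoDensity q (fun ω => (X ω, Y ω)) (tailOf Xh U i)
  let T (ω : Ω) : 𝒳 × 𝒴 × ((i : Fin (k + l)) → 𝒳h i) := (X ω, Y ω, fun i => Xh i ω)
  obtain ⟨w, hw, hT, hψ, hχ, hcard⟩ :=
    TriangularNetwork.exists_reweight hq U T ψ (condInfoDensity q X (Xh e) U)
  have sum_comp (g : 𝒳 × 𝒴 × ((i : Fin (k + l)) → 𝒳h i) → ℝ) :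
      ∑ ω, reweight w U q ω * g (T ω) = ∑ ω, q ω * g (T ω) := by
    rw [← sum_prob_mul _ T g, ← sum_prob_mul q T g]
    simp only [hT]
  have law_XY : ∀ b, _ = _ := prob_comp_congr hT fun v => (v.1, v.2.1)
  have tail_U (i : Fin (k + l)) (ω ω' : Ω) (h : tailOf Xh U i ω = tailOf Xh U i ω') :
      U ω = U ω' := (Prod.mk.inj h).2
  refine ⟨w, hw, by simpa using sum_comp fun _ => 1, ⟨fun x y => ?_, fun i hi => ?_, fun i hi => ?_,
    fun i hi => ?_, fun i => ?_⟩, hcard.trans_eq (by simp [mul_assoc])⟩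
  · exact (law_XY (x, y)).trans (h.law x y)
  · rw [condMutualInfo_reweight (fun _ => 1) (fun _ _ => one_ne_zero)
      (fun ω => (law_XY _).trans (one_mul _).symm)
      (fun ω => (prob_comp_congr hT (fun v => v.2.1) _).trans (one_mul _).symm)
      fun ω ω' h _ => tail_U i ω ω' h]
    have expect_eq := hψ i
    simp only [ψ, if_pos hi] at expect_eq
    exact (h.rate_side i hi).trans_eq' expect_eq.symm
  · rw [mutualInfo_reweight (fun ω => law_XY _) (tail_U i)]
    have expect_eq := hψ i
    simp only [ψ, if_neg hi.not_gt] at expect_eq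
    exact (h.rate_plain i hi).trans_eq' expect_eq.symm
  · obtain rfl : i = e := Fin.ext (by simp only [e]; omega)
    rw [condMutualInfo_reweight (fun ω => w (U ω)) (fun _ => id)
      (fun ω => prob_reweight_of_factor q fun ω' h => (Prod.mk.inj h).2)
      (fun ω => prob_reweight_of_factor q fun ω' h => h) fun ω ω' _ h => h]
    exact hχ.trans (h.rate_direct e hi)
  · exact (h.distortion i).trans_eq' (sum_comp fun v => d i v.1 (v.2.2 i)).symm

theorem exists_mem_infoRegion_le (hl : 0 < k + l) {m : ℕ} (h : R ∈ infoRegion P d D m) :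
    ∃ m' ≤ Fintype.card 𝒳 * Fintype.card 𝒴 * (∏ i, Fintype.card (𝒳h i)) + (k + l),
      R ∈ infoRegion P d D m' := by
  classical
  obtain ⟨q, hq, hR⟩ := mem_infoRegion_iff.1 h
  obtain ⟨w, hw, hsum, hRw, hcard⟩ := hR.exists_reweight hq.1 hl
  have support (ω : Joint 𝒳 𝒴 𝒳h m) (hω : ¬ w (Joint.U ω) ≠ 0) :
      reweight w Joint.U q ω = 0 := by simp [reweight, not_not.1 hω]
  have restricted := (hRw.restrict support).congr_aux
    (U' := fun ω => (⟨Joint.U ω.1, ω.2⟩ : {u // w u ≠ 0})) fun _ _ => by simp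
  refine ⟨_, hcard, restricted.mem_infoRegion ⟨fun ω => mul_nonneg (hw _) (hq.1 _), ?_⟩⟩
  rw [← hq.2, ← hsum, ← sum_prob _ Subtype.val, prob_subtype_val support]

end Cardinality

/-! ### Independent copies -/

section Iid

variable {Ω α : Type*} {n : ℕ}

/-- The joint weights of `n` independent copies of a random variable with weights `q`. -/
def iid (q : Ω → ℝ) (ω : Fin n → Ω) : ℝ := ∏ t, q (ω t)

theorem iid_nonneg {q : Ω → ℝ} (hq : ∀ ω, 0 ≤ q ω) (ω : Fin n → Ω) : 0 ≤ iid q ω :=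
  Finset.prod_nonneg fun t _ => hq (ω t)

variable [Fintype Ω]

theorem sum_pi_prod (f : Fin n → Ω → ℝ) :
    ∑ ω : Fin n → Ω, ∏ t, f t (ω t) = ∏ t, ∑ a, f t a := by
  classical
  rw [Finset.prod_univ_sum, Fintype.piFinset_univ]

variable {q : Ω → ℝ}

theorem sum_iid (hq1 : ∑ ω, q ω = 1) : ∑ ω : Fin n → Ω, iid q ω = 1 := by
  simp only [iid, sum_pi_prod fun _ => q, hq1, Finset.prod_const_one]

theorem prob_iid (A : Ω → α) (a : Fin n → α) :
    prob (iid q) (fun ω t => A (ω t)) a = iid (prob q A) a := by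
  classical
  simp only [prob_eq_sum_ite, iid]
  rw [← sum_pi_prod (fun t ω => if A ω = a t then q ω else 0)]
  refine Finset.sum_congr rfl fun ω _ => ?_
  split_ifs with h
  · exact Finset.prod_congr rfl fun t _ => (if_pos (congrFun h t)).symm
  · obtain ⟨t, ht⟩ := Function.ne_iff.1 h
    exact (Finset.prod_eq_zero (mem_univ t) (if_neg ht)).symm

theorem sum_iid_mul_apply (hq1 : ∑ ω, q ω = 1) (t : Fin n) (f : Ω → ℝ) :
    ∑ ω : Fin n → Ω, iid q ω * f (ω t) = ∑ a, q a * f a := by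
  classical
  have factor (ω : Fin n → Ω) :
      iid q ω * f (ω t) = ∏ s, q (ω s) * (if s = t then f (ω s) else 1) := by
    rw [Finset.prod_mul_distrib]
    simp [iid]
  simp only [factor]
  rw [sum_pi_prod (fun s a => q a * (if s = t then f a else 1)), Finset.prod_eq_single t]
  · simp
  · intro s _ hs
    simp [hs, hq1]
  · simp

theorem prob_iid_apply (hq1 : ∑ ω, q ω = 1) (t : Fin n) (A : Ω → α) (a : α) :
    prob (iid q) (fun ω : Fin n → Ω => A (ω t)) a = prob q A a := by
  classical
  rw [prob_eq_sum_ite, prob_eq_sum_ite]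
  simpa using sum_iid_mul_apply hq1 t fun ω => if A ω = a then 1 else 0

theorem entropy_iid (hq : ∀ ω, 0 ≤ q ω) (hq1 : ∑ ω, q ω = 1) (A : Ω → α) :
    entropy (iid q) (fun (ω : Fin n → Ω) t => A (ω t)) = n * entropy q A := by
  have log_prob (ω : Fin n → Ω) :
      iid q ω * logb 2 (prob (iid q) (fun (ω : Fin n → Ω) t => A (ω t)) fun t => A (ω t)) =
        ∑ t, iid q ω * logb 2 (prob q A (A (ω t))) := by
    rw [← Finset.mul_sum]
    by_cases h0 : iid q ω = 0
    · simp [h0]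
    simp only [prob_iid, iid.eq_1 (prob q A)]
    rw [logb, log_prod]
    · simp only [logb, Finset.sum_div]
    · intro t _
      have : q (ω t) ≠ 0 := fun h => h0 (Finset.prod_eq_zero (mem_univ t) h)
      exact (prob_pos hq A ((hq _).lt_of_ne' this)).ne'
  unfold entropy
  simp only [log_prob]
  rw [Finset.sum_comm]
  simp only [fun t : Fin n => sum_iid_mul_apply hq1 t fun a => logb 2 (prob q A (A a))]
  simp

end Iid

/-! ### Single-letterization -/

section TimeSharing

variable {Ω α γ : Type*} {n : ℕ}

/-- The joint weights of a uniform index `t : Fin n` and an independent random variable with weights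
`Q`. -/
def timeShared (Q : Ω → ℝ) (z : Fin n × Ω) : ℝ := 1 / n * Q z.2

theorem timeShared_nonneg {Q : Ω → ℝ} (hQ : ∀ ω, 0 ≤ Q ω) (z : Fin n × Ω) :
    0 ≤ timeShared Q z := mul_nonneg (by positivity) (hQ _)

variable [Fintype Ω] {Q : Ω → ℝ}

theorem sum_timeShared_mul (f : Fin n × Ω → ℝ) :
    ∑ z, timeShared Q z * f z = 1 / n * ∑ t, ∑ ω, Q ω * f (t, ω) := by
  simp only [timeShared, Fintype.sum_prod_type, mul_assoc, Finset.mul_sum]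

theorem sum_timeShared (hn : 0 < n) (hQ1 : ∑ ω, Q ω = 1) :
    ∑ z : Fin n × Ω, timeShared Q z = 1 := by
  have := sum_timeShared_mul (Q := Q) fun _ : Fin n × Ω => 1
  simp only [mul_one, hQ1, Finset.sum_const, Finset.card_univ, Fintype.card_fin,
    nsmul_eq_mul] at this
  rw [this, one_div_mul_cancel (by positivity)]

theorem prob_timeShared (A : Fin n × Ω → α) (a : α) :
    prob (timeShared Q) A a = 1 / n * ∑ t, prob Q (fun ω => A (t, ω)) a := by
  classical
  simpa [prob_eq_sum_ite] using sum_timeShared_mul (Q := Q) fun z => if A z = a then 1 else 0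

theorem entropy_timeShared (hn : 0 < n) (hQ : ∀ ω, 0 ≤ Q ω) (hQ1 : ∑ ω, Q ω = 1)
    {A : Fin n × Ω → α} (hA : ∀ z z', A z = A z' → z.1 = z'.1) :
    entropy (timeShared Q) A = logb 2 n + 1 / n * ∑ t, entropy Q fun ω => A (t, ω) := by
  classical
  have prob_eq (t : Fin n) (ω : Ω) : prob (timeShared Q) A (A (t, ω)) =
      1 / n * prob Q (fun ω => A (t, ω)) (A (t, ω)) := by
    rw [prob_timeShared, Finset.sum_eq_single t _ (by simp)]
    intro s _ hs
    rw [prob_eq_sum_ite]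
    exact Finset.sum_eq_zero fun ω' _ => if_neg fun h => hs (hA _ _ h)
  have log_prob (t : Fin n) : ∑ ω, Q ω * logb 2 (prob (timeShared Q) A (A (t, ω))) =
      -entropy Q (fun ω => A (t, ω)) - logb 2 n := by
    rw [entropy, neg_neg, ← one_mul (logb 2 n), ← hQ1, Finset.sum_mul, ← Finset.sum_sub_distrib]
    refine Finset.sum_congr rfl fun ω _ => ?_
    rcases (hQ ω).eq_or_lt with h | h
    · simp [← h]
    rw [prob_eq, logb_mul (by positivity) (prob_pos hQ (fun ω => A (t, ω)) h).ne', one_div,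
      logb_inv]
    ring
  rw [entropy, sum_timeShared_mul fun z => logb 2 (prob (timeShared Q) A (A z))]
  simp only [log_prob, Finset.sum_sub_distrib, Finset.sum_neg_distrib, Finset.sum_const,
    Finset.card_univ, Fintype.card_fin, nsmul_eq_mul]
  field_simp
  ring

theorem condEntropy_timeShared (hn : 0 < n) (hQ : ∀ ω, 0 ≤ Q ω) (hQ1 : ∑ ω, Q ω = 1)
    (A : Fin n × Ω → α) {C : Fin n × Ω → γ} (hC : ∀ z z', C z = C z' → z.1 = z'.1) :
    n * condEntropy (timeShared Q) A C =
      ∑ t, condEntropy Q (fun ω => A (t, ω)) fun ω => C (t, ω) := by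
  simp only [condEntropy, Finset.sum_sub_distrib]
  rw [entropy_timeShared hn hQ hQ1 hC,
    entropy_timeShared hn hQ hQ1 fun z z' h => hC z z' (Prod.mk.inj h).2]
  field_simp
  ring

end TimeSharing

section SingleLetterization

variable {𝒲 α β γ σ τ : Type*} {n : ℕ}

/-- The letters of a sequence before position `t`. -/
def past (t : ℕ) (w : Fin n → 𝒲) (s : Fin n) : Option 𝒲 := if (s : ℕ) < t then some (w s) else none

theorem past_eq_iff {t : ℕ} {w w' : Fin n → 𝒲} :
    past t w = past t w' ↔ ∀ s : Fin n, (s : ℕ) < t → w s = w' s := by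
  rw [funext_iff]
  refine forall_congr' fun s => ?_
  by_cases h : (s : ℕ) < t <;> simp [past, h]

theorem past_succ_eq_iff {t : Fin n} {w w' : Fin n → 𝒲} :
    past (t + 1) w = past (t + 1) w' ↔ w t = w' t ∧ past t w = past t w' := by
  simp only [past_eq_iff, Nat.lt_succ_iff_lt_or_eq, or_imp, forall_and, Fin.val_inj, forall_eq,
    and_comm]

/-- The letter of the sequence `z.2` at the random time `z.1`. -/
def letter (z : Fin n × (Fin n → 𝒲)) : 𝒲 := z.2 z.1

variable [Fintype 𝒲]

theorem sum_condEntropy_past (Q : (Fin n → 𝒲) → ℝ) (S : (Fin n → 𝒲) → σ) :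
    ∑ t : Fin n, condEntropy Q (fun w => w t) (fun w => (S w, past t w)) =
      condEntropy Q (fun w => w) S := by
  have step (t : Fin n) : condEntropy Q (fun w => w t) (fun w => (S w, past t w)) =
      entropy Q (fun w => (S w, past (t + 1) w)) - entropy Q fun w => (S w, past t w) := by
    rw [condEntropy, entropy_congr fun w w' => ?_]
    simp only [Prod.mk.injEq, past_succ_eq_iff]
    tauto
  simp only [step]
  rw [Fin.sum_univ_eq_sum_range (fun t => entropy Q (fun w => (S w, past (t + 1) w)) -
    entropy Q fun w => (S w, past t w)) n,
    Finset.sum_range_sub (fun t => entropy Q fun w => (S w, past t w)), condEntropy]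
  congr 1
  · refine entropy_congr fun w w' => ?_
    simp only [Prod.mk.injEq, past_eq_iff, Fin.is_lt, forall_const]
    rw [and_comm, funext_iff]
  · exact entropy_congr fun w w' => by simp [past_eq_iff]

variable {Q : (Fin n → 𝒲) → ℝ} {S : (Fin n → 𝒲) → σ} {C : Fin n × (Fin n → 𝒲) → γ}

theorem condEntropy_le_mul_condEntropy_letter (hn : 0 < n) (hQ : ∀ w, 0 ≤ Q w)
    (hQ1 : ∑ w, Q w = 1) (hC : ∀ z z', C z = C z' → z.1 = z'.1)
    (h : ∀ (t : Fin n) w w', S w = S w' → past t w = past t w' → C (t, w) = C (t, w')) :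
    condEntropy Q (fun w => w) S ≤ n * condEntropy (timeShared Q) letter C := by
  rw [← sum_condEntropy_past, condEntropy_timeShared hn hQ hQ1 _ hC]
  exact Finset.sum_le_sum fun t _ => condEntropy_anti hQ _ fun w w' e =>
    h t w w' (Prod.mk.inj e).1 (Prod.mk.inj e).2

theorem mul_condEntropy_letter_le_condEntropy (hn : 0 < n) (hQ : ∀ w, 0 ≤ Q w)
    (hQ1 : ∑ w, Q w = 1) (hC : ∀ z z', C z = C z' → z.1 = z'.1)
    (h : ∀ (t : Fin n) w w', C (t, w) = C (t, w') → S w = S w' ∧ past t w = past t w') :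
    n * condEntropy (timeShared Q) letter C ≤ condEntropy Q (fun w => w) S := by
  rw [← sum_condEntropy_past, condEntropy_timeShared hn hQ hQ1 _ hC]
  exact Finset.sum_le_sum fun t _ => condEntropy_anti hQ _ fun w w' e => Prod.ext_iff.2 (h t w w' e)

theorem condEntropy_self_eq_sub (Q : (Fin n → 𝒲) → ℝ) (S : (Fin n → 𝒲) → σ) :
    condEntropy Q (fun w => w) S = entropy Q (fun w => w) - entropy Q S := by
  rw [condEntropy, entropy_pair_self]

theorem mul_condMutualInfo_letter_le {S' : (Fin n → 𝒲) → τ} {B : Fin n × (Fin n → 𝒲) → β}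
    (hn : 0 < n) (hQ : ∀ w, 0 ≤ Q w) (hQ1 : ∑ w, Q w = 1)
    (hC : ∀ z z', C z = C z' → z.1 = z'.1)
    (hCS : ∀ (t : Fin n) w w', C (t, w) = C (t, w') → S w = S w' ∧ past t w = past t w')
    (hBC : ∀ (t : Fin n) w w', S w = S w' → S' w = S' w' → past t w = past t w' →
      B (t, w) = B (t, w') ∧ C (t, w) = C (t, w')) :
    n * condMutualInfo (timeShared Q) letter B C ≤ entropy Q S' := by
  have given_C := mul_condEntropy_letter_le_condEntropy hn hQ hQ1 hC hCS
  have given_BC := condEntropy_le_mul_condEntropy_letter hn hQ hQ1 (S := fun w => (S w, S' w))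
    (C := fun z => (B z, C z)) (fun z z' e => hC z z' (Prod.mk.inj e).2) fun t w w' e hpast =>
      Prod.ext_iff.2 (hBC t w w' (Prod.mk.inj e).1 (Prod.mk.inj e).2 hpast)
  have subadditive := entropy_pair_le_add hQ hQ1 S S'
  rw [condEntropy_self_eq_sub] at given_C given_BC
  rw [condMutualInfo_eq_sub_condEntropy (timeShared_nonneg hQ), mul_sub]
  linarith

theorem prob_timeShared_letter {q : 𝒲 → ℝ} (hn : 0 < n) (hq1 : ∑ a, q a = 1) (A : 𝒲 → α) (a : α) :
    prob (timeShared (n := n) (iid q)) (fun z => A (letter z)) a = prob q A a := by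
  rw [prob_timeShared]
  simp only [letter, prob_iid_apply hq1, Finset.sum_const, Finset.card_univ, Fintype.card_fin,
    nsmul_eq_mul]
  field_simp

theorem mul_entropy_letter [Finite α] {q : 𝒲 → ℝ} (hn : 0 < n) (hq : ∀ a, 0 ≤ q a)
    (hq1 : ∑ a, q a = 1) (A : 𝒲 → α) :
    n * entropy (timeShared (n := n) (iid q)) (fun z => A (letter z)) =
      entropy (iid q) fun (w : Fin n → 𝒲) t => A (w t) := by
  rw [entropy_iid hq hq1, entropy_eq_of_prob_eq (prob_timeShared_letter hn hq1 A)]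

theorem mul_mutualInfo_letter_le {q : 𝒲 → ℝ} (hn : 0 < n) (hq : ∀ a, 0 ≤ q a)
    (hq1 : ∑ a, q a = 1) (hC : ∀ z z', C z = C z' → z.1 = z'.1)
    (h : ∀ (t : Fin n) w w', S w = S w' → past t w = past t w' → C (t, w) = C (t, w')) :
    n * mutualInfo (timeShared (iid q)) letter C ≤ entropy (iid q) S := by
  have given_C := condEntropy_le_mul_condEntropy_letter hn (iid_nonneg hq) (sum_iid hq1) hC h
  rw [condEntropy_self_eq_sub] at given_C
  rw [mutualInfo_eq_sub_condEntropy (timeShared_nonneg (iid_nonneg hq)), mul_sub,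
    mul_entropy_letter hn hq hq1 fun a => a]
  linarith

theorem mul_condMutualInfo_letter_side_le [Fintype α] [Fintype β] {q : α × β → ℝ}
    {S : (Fin n → α × β) → σ} {B : Fin n × (Fin n → α × β) → γ} (hn : 0 < n) (hq : ∀ a, 0 ≤ q a)
    (hq1 : ∑ a, q a = 1) (hB : ∀ z z', B z = B z' → z.1 = z'.1)
    (h : ∀ (t : Fin n) w w', S w = S w' → (∀ s, (w s).2 = (w' s).2) → past t w = past t w' →
      B (t, w) = B (t, w')) :
    n * condMutualInfo (timeShared (iid q)) (fun z => (letter z).1) B (fun z => (letter z).2) ≤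
      entropy (iid q) S := by
  have given_B := condEntropy_le_mul_condEntropy_letter hn (iid_nonneg hq) (sum_iid hq1)
    (S := fun w => (S w, fun s => (w s).2)) (C := fun z => (B z, (letter z).2))
    (fun z z' e => hB z z' (Prod.mk.inj e).1) fun t w w' e hpast => by
      simp only [Prod.mk.injEq, funext_iff] at e ⊢
      exact ⟨h t w w' e.1 e.2 hpast, e.2 t⟩
  have subadditive := entropy_pair_le_add (iid_nonneg hq) (sum_iid hq1) S fun w s => (w s).2
  have entropy_letter := mul_entropy_letter hn hq hq1 fun a => a
  have entropy_side := mul_entropy_letter hn hq hq1 Prod.snd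
  rw [condEntropy_self_eq_sub] at given_B
  rw [condMutualInfo_eq_sub_condEntropy (timeShared_nonneg (iid_nonneg hq)),
    condEntropy_congr (A' := letter) (C' := fun z => (B z, (letter z).2))
      (fun z z' e => by simp [Prod.ext_iff, (Prod.mk.inj e).2]) fun _ _ => Iff.rfl,
    condEntropy, mul_sub, mul_sub]
  linarith

end SingleLetterization

/-! ### The converse -/

section Converse

variable {k l n : ℕ} {𝒳 𝒴 : Type*} {𝒳h : Fin (k + l) → Type*}
  {P : 𝒳 × 𝒴 → ℝ} {d : (i : Fin (k + l)) → 𝒳 → 𝒳h i → ℝ} {D : Fin (k + l) → ℝ}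
  {R : Fin (k + l + 1) → ℝ} {M : Fin (k + l + 1) → ℕ}

theorem sideView_congr {σ : Type*} {y y' : σ} {i j : ℕ} (hij : j ≤ i) (hy : j < k → y = y') :
    sideView k y i = sideView k y' i := by
  unfold sideView
  split_ifs with h
  · rw [hy (by omega)]
  · rfl

namespace Code

theorem msg_congr (c : Code k l n 𝒳 𝒴 𝒳h M) {x x' : Fin n → 𝒳} {y y' : Fin n → 𝒴} {j : ℕ}
    (hj : j < k + l) (hy : j < k → y = y') (hm : c.msg x y j hj = c.msg x' y' j hj) {i : ℕ}
    (hji : j ≤ i) (hi : i < k + l) : c.msg x y i hi = c.msg x' y' i hi := by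
  induction i, hji using Nat.le_induction with
  | base => exact hm
  | succ i hji ih => rw [msg, msg, ih (by omega), sideView_congr hji hy]

theorem recon_congr (c : Code k l n 𝒳 𝒴 𝒳h M) {x x' : Fin n → 𝒳} {y y' : Fin n → 𝒴} {j : ℕ}
    (hj : j < k + l) (hy : j < k → y = y') (hm : c.msg x y j hj = c.msg x' y' j hj)
    {i : Fin (k + l)} (hji : j ≤ i)
    (hdir : (i : ℕ) + 1 = k + l → c.direct x y = c.direct x' y') :
    c.recon x y i = c.recon x' y' i := by
  unfold recon
  rw [c.msg_congr hj hy hm hji, sideView_congr hji hy]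
  congr 1
  unfold directView
  split_ifs with h
  · rw [hdir h]
  · rfl

/-- The message on link `i < k + l`, as a function of the block of source pairs. -/
def blockMsg (c : Code k l n 𝒳 𝒴 𝒳h M) (i : ℕ) (hi : i < k + l) (w : Fin n → 𝒳 × 𝒴) :
    Fin (M ⟨i, by omega⟩) :=
  c.msg (fun t => (w t).1) (fun t => (w t).2) i hi

/-- The message on the direct link, as a function of the block of source pairs. -/
def blockDirect (c : Code k l n 𝒳 𝒴 𝒳h M) (w : Fin n → 𝒳 × 𝒴) : Fin (M (Fin.last (k + l))) :=
  c.direct (fun t => (w t).1) (fun t => (w t).2)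

/-- The letter that user `i` reconstructs at the random time `z.1`. -/
def letterRecon (c : Code k l n 𝒳 𝒴 𝒳h M) (i : Fin (k + l)) (z : Fin n × (Fin n → 𝒳 × 𝒴)) :
    𝒳h i :=
  c.recon (fun t => (z.2 t).1) (fun t => (z.2 t).2) i z.1

/-- The auxiliary variable of the converse: the random time, the message that the last user receives
from its predecessor, and the source pairs before the random time. -/
def aux (c : Code k l n 𝒳 𝒴 𝒳h M) (hkl : 0 < k + l) (z : Fin n × (Fin n → 𝒳 × 𝒴)) :
    Fin n × Fin (M ⟨k + l - 1, by omega⟩) × (Fin n → Option (𝒳 × 𝒴)) :=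
  (z.1, c.blockMsg (k + l - 1) (by omega) z.2, past z.1 z.2)

theorem tailOf_congr (c : Code k l n 𝒳 𝒴 𝒳h M) (hkl : 0 < k + l) {i : Fin (k + l)} {t : Fin n}
    {w w' : Fin n → 𝒳 × 𝒴} (hmsg : c.blockMsg i i.2 w = c.blockMsg i i.2 w')
    (hside : (i : ℕ) < k → ∀ s, (w s).2 = (w' s).2) (hpast : past t w = past t w') :
    tailOf c.letterRecon (c.aux hkl) i (t, w) = tailOf c.letterRecon (c.aux hkl) i (t, w') := by
  have side (h : (i : ℕ) < k) : (fun s => (w s).2) = fun s => (w' s).2 := funext (hside h)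
  refine Prod.ext (funext fun j => ?_) (Prod.ext rfl (Prod.ext ?_ hpast))
  · exact congrFun (c.recon_congr i.2 side hmsg j.2.1 fun h => absurd h j.2.2.ne) t
  · exact c.msg_congr i.2 side hmsg (by omega) (by omega)

theorem fst_eq_of_tailOf_eq (c : Code k l n 𝒳 𝒴 𝒳h M) (hkl : 0 < k + l) {i : Fin (k + l)}
    (z z' : Fin n × (Fin n → 𝒳 × 𝒴))
    (h : tailOf c.letterRecon (c.aux hkl) i z = tailOf c.letterRecon (c.aux hkl) i z') :
    z.1 = z'.1 :=
  (Prod.mk.inj (Prod.mk.inj h).2).1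

end Code

theorem sum_sum_eq_sum_pair [Fintype 𝒳] [Fintype 𝒴] (f : (Fin n → 𝒳) → (Fin n → 𝒴) → ℝ) :
    ∑ x, ∑ y, f x y = ∑ w : Fin n → 𝒳 × 𝒴, f (fun t => (w t).1) (fun t => (w t).2) := by
  rw [← Fintype.sum_prod_type']
  exact (Fintype.sum_equiv (Equiv.arrowProdEquivProdArrow (Fin n) (fun _ => 𝒳) (fun _ => 𝒴)) _ _
    fun w => rfl).symm

theorem entropy_le_of_card_le {Ω : Type*} [Fintype Ω] {q : Ω → ℝ} {m : ℕ} {r : ℝ}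
    (hq : q ∈ stdSimplex ℝ Ω) (hm : (m : ℝ) ≤ 2 ^ r) (A : Ω → Fin m) : entropy q A ≤ r := by
  obtain ⟨ω⟩ : Nonempty Ω := nonempty_of_sum_eq_one hq.2
  have hm_pos : (0 : ℝ) < m := Nat.cast_pos.2 (A ω).pos
  calc entropy q A ≤ logb 2 (Fintype.card (Fin m)) := entropy_le_logb_card hq.1 hq.2 A
    _ ≤ r := by rwa [Fintype.card_fin, logb_le_iff_le_rpow one_lt_two hm_pos]

namespace Code

variable [Fintype 𝒳] [Fintype 𝒴] (c : Code k l n 𝒳 𝒴 𝒳h M) (hkl : 0 < k + l)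

theorem sum_timeShared_mul_letterRecon (i : Fin (k + l)) :
    ∑ z, timeShared (iid P) z * d i (letter z).1 (c.letterRecon i z) = c.expDistortion P d i := by
  unfold expDistortion
  rw [sum_sum_eq_sum_pair, sum_timeShared_mul fun z => d i (letter z).1 (c.letterRecon i z),
    Finset.sum_comm, Finset.mul_sum]
  refine Finset.sum_congr rfl fun w _ => ?_
  simp only [iid, letter, letterRecon, Finset.mul_sum]
  exact Finset.sum_congr rfl fun t _ => by ring

theorem mul_condMutualInfo_tailOf_le (hP : P ∈ stdSimplex ℝ (𝒳 × 𝒴)) (hn : 0 < n)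
    (i : Fin (k + l)) :
    n * condMutualInfo (timeShared (iid P)) (fun z => (letter z).1)
      (tailOf c.letterRecon (c.aux hkl) i) (fun z => (letter z).2) ≤
    entropy (iid P) (c.blockMsg i i.2) :=
  mul_condMutualInfo_letter_side_le hn hP.1 hP.2 (c.fst_eq_of_tailOf_eq hkl)
    fun _ _ _ hmsg hside hpast => c.tailOf_congr hkl hmsg (fun _ => hside) hpast

theorem mul_mutualInfo_tailOf_le (hP : P ∈ stdSimplex ℝ (𝒳 × 𝒴)) (hn : 0 < n)
    {i : Fin (k + l)} (hi : k ≤ i) :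
    n * mutualInfo (timeShared (iid P)) letter (tailOf c.letterRecon (c.aux hkl) i) ≤
      entropy (iid P) (c.blockMsg i i.2) :=
  mul_mutualInfo_letter_le hn hP.1 hP.2 (c.fst_eq_of_tailOf_eq hkl)
    fun _ _ _ hmsg hpast => c.tailOf_congr hkl hmsg (fun h => absurd h hi.not_gt) hpast

theorem mul_condMutualInfo_letterRecon_le (hP : P ∈ stdSimplex ℝ (𝒳 × 𝒴)) (hn : 0 < n)
    (hl : 0 < l) {i : Fin (k + l)} (hi : (i : ℕ) + 1 = k + l) :
    n * condMutualInfo (timeShared (iid P)) (fun z => (letter z).1) (c.letterRecon i)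
      (c.aux hkl) ≤ entropy (iid P) c.blockDirect := by
  have last_lt : k + l - 1 < k + l := by omega
  obtain rfl : i = ⟨k + l - 1, last_lt⟩ := Fin.ext (by simp only; omega)
  have le_pair := condMutualInfo_mono_left (timeShared_nonneg (n := n) (iid_nonneg hP.1))
    (A := letter) (A' := fun z => (letter z).1) (c.letterRecon ⟨k + l - 1, last_lt⟩) (c.aux hkl)
    fun _ _ h => congrArg Prod.fst h
  refine (mul_le_mul_of_nonneg_left le_pair n.cast_nonneg).trans ?_
  refine mul_condMutualInfo_letter_le (S := c.blockMsg _ last_lt) hn (iid_nonneg hP.1)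
    (sum_iid hP.2) (fun z z' h => (Prod.mk.inj h).1)
    (fun _ _ _ h => Prod.mk.inj (Prod.mk.inj h).2) ?_
  intro t w w' hmsg hdirect hpast
  have side (h : k + l - 1 < k) : (fun s => (w s).2) = fun s => (w' s).2 := by omega
  exact ⟨congrFun (c.recon_congr _ side hmsg le_rfl fun _ => hdirect) t,
    Prod.ext rfl (Prod.ext hmsg hpast)⟩

theorem exists_mem_infoRegion [∀ i, Fintype (𝒳h i)] (hP : P ∈ stdSimplex ℝ (𝒳 × 𝒴))
    (hl : 0 < l) (hn : 0 < n) (hM : ∀ i, (M i : ℝ) ≤ (2 : ℝ) ^ ((n : ℝ) * R i))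
    (hc : ∀ i, c.expDistortion P d i ≤ D i) : ∃ m, R ∈ infoRegion P d D m := by
  have hkl : 0 < k + l := by omega
  have iid_mem : iid P ∈ stdSimplex ℝ (Fin n → 𝒳 × 𝒴) := ⟨iid_nonneg hP.1, sum_iid hP.2⟩
  have le_rate {a : ℝ} {i : Fin (k + l + 1)} {A : (Fin n → 𝒳 × 𝒴) → Fin (M i)}
      (h : n * a ≤ entropy (iid P) A) : a ≤ R i :=
    le_of_mul_le_mul_left (h.trans (entropy_le_of_card_le iid_mem (hM i) A)) (Nat.cast_pos.2 hn)
  have bounds : SatisfiesBounds P d D R (timeShared (n := n) (iid P)) (fun z => (letter z).1)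
      (fun z => (letter z).2) c.letterRecon (c.aux hkl) :=
    { law := fun x y =>
        (prob_timeShared_letter hn hP.2 (fun a => a) (x, y)).trans (prob_self P (x, y))
      rate_side := fun i _ => le_rate (c.mul_condMutualInfo_tailOf_le hkl hP hn i)
      rate_plain := fun _ hi => le_rate (c.mul_mutualInfo_tailOf_le hkl hP hn hi)
      rate_direct := fun _ hi => le_rate (c.mul_condMutualInfo_letterRecon_le hkl hP hn hl hi)
      distortion := fun i => (c.sum_timeShared_mul_letterRecon i).trans_le (hc i) }
  exact ⟨_, bounds.mem_infoRegion
    ⟨timeShared_nonneg iid_mem.1, sum_timeShared hn iid_mem.2⟩⟩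

end Code

end Converse

/-! ### Random codebooks -/

section Codebook

variable {B : Type*} [Fintype B] {μ : B → ℝ}

theorem sum_iid_mul_prod (μ f : B → ℝ) (M : ℕ) :
    ∑ c : Fin M → B, iid μ c * ∏ m, f (c m) = (∑ b, μ b * f b) ^ M := by
  simp only [iid, ← Finset.prod_mul_distrib]
  rw [sum_pi_prod fun _ b => μ b * f b, Finset.prod_const, Finset.card_univ, Fintype.card_fin]

theorem sum_iid_mul_ite_exists_le (hμ : ∀ b, 0 ≤ μ b) (hμ1 : ∑ b, μ b = 1) {G : B → Prop}
    [DecidablePred G] {p : ℝ} (hG : p ≤ ∑ b with G b, μ b) (M : ℕ) :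
    ∑ c : Fin M → B, iid μ c * (if ∃ m, G (c m) then 0 else 1) ≤ (1 - p) ^ M := by
  have indicator (c : Fin M → B) :
      (if ∃ m, G (c m) then (0 : ℝ) else 1) = ∏ m, if G (c m) then (0 : ℝ) else 1 := by
    by_cases h : ∃ m, G (c m)
    · rw [if_pos h]
      obtain ⟨m, hm⟩ := h
      exact (Finset.prod_eq_zero (mem_univ m) (if_pos hm : ite _ (0 : ℝ) 1 = 0)).symm
    · rw [if_neg h]
      exact (Finset.prod_eq_one fun m _ => if_neg fun hm => h ⟨m, hm⟩).symm
  have miss : ∑ b, μ b * (if G b then 0 else 1) = ∑ b with ¬G b, μ b := by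
    simp only [Finset.sum_filter, mul_ite, mul_zero, mul_one, ite_not]
  simp only [indicator, sum_iid_mul_prod μ fun b => if G b then 0 else 1]
  rw [miss]
  refine pow_le_pow_left₀ (Finset.sum_nonneg fun b _ => hμ b) ?_ M
  have := Finset.sum_filter_add_sum_filter_not univ G μ
  linarith

theorem sum_iid_mul_exp_card_le (hμ : ∀ b, 0 ≤ μ b) (hμ1 : ∑ b, μ b = 1) {L : B → Prop}
    [DecidablePred L] {r : ℝ} (hL : ∑ b with L b, μ b ≤ r) (M : ℕ) :
    ∑ c : Fin M → B, iid μ c * exp #{m | L (c m)} ≤ exp (2 * r * M) := by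
  have exp_card (c : Fin M → B) :
      exp #{m | L (c m)} = ∏ m, exp (if L (c m) then 1 else 0) := by
    rw [← exp_sum, Finset.sum_boole]
  have single : ∑ b, μ b * exp (if L b then 1 else 0) = 1 + (exp 1 - 1) * ∑ b with L b, μ b := by
    refine Eq.trans ?_ (congrArg (· + _) hμ1)
    rw [Finset.sum_filter, Finset.mul_sum, ← Finset.sum_add_distrib]
    refine Finset.sum_congr rfl fun b _ => ?_
    split_ifs
    · ring
    · simp
  have single_le : ∑ b, μ b * exp (if L b then 1 else 0) ≤ exp (2 * r) := by
    have exp_one_sub_le : exp 1 - 1 ≤ 2 := by linarith [exp_one_lt_three]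
    have := mul_le_mul exp_one_sub_le hL (Finset.sum_nonneg fun b _ => hμ b) zero_le_two
    linarith [add_one_le_exp (2 * r)]
  simp only [exp_card, sum_iid_mul_prod μ fun b => exp (if L b then 1 else 0)]
  calc _ ≤ exp (2 * r) ^ M := pow_le_pow_left₀
        (Finset.sum_nonneg fun b _ => mul_nonneg (hμ b) (exp_pos _).le) single_le M
    _ = exp (2 * r * M) := by rw [← exp_nat_mul, mul_comm]

/-- The number of sets missed, plus the number of lists that are too long, has expectation less
than `1` for a random codebook. -/
theorem exists_codebook {ι κ : Type*} [Fintype ι] [Fintype κ] (hμ : ∀ b, 0 ≤ μ b)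
    (hμ1 : ∑ b, μ b = 1) {G : ι → B → Prop} [∀ w, DecidablePred (G w)] {p : ℝ}
    (hG : ∀ w, p ≤ ∑ b with G w b, μ b) {L : κ → B → Prop} [∀ y, DecidablePred (L y)] {r : ℝ}
    (hL : ∀ y, ∑ b with L y b, μ b ≤ r) {M : ℕ} {K : ℝ}
    (h : Fintype.card ι * (1 - p) ^ M + Fintype.card κ * exp (2 * r * M - K) < 1) :
    ∃ c : Fin M → B, (∀ w, ∃ m, G w (c m)) ∧ ∀ y, (#{m | L y (c m)} : ℝ) ≤ K := by
  let misses (c : Fin M → B) : ℝ := ∑ w, if ∃ m, G w (c m) then 0 else 1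
  let overflows (c : Fin M → B) : ℝ := ∑ y, exp (-K) * exp #{m | L y (c m)}
  have misses_le : ∑ c, iid μ c * misses c ≤ Fintype.card ι * (1 - p) ^ M := by
    simp only [misses, Finset.mul_sum]
    rw [Finset.sum_comm, ← nsmul_eq_mul]
    exact Finset.sum_le_card_nsmul _ _ _ fun w _ => sum_iid_mul_ite_exists_le hμ hμ1 (hG w) M
  have overflows_le :
      ∑ c, iid μ c * overflows c ≤ Fintype.card κ * exp (2 * r * M - K) := by
    simp only [overflows, Finset.mul_sum, mul_left_comm _ (exp (-K))]
    rw [Finset.sum_comm, ← nsmul_eq_mul]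
    refine Finset.sum_le_card_nsmul _ _ _ fun y _ => ?_
    rw [← Finset.mul_sum, sub_eq_add_neg, exp_add, mul_comm (exp (2 * r * M))]
    exact mul_le_mul_of_nonneg_left (sum_iid_mul_exp_card_le hμ hμ1 (hL y) M) (exp_pos _).le
  obtain ⟨c, -, hc⟩ : ∃ c ∈ univ, iid μ c * (misses c + overflows c) < iid μ c * 1 := by
    refine Finset.exists_lt_of_sum_lt ?_
    simp only [mul_add, mul_one, Finset.sum_add_distrib, sum_iid hμ1]
    linarith
  have cost_lt_one : misses c + overflows c < 1 := lt_of_mul_lt_mul_left hc (iid_nonneg hμ c)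
  have misses_nonneg : ∀ w ∈ univ, (0 : ℝ) ≤ if ∃ m, G w (c m) then 0 else 1 := fun w _ => by
    split_ifs <;> norm_num
  have overflows_nonneg : ∀ y ∈ univ, 0 ≤ exp (-K) * exp #{m | L y (c m)} := fun y _ =>
    (mul_pos (exp_pos _) (exp_pos _)).le
  refine ⟨c, fun w => ?_, fun y => ?_⟩
  · by_contra hw
    have := Finset.single_le_sum misses_nonneg (mem_univ w)
    rw [if_neg hw] at this
    linarith [Finset.sum_nonneg overflows_nonneg]
  · have := Finset.single_le_sum overflows_nonneg (mem_univ y)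
    rw [← exp_add] at this
    have exp_lt : exp (-K + #{m | L y (c m)}) < 1 := by
      linarith [Finset.sum_nonneg misses_nonneg]
    linarith [exp_lt_one_iff.1 exp_lt]

end Codebook

/-! ### One layer of a superposition code -/

section Layer

variable {Ω 𝒲 σ α β β' : Type*} [Fintype Ω]

open Classical in
theorem sum_fiber_prob [Fintype β] (q : Ω → ℝ) (A : Ω → α) {V : Ω → β} {V' : Ω → β'} {ρ : β → β'}
    (hρ : ∀ ω, ρ (V ω) = V' ω) (a : α) (v' : β') :
    ∑ v with ρ v = v', prob q (fun ω => (A ω, V ω)) (a, v) =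
      prob q (fun ω => (A ω, V' ω)) (a, v') := by
  have point (ω : Ω) : ∑ v with ρ v = v', (if (A ω, V ω) = (a, v) then q ω else 0) =
      if (A ω, V' ω) = (a, v') then q ω else 0 := by
    simp only [Prod.mk.injEq, ite_and, Finset.sum_filter, ← hρ ω]
    rw [Finset.sum_eq_single (V ω)]
    · simp only [if_true]
      split_ifs <;> rfl
    · intro v _ hv
      simp only [if_neg hv.symm, ite_self]
    · simp
  simp only [prob_eq_sum_ite]
  rw [Finset.sum_comm]
  exact Finset.sum_congr rfl fun ω _ => by convert point ω

/-- The word `v` extends `v'`, and its density with the side information `y`, relative to that of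
`v'`, is not less than `1 / b`. -/
def Compatible (Q : Ω → ℝ) (Y : Ω → σ) (V : Ω → β) (V' : Ω → β') (ρ : β → β') (b : ℝ) (y : σ)
    (v' : β') (v : β) : Prop :=
  ρ v = v' ∧ 0 < prob Q (fun ω => (Y ω, V' ω)) (y, v') ∧
    prob Q (fun ω => (Y ω, V' ω)) (y, v') * prob Q V v ≤
      b * (prob Q V' v' * prob Q (fun ω => (Y ω, V ω)) (y, v))

open Classical in
/-- Given that the source block is `w` and that the word is `v`, the probability that `T` fails is
at most `δ`. -/
def Likely (Q : Ω → ℝ) (W : Ω → 𝒲) (V : Ω → β) (T : Ω → Prop) (δ : ℝ) (w : 𝒲) (v : β) : Prop :=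
  0 < prob Q (fun ω => (W ω, V ω)) (w, v) ∧
    prob (fun ω => if T ω then 0 else Q ω) (fun ω => (W ω, V ω)) (w, v) ≤
      δ * prob Q (fun ω => (W ω, V ω)) (w, v)

open Classical in
/-- The law of the word `V` given that its prefix `V'` is `v'`. -/
def extensionLaw (Q : Ω → ℝ) (V : Ω → β) (V' : Ω → β') (ρ : β → β') (v' : β') (v : β) : ℝ :=
  if ρ v = v' then prob Q V v / prob Q V' v' else 0

variable {Q : Ω → ℝ} {W : Ω → 𝒲} {Y : Ω → σ} {V : Ω → β} {V' : Ω → β'} {ρ : β → β'}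
  {T : Ω → Prop} {δ : ℝ}

open Classical in
theorem Likely.exists {w : 𝒲} {v : β} (hδ : δ < 1) (h : Likely Q W V T δ w v) :
    ∃ ω, T ω ∧ 0 < Q ω ∧ W ω = w ∧ V ω = v := by
  have split : prob Q (fun ω => (W ω, V ω)) (w, v) =
      prob (fun ω => if T ω then Q ω else 0) (fun ω => (W ω, V ω)) (w, v) +
      prob (fun ω => if T ω then 0 else Q ω) (fun ω => (W ω, V ω)) (w, v) := by
    unfold prob
    rw [← Finset.sum_add_distrib]
    exact Finset.sum_congr rfl fun ω _ => by split_ifs <;> simp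
  have success_pos :
      0 < prob (fun ω => if T ω then Q ω else 0) (fun ω => (W ω, V ω)) (w, v) := by
    obtain ⟨hpos, hfail⟩ := h
    nlinarith
  obtain ⟨ω, hω, hQω⟩ := exists_of_prob_pos success_pos
  by_cases hT : T ω
  · exact ⟨ω, hT, by simpa only [hT, if_true] using hQω, (Prod.mk.inj hω).1, (Prod.mk.inj hω).2⟩
  · simp [hT] at hQω

theorem extensionLaw_nonneg (hQ : ∀ ω, 0 ≤ Q ω) (v' : β') (v : β) :
    0 ≤ extensionLaw Q V V' ρ v' v := by
  unfold extensionLaw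
  split_ifs
  exacts [div_nonneg (prob_nonneg hQ _ _) (prob_nonneg hQ _ _), le_rfl]

theorem sum_extensionLaw [Fintype β] (hρ : ∀ ω, ρ (V ω) = V' ω) {v' : β'} (hv' : prob Q V' v' ≠ 0) :
    ∑ v, extensionLaw Q V V' ρ v' v = 1 := by
  have fiber := sum_fiber_prob Q (fun _ => ()) hρ () v'
  simp only [prob_unit_pair] at fiber
  simp only [extensionLaw]
  rw [← Finset.sum_filter, ← Finset.sum_div, fiber, div_self hv']

open Classical in
/-- Markov's inequality for the conditional failure probability. -/
theorem Likely.le_two_mul_sum [Fintype β] (hQ : ∀ ω, 0 ≤ Q ω) (hρ : ∀ ω, ρ (V ω) = V' ω)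
    (hδ : 0 < δ) {w : 𝒲} {v' : β'} (h : Likely Q W V' T δ w v') :
    prob Q (fun ω => (W ω, V' ω)) (w, v') ≤
      2 * ∑ v with ρ v = v' ∧ Likely Q W V T (2 * δ) w v,
        prob Q (fun ω => (W ω, V ω)) (w, v) := by
  let F (v : β) := prob Q (fun ω => (W ω, V ω)) (w, v)
  let E (v : β) := prob (fun ω => if T ω then 0 else Q ω) (fun ω => (W ω, V ω)) (w, v)
  have E_nonneg (v : β) : 0 ≤ E v := prob_nonneg (fun ω => by split_ifs; exacts [le_rfl, hQ ω]) _ _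
  have unlikely_le (v : β) (hv : ¬Likely Q W V T (2 * δ) w v) : 2 * δ * F v ≤ E v := by
    by_contra hlt
    have F_pos : 0 < F v := by nlinarith [E_nonneg v, not_le.1 hlt]
    exact hv ⟨F_pos, (not_le.1 hlt).le⟩
  have sum_unlikely_le : 2 * δ * ∑ v with ρ v = v' ∧ ¬Likely Q W V T (2 * δ) w v, F v ≤
      δ * prob Q (fun ω => (W ω, V' ω)) (w, v') :=
    calc _ ≤ ∑ v with ρ v = v' ∧ ¬Likely Q W V T (2 * δ) w v, E v := by
          rw [Finset.mul_sum]
          exact Finset.sum_le_sum fun v hv => unlikely_le v (mem_filter.1 hv).2.2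
      _ ≤ ∑ v with ρ v = v', E v := by
          refine Finset.sum_le_sum_of_subset_of_nonneg (fun v hv => ?_) fun v _ _ => E_nonneg v
          exact mem_filter.2 ⟨mem_univ v, (mem_filter.1 hv).2.1⟩
      _ = prob (fun ω => if T ω then 0 else Q ω) (fun ω => (W ω, V' ω)) (w, v') :=
          sum_fiber_prob _ W hρ w v'
      _ ≤ _ := h.2
  have sum_split := Finset.sum_filter_add_sum_filter_not (univ.filter fun v => ρ v = v')
    (fun v => Likely Q W V T (2 * δ) w v) F
  rw [Finset.filter_filter, Finset.filter_filter, sum_fiber_prob Q W hρ] at sum_split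
  have := le_of_mul_le_mul_left (by linarith :
    δ * (2 * ∑ v with ρ v = v' ∧ ¬Likely Q W V T (2 * δ) w v, F v) ≤
      δ * prob Q (fun ω => (W ω, V' ω)) (w, v')) hδ
  linarith

/-- Hypotheses under which `M` words that extend a given word cover the source block `W` while no
side information `Y` is compatible with more than `K` of them: on the event `T`, passing from `V'`
to its extension `V` multiplies the density with `W` by at most `a` and divides the density with
`Y` by at most `b`. -/
structure IsLayer [Fintype 𝒲] [Fintype σ] (Q : Ω → ℝ) (W : Ω → 𝒲) (y : 𝒲 → σ) (V : Ω → β)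
    (V' : Ω → β') (ρ : β → β') (T : Ω → Prop) (a b : ℝ) (M : ℕ) (K : ℝ) : Prop where
  extends_prefix : ∀ ω, ρ (V ω) = V' ω
  density_le : ∀ ω, T ω → prob Q (fun ω => (W ω, V ω)) (W ω, V ω) * prob Q V' (V' ω) ≤
    a * (prob Q V (V ω) * prob Q (fun ω => (W ω, V' ω)) (W ω, V' ω))
  le_density_side : ∀ ω, T ω →
    prob Q (fun ω => (y (W ω), V' ω)) (y (W ω), V' ω) * prob Q V (V ω) ≤
      b * (prob Q V' (V' ω) * prob Q (fun ω => (y (W ω), V ω)) (y (W ω), V ω))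
  one_le : 1 ≤ a
  nonneg_side : 0 ≤ b
  nonneg_list : 0 ≤ K
  failure_lt : Fintype.card 𝒲 * (1 - 1 / (2 * a)) ^ M +
    Fintype.card σ * exp (2 * b * M - K) < 1

open Classical in
theorem sum_extensionLaw_compatible_le [Fintype β] (hQ : ∀ ω, 0 ≤ Q ω)
    (hρ : ∀ ω, ρ (V ω) = V' ω) {b : ℝ} (hb : 0 ≤ b) (y : σ) (v' : β') :
    ∑ v with Compatible Q Y V V' ρ b y v' v, extensionLaw Q V V' ρ v' v ≤ b := by
  by_cases hy : 0 < prob Q (fun ω => (Y ω, V' ω)) (y, v')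
  swap
  · rw [Finset.sum_eq_zero fun v hv => absurd (mem_filter.1 hv).2.2.1 hy]
    exact hb
  have hv' : 0 < prob Q V' v' := prob_pos_of_prob_pair_pos hQ hy
  have extensionLaw_le (v : β) (hv : Compatible Q Y V V' ρ b y v' v) : extensionLaw Q V V' ρ v' v ≤
      b * prob Q (fun ω => (Y ω, V ω)) (y, v) / prob Q (fun ω => (Y ω, V' ω)) (y, v') := by
    rw [extensionLaw, if_pos hv.1, div_le_div_iff₀ hv' hy]
    linarith [hv.2.2]
  calc _ ≤ ∑ v with Compatible Q Y V V' ρ b y v' v,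
        b * prob Q (fun ω => (Y ω, V ω)) (y, v) / prob Q (fun ω => (Y ω, V' ω)) (y, v') :=
        Finset.sum_le_sum fun v hv => extensionLaw_le v (mem_filter.1 hv).2
    _ ≤ ∑ v with ρ v = v',
        b * prob Q (fun ω => (Y ω, V ω)) (y, v) / prob Q (fun ω => (Y ω, V' ω)) (y, v') :=
        Finset.sum_le_sum_of_subset_of_nonneg
          (fun v hv => mem_filter.2 ⟨mem_univ v, (mem_filter.1 hv).2.1⟩)
          fun v _ _ => div_nonneg (mul_nonneg hb (prob_nonneg hQ _ _)) hy.le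
    _ = b := by
        rw [← Finset.sum_div, ← Finset.mul_sum, sum_fiber_prob Q Y hρ,
          mul_div_cancel_right₀ _ hy.ne']

variable [Fintype 𝒲] [Fintype σ] {y : 𝒲 → σ} {a b : ℝ} {M : ℕ} {K : ℝ}

open Classical in
theorem IsLayer.extensionLaw_ge [Fintype β] (h : IsLayer Q W y V V' ρ T a b M K)
    (hQ : ∀ ω, 0 ≤ Q ω) (hδ : 0 < δ) (hδ1 : 2 * δ < 1) {w : 𝒲} {v' : β'}
    (hw : Likely Q W V' T δ w v') :
    1 / (2 * a) ≤ ∑ v with Likely Q W V T (2 * δ) w v ∧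
      Compatible Q (fun ω => y (W ω)) V V' ρ b (y w) v' v, extensionLaw Q V V' ρ v' v := by
  have a_pos : 0 < a := zero_lt_one.trans_le h.one_le
  have extension (v : β) (hv : ρ v = v') (hL : Likely Q W V T (2 * δ) w v) :
      Compatible Q (fun ω => y (W ω)) V V' ρ b (y w) v' v ∧
      prob Q (fun ω => (W ω, V ω)) (w, v) ≤
        a * prob Q (fun ω => (W ω, V' ω)) (w, v') * extensionLaw Q V V' ρ v' v := by
    obtain ⟨ω, hω, hpos, rfl, rfl⟩ := hL.exists hδ1
    obtain rfl : V' ω = v' := (h.extends_prefix ω).symm.trans hv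
    refine ⟨⟨hv, prob_pos hQ (fun ω => (y (W ω), V' ω)) hpos, h.le_density_side ω hω⟩, ?_⟩
    rw [extensionLaw, if_pos hv, mul_div_assoc', le_div_iff₀ (prob_pos hQ V' hpos)]
    linarith [h.density_le ω hω]
  have half := hw.le_two_mul_sum hQ h.extends_prefix hδ
  rw [div_le_iff₀ (by positivity)]
  refine le_of_mul_le_mul_left ?_ hw.1
  calc _ ≤ 2 * ∑ v with ρ v = v' ∧ Likely Q W V T (2 * δ) w v,
        a * prob Q (fun ω => (W ω, V' ω)) (w, v') * extensionLaw Q V V' ρ v' v := by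
        rw [mul_one]
        refine half.trans (mul_le_mul_of_nonneg_left (Finset.sum_le_sum fun v hv => ?_) zero_le_two)
        obtain ⟨-, hv, hL⟩ := mem_filter.1 hv
        exact (extension v hv hL).2
    _ ≤ 2 * ∑ v with Likely Q W V T (2 * δ) w v ∧
          Compatible Q (fun ω => y (W ω)) V V' ρ b (y w) v' v,
        a * prob Q (fun ω => (W ω, V' ω)) (w, v') * extensionLaw Q V V' ρ v' v := by
        refine mul_le_mul_of_nonneg_left (Finset.sum_le_sum_of_subset_of_nonneg (fun v hv => ?_)
          fun v _ _ => mul_nonneg (mul_nonneg a_pos.le hw.1.le) (extensionLaw_nonneg hQ _ _))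
          zero_le_two
        obtain ⟨-, hv, hL⟩ := mem_filter.1 hv
        exact mem_filter.2 ⟨mem_univ v, hL, (extension v hv hL).1⟩
    _ = _ := by
        rw [← Finset.mul_sum]
        ring

open Classical in
/-- Random coding with the law `extensionLaw`. -/
theorem IsLayer.exists_codebook [Finite β] [Nonempty β] (h : IsLayer Q W y V V' ρ T a b M K)
    (hQ : ∀ ω, 0 ≤ Q ω) (hδ : 0 < δ) (hδ1 : 2 * δ < 1) (v' : β') :
    ∃ c : Fin M → β,
      (∀ w, Likely Q W V' T δ w v' → ∃ m, Likely Q W V T (2 * δ) w (c m) ∧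
        Compatible Q (fun ω => y (W ω)) V V' ρ b (y w) v' (c m)) ∧
      ∀ z, (#{m | Compatible Q (fun ω => y (W ω)) V V' ρ b z v' (c m)} : ℝ) ≤ K := by
  cases nonempty_fintype β
  by_cases hv' : prob Q V' v' = 0
  · refine ⟨fun _ => Classical.arbitrary β,
      fun w hw => absurd hv' (prob_pos_of_prob_pair_pos hQ hw.1).ne', fun z => ?_⟩
    rw [Finset.filter_false_of_mem fun m _ hm => (prob_pos_of_prob_pair_pos hQ hm.2.1).ne' hv']
    simpa using h.nonneg_list
  have sum_law : ∑ v, extensionLaw Q V V' ρ v' v = 1 := sum_extensionLaw h.extends_prefix hv'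
  let Covers (w : 𝒲) (v : β) : Prop := Likely Q W V' T δ w v' →
    Likely Q W V T (2 * δ) w v ∧ Compatible Q (fun ω => y (W ω)) V V' ρ b (y w) v' v
  have covers_ge (w : 𝒲) : 1 / (2 * a) ≤ ∑ v with Covers w v, extensionLaw Q V V' ρ v' v := by
    by_cases hw : Likely Q W V' T δ w v'
    · simpa only [Covers, hw, true_imp_iff] using h.extensionLaw_ge hQ hδ hδ1 hw
    · simp only [Covers, hw, false_imp_iff, Finset.filter_true, sum_law]
      rw [div_le_one (by linarith [h.one_le])]
      linarith [h.one_le]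
  obtain ⟨c, covers, lists⟩ := TriangularNetwork.exists_codebook (extensionLaw_nonneg hQ v') sum_law
    covers_ge (fun z => sum_extensionLaw_compatible_le hQ h.extends_prefix h.nonneg_side z v')
    h.failure_lt
  exact ⟨c, fun w hw => (covers w).imp fun m hm => hm hw, lists⟩

end Layer

/-! ### Superposition codes -/

section Tree

variable {β : Type*} {M : ℕ → ℕ} (c : ∀ s, β → Fin (M s) → β) (p : ℕ → β → β → Prop) (v₀ : β)

open Classical in
/-- Generation `s` of the tree with root `v₀` in which the children of a word `v'` of generation `s`
are those words of its codebook `c s v'` that the relation `p s v'` admits. -/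
def tree : ℕ → Finset β
  | 0 => {v₀}
  | s + 1 => (tree s).biUnion fun v' => {m | p s v' (c s v' m)}.toFinset.image (c s v')

variable {c p v₀}

theorem mem_tree_succ {s : ℕ} {v : β} :
    v ∈ tree c p v₀ (s + 1) ↔ ∃ v' ∈ tree c p v₀ s, ∃ m, p s v' (c s v' m) ∧ c s v' m = v := by
  simp [tree]

theorem map_mem_tree {ρ : ℕ → β → β} {s : ℕ} (h : ∀ v' v, p s v' v → ρ s v = v') {v : β}
    (hv : v ∈ tree c p v₀ (s + 1)) : ρ s v ∈ tree c p v₀ s := by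
  obtain ⟨v', hv', m, hm, rfl⟩ := mem_tree_succ.1 hv
  rwa [h v' _ hm]

open Classical in
theorem card_tree_le {K : ℕ → ℝ} {s : ℕ} (h : ∀ r < s, ∀ v', (#{m | p r v' (c r v' m)} : ℝ) ≤ K r) :
    (#(tree c p v₀ s) : ℝ) ≤ ∏ r ∈ range s, K r := by
  induction s with
  | zero => simp [tree]
  | succ s ih =>
    have K_nonneg : 0 ≤ K s := (Nat.cast_nonneg _).trans (h s s.lt_succ_self v₀)
    rw [tree, Finset.prod_range_succ]
    calc _ ≤ ∑ v' ∈ tree c p v₀ s, (#({m | p s v' (c s v' m)}.toFinset.image (c s v')) : ℝ) := by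
          exact_mod_cast Finset.card_biUnion_le
      _ ≤ ∑ _ ∈ tree c p v₀ s, K s := Finset.sum_le_sum fun _ _ =>
          (Nat.cast_le.2 Finset.card_image_le).trans (by simpa using h s s.lt_succ_self _)
      _ = #(tree c p v₀ s) * K s := by rw [Finset.sum_const, nsmul_eq_mul]
      _ ≤ _ := mul_le_mul_of_nonneg_right (ih fun r hr => h r (hr.trans s.lt_succ_self)) K_nonneg

variable {Ω 𝒲 σ : Type*} [Fintype Ω] [Fintype 𝒲] [Fintype σ] [Finite β] {Q : Ω → ℝ} {W : Ω → 𝒲}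
  {y : 𝒲 → σ} {V : ℕ → Ω → β} {ρ : ℕ → β → β} {T : Ω → Prop} {S : ℕ} {a b K : ℕ → ℝ}

open Classical in
theorem exists_layer_codebooks
    (h : ∀ s < S, IsLayer Q W y (V (s + 1)) (V s) (ρ s) T (a s) (b s) (M s) (K s))
    (hQ : ∀ ω, 0 ≤ Q ω) {δ : ℝ} (hδ : 0 < δ) (hδ1 : 2 ^ S * δ < 1) (v₀ : β) :
    ∃ c : ∀ s, β → Fin (M s) → β, ∀ s < S, ∀ v',
      (∀ w, Likely Q W (V s) T (2 ^ s * δ) w v' → ∃ m,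
        Likely Q W (V (s + 1)) T (2 ^ (s + 1) * δ) w (c s v' m) ∧
        Compatible Q (fun ω => y (W ω)) (V (s + 1)) (V s) (ρ s) (b s) (y w) v' (c s v' m)) ∧
      ∀ z, (#{m | Compatible Q (fun ω => y (W ω)) (V (s + 1)) (V s) (ρ s) (b s) z v'
        (c s v' m)} : ℝ) ≤ K s := by
  have : Nonempty β := ⟨v₀⟩
  suffices layer : ∀ s, ∃ c : β → Fin (M s) → β, s < S → ∀ v',
      (∀ w, Likely Q W (V s) T (2 ^ s * δ) w v' → ∃ m,
        Likely Q W (V (s + 1)) T (2 ^ (s + 1) * δ) w (c v' m) ∧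
        Compatible Q (fun ω => y (W ω)) (V (s + 1)) (V s) (ρ s) (b s) (y w) v' (c v' m)) ∧
      ∀ z, (#{m | Compatible Q (fun ω => y (W ω)) (V (s + 1)) (V s) (ρ s) (b s) z v'
        (c v' m)} : ℝ) ≤ K s by
    choose c hc using layer
    exact ⟨c, hc⟩
  intro s
  by_cases hs : s < S
  · have doubled_lt : 2 * (2 ^ s * δ) < 1 := by
      refine lt_of_le_of_lt ?_ hδ1
      rw [← mul_assoc, ← pow_succ']
      gcongr
      exacts [one_le_two, hs]
    choose c hc using (h s hs).exists_codebook hQ (mul_pos (pow_pos two_pos s) hδ) doubled_lt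
    exact ⟨c, fun _ => by simpa only [pow_succ', mul_assoc] using hc⟩
  · exact ⟨fun _ _ => v₀, fun hs' => absurd hs' hs⟩

/-- `C` is the whole tree of code words, and `L z` is the part of it that remains possible once the
side information `z` is known. -/
theorem exists_tree
    (h : ∀ s < S, IsLayer Q W y (V (s + 1)) (V s) (ρ s) T (a s) (b s) (M s) (K s))
    (hQ : ∀ ω, 0 ≤ Q ω) {δ : ℝ} (hδ : 0 < δ) (hδ1 : 2 ^ S * δ < 1) (v₀ : β) :
    ∃ (C : ℕ → Finset β) (L : ℕ → σ → Finset β),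
      (∀ s, (#(C s) : ℝ) ≤ ∏ r ∈ range s, (M r : ℝ)) ∧
      (∀ s ≤ S, ∀ z, (#(L s z) : ℝ) ≤ ∏ r ∈ range s, K r) ∧
      (∀ s, ∀ v ∈ C (s + 1), ρ s v ∈ C s) ∧ (∀ s, ∀ z, ∀ v ∈ L (s + 1) z, ρ s v ∈ L s z) ∧
      ∀ w, Likely Q W (V 0) T δ w v₀ →
        ∃ v, v ∈ C S ∧ v ∈ L S (y w) ∧ Likely Q W (V S) T (2 ^ S * δ) w v := by
  classical
  obtain ⟨c, hc⟩ := exists_layer_codebooks h hQ hδ hδ1 v₀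
  refine ⟨tree c (fun s v' v => ρ s v = v') v₀, fun s z => tree c (fun r =>
      Compatible Q (fun ω => y (W ω)) (V (r + 1)) (V r) (ρ r) (b r) z) v₀ s, fun s => ?_,
    fun s hs z => ?_, fun s v => map_mem_tree fun v' v => id,
    fun s z v => map_mem_tree fun v' v hv => hv.1, fun w hw => ?_⟩
  · refine card_tree_le fun r _ v' => ?_
    exact_mod_cast (Finset.card_le_univ _).trans_eq (Fintype.card_fin (M r))
  · exact card_tree_le fun r hr v' => (hc r (hr.trans_le hs) v').2 z
  · suffices branch : ∀ s ≤ S, ∃ v, v ∈ tree c (fun s v' v => ρ s v = v') v₀ s ∧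
        v ∈ tree c (fun r => Compatible Q (fun ω => y (W ω)) (V (r + 1)) (V r) (ρ r) (b r) (y w))
          v₀ s ∧ Likely Q W (V s) T (2 ^ s * δ) w v from branch S le_rfl
    intro s hs
    induction s with
    | zero => exact ⟨v₀, mem_singleton_self v₀, mem_singleton_self v₀, by simpa using hw⟩
    | succ s ih =>
      obtain ⟨v', in_C, in_L, likely⟩ := ih (Nat.le_of_succ_le hs)
      obtain ⟨m, likely_succ, compatible⟩ := (hc s hs v').1 w likely
      exact ⟨c s v' m, mem_tree_succ.2 ⟨v', in_C, m, compatible.1, rfl⟩,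
        mem_tree_succ.2 ⟨v', in_L, m, compatible, rfl⟩, likely_succ⟩

end Tree

/-! ### Codes from sets of code words -/

section Words

theorem exists_leftInvOn_fin {β : Type*} [Nonempty β] {M : ℕ} (hM : 0 < M) {Z : Finset β}
    (hZ : #Z ≤ M) : ∃ (e : β → Fin M) (f : Fin M → β), Set.LeftInvOn f e Z := by
  have : Nonempty (Fin M) := ⟨⟨0, hM⟩⟩
  obtain ⟨e, -, he⟩ := Z.finite_toSet.exists_injOn_of_encard_le (t := (Set.univ : Set (Fin M)))
    (by simpa using hZ)
  exact ⟨e, Function.invFunOn e Z, he.leftInvOn_invFunOn⟩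

variable {k l n : ℕ} {𝒳 𝒴 β : Type*} {𝒳h : Fin (k + l) → Type*} {M : Fin (k + l + 1) → ℕ}

/-- The code in which the message of user `i` is the index `e i` of a word that the user recovers
by means of `f i` and that `ρ i` turns into the word for the next user. -/
def codeOfWords (hkl : 0 < k + l)
    (e : (i : Fin (k + l)) → Option (Fin n → 𝒴) → β → Fin (M i.castSucc))
    (f : (i : Fin (k + l)) → Option (Fin n → 𝒴) → Fin (M i.castSucc) → β) (ρ : ℕ → β → β)
    (word : (Fin n → 𝒳) → (Fin n → 𝒴) → β)
    (sel : (Fin n → 𝒳) → (Fin n → 𝒴) → Fin (M (Fin.last (k + l))))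
    (rec : (i : Fin (k + l)) → β → Option (Fin (M (Fin.last (k + l)))) → Fin n → 𝒳h i) :
    Code k l n 𝒳 𝒴 𝒳h M where
  enc x y := e ⟨0, hkl⟩ (sideView k y 0) (word x y)
  direct := sel
  relay i hi v m := e ⟨i + 1, hi⟩ (if i + 1 < k then v else none)
    (ρ i (f ⟨i, Nat.lt_of_succ_lt hi⟩ v m))
  dec i v m t := rec i (f i v m) t

theorem codeOfWords_msg (hkl : 0 < k + l)
    {e : (i : Fin (k + l)) → Option (Fin n → 𝒴) → β → Fin (M i.castSucc)}
    {f : (i : Fin (k + l)) → Option (Fin n → 𝒴) → Fin (M i.castSucc) → β} {ρ : ℕ → β → β}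
    {g : ℕ → (Fin n → 𝒳) → (Fin n → 𝒴) → β} (hg : ∀ i x y, g (i + 1) x y = ρ i (g i x y))
    (sel : (Fin n → 𝒳) → (Fin n → 𝒴) → Fin (M (Fin.last (k + l))))
    (rec : (i : Fin (k + l)) → β → Option (Fin (M (Fin.last (k + l)))) → Fin n → 𝒳h i)
    {x : Fin n → 𝒳} {y : Fin n → 𝒴}
    (hef : ∀ i : Fin (k + l), f i (sideView k y i) (e i (sideView k y i) (g i x y)) = g i x y)
    (i : ℕ) (hi : i < k + l) :
    (codeOfWords hkl e f ρ (g 0) sel rec).msg x y i hi = e ⟨i, hi⟩ (sideView k y i) (g i x y) := by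
  induction i with
  | zero => rfl
  | succ i ih =>
    have view_succ : (if i + 1 < k then sideView k y i else none) = sideView k y (i + 1) := by
      unfold sideView
      split_ifs <;> first | rfl | omega
    rw [Code.msg, ih (Nat.lt_of_succ_lt hi), hg]
    change e _ (if i + 1 < k then _ else _) (ρ i (f _ _ _)) = _
    rw [view_succ, hef ⟨i, Nat.lt_of_succ_lt hi⟩]

theorem exists_code [Nonempty β] (hkl : 0 < k + l) (hM : ∀ i, 0 < M i)
    {Z : Fin (k + l) → Option (Fin n → 𝒴) → Finset β} (hZ : ∀ i y, #(Z i y) ≤ M i.castSucc)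
    {ρ : ℕ → β → β} {g : ℕ → (Fin n → 𝒳) → (Fin n → 𝒴) → β}
    (hg : ∀ i x y, g (i + 1) x y = ρ i (g i x y))
    (sel : (Fin n → 𝒳) → (Fin n → 𝒴) → Fin (M (Fin.last (k + l))))
    (rec : (i : Fin (k + l)) → β → Option (Fin (M (Fin.last (k + l)))) → Fin n → 𝒳h i) :
    ∃ c : Code k l n 𝒳 𝒴 𝒳h M, ∀ x y, (∀ i : Fin (k + l), g i x y ∈ Z i (sideView k y i)) →
      ∀ i, c.recon x y i = rec i (g i x y) (directView (k + l) (sel x y) i) := by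
  choose e f hef using fun i y => exists_leftInvOn_fin (hM _) (hZ i y)
  refine ⟨codeOfWords hkl e f ρ (g 0) sel rec, fun x y h i => ?_⟩
  rw [Code.recon, codeOfWords_msg hkl hg sel rec fun i => hef i _ (h i)]
  change rec i (f i _ _) (directView (k + l) (sel x y) i) = _
  rw [hef i _ (h i)]

end Words

/-! ### Laws of large numbers -/

section Mass

variable {Ω : Type*} [Fintype Ω] {Q : Ω → ℝ}

open Classical in
/-- The probability of the event `E` under weights `Q`. -/
def mass (Q : Ω → ℝ) (E : Ω → Prop) : ℝ := ∑ ω, if E ω then Q ω else 0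

theorem mass_nonneg (hQ : ∀ ω, 0 ≤ Q ω) (E : Ω → Prop) : 0 ≤ mass Q E := by
  classical
  exact Finset.sum_nonneg fun ω _ => by split_ifs; exacts [hQ ω, le_rfl]

theorem mass_mono (hQ : ∀ ω, 0 ≤ Q ω) {E F : Ω → Prop} (h : ∀ ω, 0 < Q ω → E ω → F ω) :
    mass Q E ≤ mass Q F := by
  classical
  refine Finset.sum_le_sum fun ω _ => ?_
  rcases (hQ ω).eq_or_lt with h0 | hpos
  · simp only [← h0, ite_self, le_refl]
  · by_cases hE : E ω
    · rw [if_pos hE, if_pos (h ω hpos hE)]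
    · rw [if_neg hE]
      split_ifs
      exacts [hQ ω, le_rfl]

theorem mass_exists_le {ι : Type*} [Fintype ι] (hQ : ∀ ω, 0 ≤ Q ω) (E : ι → Ω → Prop) :
    mass Q (fun ω => ∃ i, E i ω) ≤ ∑ i, mass Q (E i) := by
  classical
  unfold mass
  rw [Finset.sum_comm]
  refine Finset.sum_le_sum fun ω _ => ?_
  have term_nonneg : ∀ i ∈ univ, 0 ≤ if E i ω then Q ω else 0 := fun i _ => by
    split_ifs
    exacts [hQ ω, le_rfl]
  split_ifs with h
  · obtain ⟨i, hi⟩ := h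
    exact (if_pos hi).symm.le.trans (Finset.single_le_sum term_nonneg (mem_univ i))
  · exact Finset.sum_nonneg term_nonneg

theorem mass_or_le (hQ : ∀ ω, 0 ≤ Q ω) (E F : Ω → Prop) :
    mass Q (fun ω => E ω ∨ F ω) ≤ mass Q E + mass Q F := by
  refine (mass_mono hQ fun ω _ h => ?_).trans
    ((mass_exists_le hQ fun b : Bool => if b then E else F).trans_eq (Fintype.sum_bool _))
  exact h.elim (⟨true, ·⟩) (⟨false, ·⟩)

/-- Markov's inequality for the conditional probability that `T` fails. -/
theorem mass_not_likely_le {𝒲 β : Type*} [Finite 𝒲] [Finite β] (hQ : ∀ ω, 0 ≤ Q ω) (W : Ω → 𝒲)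
    (V : Ω → β) (T : Ω → Prop) {δ : ℝ} (hδ : 0 < δ) :
    mass Q (fun ω => ¬Likely Q W V T δ (W ω) (V ω)) ≤ mass Q (fun ω => ¬T ω) / δ := by
  classical
  cases nonempty_fintype 𝒲
  cases nonempty_fintype β
  let F (z : 𝒲 × β) := prob Q (fun ω => (W ω, V ω)) z
  let E (z : 𝒲 × β) := prob (fun ω => if T ω then 0 else Q ω) (fun ω => (W ω, V ω)) z
  have mass_unlikely : mass Q (fun ω => ¬Likely Q W V T δ (W ω) (V ω)) =
      ∑ z, F z * if Likely Q W V T δ z.1 z.2 then 0 else 1 := by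
    rw [sum_prob_mul Q (fun ω => (W ω, V ω)) fun z => if Likely Q W V T δ z.1 z.2 then 0 else 1]
    exact Finset.sum_congr rfl fun ω _ => by split_ifs <;> simp_all
  have mass_failure : mass Q (fun ω => ¬T ω) = ∑ z, E z := by
    rw [sum_prob, mass]
    exact Finset.sum_congr rfl fun ω _ => by split_ifs <;> simp_all
  have E_nonneg (z : 𝒲 × β) : 0 ≤ E z :=
    prob_nonneg (fun ω => by split_ifs; exacts [le_rfl, hQ ω]) _ _
  rw [mass_unlikely, mass_failure, Finset.sum_div]
  refine Finset.sum_le_sum fun z _ => ?_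
  split_ifs with h
  · rw [mul_zero]
    exact div_nonneg (E_nonneg z) hδ.le
  · rw [mul_one, le_div_iff₀ hδ]
    by_contra! hlt
    exact h ⟨pos_of_mul_pos_left ((E_nonneg z).trans_lt hlt) hδ.le, by linarith⟩

end Mass

section Negligible

variable {Ω : Type*} [Fintype Ω] {q : Ω → ℝ}

/-- The probability of the event `E n` on blocks of length `n` tends to `0`. -/
def Negligible (q : Ω → ℝ) (E : (n : ℕ) → (Fin n → Ω) → Prop) : Prop :=
  Tendsto (fun n => mass (iid q) (E n)) atTop (𝓝 0)

theorem Negligible.mono (hq : ∀ ω, 0 ≤ q ω) {E F : (n : ℕ) → (Fin n → Ω) → Prop}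
    (hF : Negligible q F) (h : ∀ n ω, 0 < iid q ω → E n ω → F n ω) : Negligible q E :=
  squeeze_zero (fun _ => mass_nonneg (iid_nonneg hq) _)
    (fun n => mass_mono (iid_nonneg hq) (h n)) hF

theorem Negligible.or (hq : ∀ ω, 0 ≤ q ω) {E F : (n : ℕ) → (Fin n → Ω) → Prop}
    (hE : Negligible q E) (hF : Negligible q F) : Negligible q fun n ω => E n ω ∨ F n ω :=
  squeeze_zero (fun _ => mass_nonneg (iid_nonneg hq) _)
    (fun _ => mass_or_le (iid_nonneg hq) _ _) (by simpa using Tendsto.add hE hF)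

theorem Negligible.exists {ι : Type*} [Finite ι] (hq : ∀ ω, 0 ≤ q ω)
    {E : ι → (n : ℕ) → (Fin n → Ω) → Prop} (hE : ∀ i, Negligible q (E i)) :
    Negligible q fun n ω => ∃ i, E i n ω := by
  cases nonempty_fintype ι
  exact squeeze_zero (fun _ => mass_nonneg (iid_nonneg hq) _)
    (fun n => mass_exists_le (iid_nonneg hq) fun i => E i n)
    (by simpa using tendsto_finsetSum univ fun i _ => hE i)

theorem Negligible.not_likely {α β : ℕ → Type*} [∀ n, Finite (α n)] [∀ n, Finite (β n)]
    (hq : ∀ ω, 0 ≤ q ω) {T : (n : ℕ) → (Fin n → Ω) → Prop}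
    (hT : Negligible q fun n ω => ¬T n ω) (W : (n : ℕ) → (Fin n → Ω) → α n)
    (V : (n : ℕ) → (Fin n → Ω) → β n) {δ : ℝ} (hδ : 0 < δ) :
    Negligible q fun n ω => ¬Likely (iid q) (W n) (V n) (T n) δ (W n ω) (V n ω) :=
  squeeze_zero (fun _ => mass_nonneg (iid_nonneg hq) _)
    (fun n => mass_not_likely_le (iid_nonneg hq) (W n) (V n) (T n) hδ)
    (by simpa using Tendsto.div_const hT δ)

theorem exists_sum_mul_exp_lt_one (hq1 : ∑ ω, q ω = 1) {f : Ω → ℝ} (hf : ∑ ω, q ω * f ω < 0) :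
    ∃ t : ℝ, 0 < t ∧ ∑ ω, q ω * exp (t * f ω) < 1 := by
  have derivative : HasDerivAt (fun t => ∑ ω, q ω * exp (t * f ω)) (∑ ω, q ω * f ω) 0 := by
    have := HasDerivAt.fun_sum (u := univ) fun ω _ =>
      ((hasDerivAt_mul_const (x := 0) (f ω)).exp.const_mul (q ω))
    simpa using this
  obtain ⟨t, slope_neg, ht⟩ :=
    ((derivative.tendsto_slope_zero_right.eventually_lt_const hf).and self_mem_nhdsWithin).exists
  refine ⟨t, ht, ?_⟩
  have := neg_of_mul_neg_right slope_neg (inv_nonneg.2 (le_of_lt ht))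
  simpa [hq1] using this

theorem negligible_lt_sum (hq : ∀ ω, 0 ≤ q ω) (hq1 : ∑ ω, q ω = 1) {f : Ω → ℝ} {c : ℝ}
    (hc : ∑ ω, q ω * f ω < c) : Negligible q fun n ω => n * c < ∑ t, f (ω t) := by
  classical
  obtain ⟨t, ht, moment_lt⟩ := exists_sum_mul_exp_lt_one hq1 (f := fun ω => f ω - c) (by
    simp only [mul_sub, Finset.sum_sub_distrib, ← Finset.sum_mul, hq1]
    linarith)
  set r := ∑ ω, q ω * exp (t * (f ω - c))
  have r_nonneg : 0 ≤ r := Finset.sum_nonneg fun ω _ => mul_nonneg (hq ω) (exp_pos _).le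
  have r_pow (n : ℕ) : r ^ n = ∑ ω : Fin n → Ω, iid q ω * exp (t * (∑ s, f (ω s) - n * c)) := by
    have exp_sum_sub (ω : Fin n → Ω) :
        exp (t * (∑ s, f (ω s) - n * c)) = ∏ s, exp (t * (f (ω s) - c)) := by
      rw [← exp_sum, ← Finset.mul_sum, Finset.sum_sub_distrib]
      simp
    simp only [exp_sum_sub]
    exact (sum_iid_mul_prod q (fun ω => exp (t * (f ω - c))) n).symm
  refine squeeze_zero (fun n => mass_nonneg (iid_nonneg hq) _) (fun n => ?_)
    (tendsto_pow_atTop_nhds_zero_of_lt_one r_nonneg moment_lt)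
  rw [r_pow]
  refine Finset.sum_le_sum fun ω _ => ?_
  split_ifs with h
  · exact le_mul_of_one_le_right (iid_nonneg hq ω)
      (one_le_exp (mul_nonneg ht.le (sub_nonneg.2 h.le)))
  · exact mul_nonneg (iid_nonneg hq ω) (exp_pos _).le

theorem negligible_not_abs_sum_sub_le (hq : ∀ ω, 0 ≤ q ω) (hq1 : ∑ ω, q ω = 1) (f : Ω → ℝ) {η : ℝ}
    (hη : 0 < η) : Negligible q fun n ω => ¬|∑ t, f (ω t) - n * ∑ ω, q ω * f ω| ≤ n * η := by
  have upper := negligible_lt_sum hq hq1 (f := f) (c := ∑ ω, q ω * f ω + η) (by linarith)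
  have lower := negligible_lt_sum hq hq1 (f := fun ω => -f ω) (c := -∑ ω, q ω * f ω + η) (by
    simp only [mul_neg, Finset.sum_neg_distrib]
    linarith)
  refine (upper.or hq lower).mono hq fun n ω _ h => ?_
  by_contra! hcon
  rw [Finset.sum_neg_distrib] at hcon
  exact h (abs_le.2 ⟨by linarith [hcon.2], by linarith [hcon.1]⟩)

end Negligible

/-! ### Information densities of blocks -/

section Density

variable {Ω α β γ : Type*} {q : Ω → ℝ} {n : ℕ}

theorem pos_of_iid_pos (hq : ∀ ω, 0 ≤ q ω) {ω : Fin n → Ω} (h : 0 < iid q ω) (t : Fin n) :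
    0 < q (ω t) :=
  (hq _).lt_of_ne' fun h0 => h.ne' (Finset.prod_eq_zero (mem_univ t) h0)

variable [Fintype Ω]

theorem prob_iid_pair (A : Ω → α) (B : Ω → β) (a : Fin n → α) (b : Fin n → β) :
    prob (iid q) (fun ω : Fin n → Ω => ((fun t => A (ω t)), fun t => B (ω t))) (a, b) =
      ∏ t, prob q (fun ω => (A ω, B ω)) (a t, b t) := by
  refine (prob_congr fun ω => ?_).trans (prob_iid (fun ω => (A ω, B ω)) fun t => (a t, b t))
  simp only [Prod.mk.injEq, funext_iff, forall_and]

theorem prob_iid_pair_eq_mul_rpow (hq : ∀ ω, 0 ≤ q ω) (A : Ω → α) (B : Ω → β) {ω : Fin n → Ω}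
    (h : 0 < iid q ω) :
    prob (iid q) (fun ω : Fin n → Ω => ((fun t => A (ω t)), fun t => B (ω t)))
      ((fun t => A (ω t)), fun t => B (ω t)) =
    prob (iid q) (fun (ω : Fin n → Ω) t => A (ω t)) (fun t => A (ω t)) *
    prob (iid q) (fun (ω : Fin n → Ω) t => B (ω t)) (fun t => B (ω t)) *
      (2 : ℝ) ^ ∑ t, infoDensity q A B (ω t) := by
  rw [prob_iid_pair, prob_iid, prob_iid, rpow_sum_of_pos two_pos, iid, iid,
    ← Finset.prod_mul_distrib, ← Finset.prod_mul_distrib]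
  refine Finset.prod_congr rfl fun t _ => ?_
  have letter_pos := pos_of_iid_pos hq h t
  have pos_left := prob_pos hq A letter_pos
  have pos_right := prob_pos hq B letter_pos
  have pos_pair := prob_pos hq (fun ω => (A ω, B ω)) letter_pos
  rw [infoDensity, rpow_logb two_pos (by norm_num) (by positivity)]
  field_simp

theorem prob_iid_triple_eq_rpow_mul (hq : ∀ ω, 0 ≤ q ω) (A : Ω → α) (B : Ω → β) (C : Ω → γ)
    {ω : Fin n → Ω} (h : 0 < iid q ω) :
    prob (iid q) (fun ω : Fin n → Ω => ((fun t => A (ω t)), fun t => (B (ω t), C (ω t))))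
      ((fun t => A (ω t)), fun t => (B (ω t), C (ω t))) *
    prob (iid q) (fun (ω : Fin n → Ω) t => C (ω t)) (fun t => C (ω t)) =
      (2 : ℝ) ^ (∑ t, condInfoDensity q A B C (ω t)) *
      (prob (iid q) (fun (ω : Fin n → Ω) t => (B (ω t), C (ω t)))
        (fun t => (B (ω t), C (ω t))) *
      prob (iid q) (fun ω : Fin n → Ω => ((fun t => A (ω t)), fun t => C (ω t)))
        ((fun t => A (ω t)), fun t => C (ω t))) := by
  rw [prob_iid_pair (B := fun ω => (B ω, C ω)), prob_iid, prob_iid (fun ω => (B ω, C ω)),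
    prob_iid_pair, rpow_sum_of_pos two_pos, iid, iid,
    ← Finset.prod_mul_distrib, ← Finset.prod_mul_distrib, ← Finset.prod_mul_distrib]
  refine Finset.prod_congr rfl fun t _ => ?_
  have letter_pos := pos_of_iid_pos hq h t
  have pos_AC := prob_pos hq (fun ω => (A ω, C ω)) letter_pos
  have pos_BC := prob_pos hq (fun ω => (B ω, C ω)) letter_pos
  have pos_ABC := prob_pos hq (fun ω => (A ω, B ω, C ω)) letter_pos
  have pos_C := prob_pos hq C letter_pos
  rw [condInfoDensity, rpow_logb two_pos (by norm_num) (by positivity)]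
  field_simp

end Density

/-! ### Asymptotics -/

section Asymptotics

theorem tendsto_pow_mul_exp_neg_two_rpow {C c η : ℝ} (hC : 0 ≤ C) (hc : 0 < c) (hη : 0 < η) :
    Tendsto (fun n : ℕ => C ^ n * exp (-(c * (2 : ℝ) ^ ((n : ℝ) * η)))) atTop (𝓝 0) := by
  let κ := η * log 2
  have : 0 < κ := mul_pos hη (log_pos one_lt_two)
  have pow_le (n : ℕ) : C ^ n ≤ exp (n * C) := by
    rw [exp_nat_mul]
    exact pow_le_pow_left₀ hC (by linarith [add_one_le_exp C]) n
  have le_two_rpow (n : ℕ) : (n * κ) ^ 2 / 2 ≤ (2 : ℝ) ^ ((n : ℝ) * η) := by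
    have exponent : log 2 * ((n : ℝ) * η) = n * κ := by ring
    have κn_nonneg : 0 ≤ n * κ := by positivity
    rw [rpow_def_of_pos two_pos, exponent]
    linarith [quadratic_le_exp_of_nonneg κn_nonneg]
  have le_exp (n : ℕ) : C ^ n * exp (-(c * (2 : ℝ) ^ ((n : ℝ) * η))) ≤
      exp ((n : ℝ) * (C + -(c * κ ^ 2 / 2) * n)) :=
    calc _ ≤ exp (n * C) * exp (-(c * ((n * κ) ^ 2 / 2))) := by
          gcongr
          exacts [pow_le n, le_two_rpow n]
      _ = _ := by rw [← exp_add]; congr 1; ring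
  refine squeeze_zero (fun n => by positivity) le_exp (tendsto_exp_atBot.comp ?_)
  refine tendsto_natCast_atTop_atTop.atTop_mul_atBot₀ (tendsto_atBot_add_const_left _ _ ?_)
  exact tendsto_natCast_atTop_atTop.const_mul_atTop_of_neg (neg_lt_zero.2 (by positivity))

theorem eventually_two_le_rpow {η : ℝ} (hη : 0 < η) :
    ∀ᶠ n : ℕ in atTop, (2 : ℝ) ≤ (2 : ℝ) ^ ((n : ℝ) * η) := by
  filter_upwards [(tendsto_natCast_atTop_atTop.atTop_mul_const hη).eventually_ge_atTop 1] with n hn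
  simpa using rpow_le_rpow_of_exponent_le one_le_two hn

theorem natCeil_le_two_mul {x : ℝ} (hx : 1 ≤ x) : (⌈x⌉₊ : ℝ) ≤ 2 * x := by
  linarith [Nat.ceil_lt_add_one (by linarith : 0 ≤ x)]

theorem one_sub_pow_le_exp {a x : ℝ} (ha : 1 ≤ a) {M : ℕ} (hM : a * x ≤ M) :
    (1 - 1 / (2 * a)) ^ M ≤ exp (-(1 / 2 * x)) := by
  have base_nonneg : 0 ≤ 1 - 1 / (2 * a) := by
    rw [sub_nonneg, div_le_one (by linarith)]
    linarith
  calc (1 - 1 / (2 * a)) ^ M ≤ exp (-(1 / (2 * a))) ^ M :=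
        pow_le_pow_left₀ base_nonneg (one_sub_le_exp_neg _) _
    _ = exp (-(M / (2 * a))) := by rw [← exp_nat_mul]; congr 1; ring
    _ ≤ exp (-(1 / 2 * x)) := by
        rw [exp_le_exp, neg_le_neg_iff, le_div_iff₀ (by linarith)]
        linarith

end Asymptotics

/-! ### Conditional codebooks -/

section ConditionalCodebook

variable {Ω α β γ : Type*} [Fintype Ω] {q : Ω → ℝ}

theorem isLayer_of_sum_condInfoDensity_le [Fintype α] (hq : ∀ ω, 0 ≤ q ω) (A : Ω → α)
    (B : Ω → β) (C : Ω → γ) {n : ℕ} {T : (Fin n → Ω) → Prop} {η : ℝ} (hη : 0 < η)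
    (T_pos : ∀ ω, T ω → 0 < iid q ω)
    (T_le : ∀ ω, T ω → ∑ t, condInfoDensity q A B C (ω t) ≤ n * (condMutualInfo q A B C + η))
    (hn : (Fintype.card α : ℝ) ^ n * exp (-(1 / 2 * (2 : ℝ) ^ ((n : ℝ) * η))) < 1 / 2) {M : ℕ}
    (hM : (2 : ℝ) ^ ((n : ℝ) * (condMutualInfo q A B C + 2 * η)) ≤ M) :
    IsLayer (iid q) (fun ω t => A (ω t)) (fun _ => ()) (fun ω t => (B (ω t), C (ω t)))
      (fun ω t => C (ω t)) (fun v t => (v t).2) T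
      ((2 : ℝ) ^ ((n : ℝ) * (condMutualInfo q A B C + η))) 1 M (2 * M + 1) where
  extends_prefix _ := rfl
  density_le ω hω := by
    rw [prob_iid_triple_eq_rpow_mul hq A B C (T_pos ω hω)]
    exact mul_le_mul_of_nonneg_right (rpow_le_rpow_of_exponent_le one_le_two (T_le ω hω))
      (mul_nonneg (prob_nonneg (iid_nonneg hq) _ _) (prob_nonneg (iid_nonneg hq) _ _))
  le_density_side ω _ := by
    simp only [one_mul, prob_unit_pair, le_refl]
  one_le := one_le_rpow one_le_two
    (mul_nonneg n.cast_nonneg (add_nonneg (condMutualInfo_nonneg hq A B C) hη.le))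
  nonneg_side := zero_le_one
  nonneg_list := by positivity
  failure_lt := by
    have info_nonneg := condMutualInfo_nonneg hq A B C
    have pow_le : (1 - 1 / (2 * (2 : ℝ) ^ ((n : ℝ) * (condMutualInfo q A B C + η)))) ^ M ≤
        exp (-(1 / 2 * (2 : ℝ) ^ ((n : ℝ) * η))) := by
      refine one_sub_pow_le_exp (one_le_rpow one_le_two (by positivity)) (le_of_eq_of_le ?_ hM)
      rw [← rpow_add two_pos]
      congr 1
      ring
    have list_failure_lt : exp (2 * 1 * (M : ℝ) - (2 * M + 1)) < 1 / 2 := by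
      rw [show 2 * 1 * (M : ℝ) - (2 * M + 1) = -1 by ring]
      exact exp_neg_one_lt_half
    have := mul_le_mul_of_nonneg_left pow_le (by positivity : (0 : ℝ) ≤ Fintype.card α ^ n)
    simp only [Fintype.card_pi_const, Fintype.card_unit, Nat.cast_pow, Nat.cast_one, one_mul]
    linarith

theorem exists_conditional_codebooks [Finite α] [Finite β] [Finite γ]
    (hq : ∀ ω, 0 ≤ q ω) (hq1 : ∑ ω, q ω = 1) (A : Ω → α) (B : Ω → β) (C : Ω → γ)
    (f : α → β → ℝ) {D η : ℝ} (hf : ∑ ω, q ω * f (A ω) (B ω) ≤ D) (hη : 0 < η) :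
    ∃ E : (n : ℕ) → (Fin n → α) → (Fin n → γ) → Prop,
      (Negligible q fun n ω => ¬E n (fun t => A (ω t)) fun t => C (ω t)) ∧
      ∀ᶠ n : ℕ in atTop, ∀ M : ℕ, (2 : ℝ) ^ ((n : ℝ) * (condMutualInfo q A B C + 2 * η)) ≤ M →
        ∀ u, ∃ c : Fin M → Fin n → β, ∀ x, E n x u → ∃ m, ∑ t, f (x t) (c m t) ≤ n * (D + η) := by
  cases nonempty_fintype α
  have : Nonempty Ω := nonempty_of_sum_eq_one hq1
  let T (n : ℕ) (ω : Fin n → Ω) : Prop := 0 < iid q ω ∧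
    ∑ t, condInfoDensity q A B C (ω t) ≤ n * (condMutualInfo q A B C + η) ∧
    ∑ t, f (A (ω t)) (B (ω t)) ≤ n * (D + η)
  have density_concentrates : Negligible q fun n ω =>
      n * (condMutualInfo q A B C + η) < ∑ t, condInfoDensity q A B C (ω t) :=
    negligible_lt_sum hq hq1 (lt_add_of_pos_right (condMutualInfo q A B C) hη)
  have distortion_concentrates : Negligible q fun n ω =>
      n * (D + η) < ∑ t, f (A (ω t)) (B (ω t)) :=
    negligible_lt_sum hq hq1 (f := fun ω => f (A ω) (B ω)) (by linarith)
  have atypical_negligible : Negligible q fun n ω => ¬T n ω := by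
    refine (density_concentrates.or hq distortion_concentrates).mono hq fun n ω hpos h => ?_
    by_contra! hcon
    exact h ⟨hpos, hcon⟩
  have unlikely_negligible := atypical_negligible.not_likely hq (fun n ω (t : Fin n) => A (ω t))
    (fun n ω (t : Fin n) => C (ω t)) (δ := 1 / 4) (by norm_num)
  refine ⟨fun n x u => Likely (iid q) (fun ω t => A (ω t)) (fun ω t => C (ω t)) (T n) (1 / 4) x u,
    unlikely_negligible, ?_⟩
  filter_upwards [(tendsto_pow_mul_exp_neg_two_rpow (Fintype.card α).cast_nonneg one_half_pos
    hη).eventually_lt_const one_half_pos] with n hn M hM u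
  have : Nonempty β := ⟨B (Classical.arbitrary Ω)⟩
  have : Nonempty γ := ⟨C (Classical.arbitrary Ω)⟩
  obtain ⟨c, covers, -⟩ := (isLayer_of_sum_condInfoDensity_le (T := T n) hq A B C hη
    (fun ω hω => hω.1) (fun ω hω => hω.2.1) hn hM).exists_codebook (iid_nonneg hq)
    (δ := 1 / 4) (by norm_num) (by norm_num) u
  refine ⟨fun m t => (c m t).1, fun x hx => ?_⟩
  obtain ⟨m, hm, -⟩ := covers x hx
  obtain ⟨ω, ⟨-, -, hω⟩, -, rfl, hc⟩ := hm.exists (by norm_num)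
  exact ⟨m, by simpa only [← hc] using hω⟩

end ConditionalCodebook

/-! ### Superposition codebooks for long blocks -/

section Superposition

variable {Ω 𝒲 σ α β β' : Type*} [Fintype Ω] {q : Ω → ℝ}

theorem mutualInfo_mono_right (hq : ∀ ω, 0 ≤ q ω) (A : Ω → α) {B : Ω → β} {B' : Ω → β'}
    (h : ∀ ω ω', B ω = B ω' → B' ω = B' ω') : mutualInfo q A B' ≤ mutualInfo q A B := by
  rw [mutualInfo_eq_sub_condEntropy hq, mutualInfo_eq_sub_condEntropy hq]
  exact sub_le_sub_left (condEntropy_anti hq A h) _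

theorem condMutualInfo_mono_right (hq : ∀ ω, 0 ≤ q ω) (A : Ω → α) {B : Ω → β} {B' : Ω → β'}
    (C : Ω → σ) (h : ∀ ω ω', B ω = B ω' → B' ω = B' ω') :
    condMutualInfo q A B' C ≤ condMutualInfo q A B C := by
  rw [condMutualInfo_eq_sub_condEntropy hq, condMutualInfo_eq_sub_condEntropy hq]
  refine sub_le_sub_left (condEntropy_anti hq A fun ω ω' => ?_) _
  simp only [Prod.mk.injEq]
  exact And.imp_left (h ω ω')

theorem condMutualInfo_eq_mutualInfo_sub (hq : ∀ ω, 0 ≤ q ω) (W : Ω → 𝒲) (y : 𝒲 → σ)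
    (V : Ω → β) : condMutualInfo q W V (fun ω => y (W ω)) =
      mutualInfo q W V - mutualInfo q (fun ω => y (W ω)) V := by
  rw [condMutualInfo_eq_entropy hq, mutualInfo_eq_entropy hq, mutualInfo_eq_entropy hq,
    entropy_congr (A := fun ω => (W ω, y (W ω))) (B := W) (by simp +contextual),
    entropy_congr (A := fun ω => (W ω, V ω, y (W ω))) (B := fun ω => (W ω, V ω))
      (by simp +contextual),
    entropy_congr (A := fun ω => (V ω, y (W ω))) (B := fun ω => (y (W ω), V ω))
      (by simp [and_comm])]
  ring

theorem mutualInfo_const (hq : ∀ ω, 0 ≤ q ω) (hq1 : ∑ ω, q ω = 1) (A : Ω → α) (b : β) :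
    mutualInfo q A (fun _ => b) = 0 := by
  rw [mutualInfo_eq_entropy hq, entropy_const hq1,
    entropy_congr (A := fun ω => (A ω, b)) (B := A) (by simp)]
  ring

/-- The information density of the blocks of `A` and `B` is within `n * η` of its expectation. -/
def InfoTypical (q : Ω → ℝ) (A : Ω → α) (B : Ω → β) (η : ℝ) {n : ℕ} (ω : Fin n → Ω) : Prop :=
  |∑ t, infoDensity q A B (ω t) - n * mutualInfo q A B| ≤ n * η

theorem negligible_not_infoTypical (hq : ∀ ω, 0 ≤ q ω) (hq1 : ∑ ω, q ω = 1) (A : Ω → α) (B : Ω → β)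
    {η : ℝ} (hη : 0 < η) : Negligible q fun _ ω => ¬InfoTypical q A B η ω :=
  negligible_not_abs_sum_sub_le hq hq1 (infoDensity q A B) hη

theorem InfoTypical.prob_iid_mul_le (hq : ∀ ω, 0 ≤ q ω) {A : Ω → α} {B : Ω → β} {B' : Ω → β'}
    {η : ℝ} {n : ℕ} {ω : Fin n → Ω} (hB : InfoTypical q A B η ω) (hB' : InfoTypical q A B' η ω)
    (hω : 0 < iid q ω) :
    prob (iid q) (fun ω : Fin n → Ω => ((fun t => A (ω t)), fun t => B (ω t)))
        ((fun t => A (ω t)), fun t => B (ω t)) *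
      prob (iid q) (fun (ω : Fin n → Ω) t => B' (ω t)) (fun t => B' (ω t)) ≤
    (2 : ℝ) ^ (n * (mutualInfo q A B - mutualInfo q A B' + 2 * η)) *
      (prob (iid q) (fun (ω : Fin n → Ω) t => B (ω t)) (fun t => B (ω t)) *
        prob (iid q) (fun ω : Fin n → Ω => ((fun t => A (ω t)), fun t => B' (ω t)))
          ((fun t => A (ω t)), fun t => B' (ω t))) := by
  have density_le : (2 : ℝ) ^ (∑ t, infoDensity q A B (ω t)) ≤
      (2 : ℝ) ^ (n * (mutualInfo q A B - mutualInfo q A B' + 2 * η)) *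
        (2 : ℝ) ^ (∑ t, infoDensity q A B' (ω t)) := by
    rw [← rpow_add two_pos]
    exact rpow_le_rpow_of_exponent_le one_le_two (by linarith [(abs_le.1 hB).2, (abs_le.1 hB').1])
  rw [prob_iid_pair_eq_mul_rpow hq A B hω, prob_iid_pair_eq_mul_rpow hq A B' hω]
  have := mul_le_mul_of_nonneg_left density_le (mul_nonneg (mul_nonneg
    (prob_nonneg (iid_nonneg hq) (fun (ω : Fin n → Ω) t => A (ω t)) fun t => A (ω t))
    (prob_nonneg (iid_nonneg hq) (fun (ω : Fin n → Ω) t => B (ω t)) fun t => B (ω t)))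
    (prob_nonneg (iid_nonneg hq) (fun (ω : Fin n → Ω) t => B' (ω t)) fun t => B' (ω t)))
  linarith

/-- The number of extensions of a code word when they raise the information by `Δ`. A random
extension succeeds with probability about `2 ^ (-n * (Δ + 2 * η))`, so that all of these fail with
doubly exponentially small probability. -/
def codebookSize (n : ℕ) (Δ η : ℝ) : ℕ := ⌈(2 : ℝ) ^ (n * (Δ + 3 * η))⌉₊

theorem le_codebookSize (n : ℕ) (Δ η : ℝ) :
    (2 : ℝ) ^ (n * (Δ + 2 * η)) * (2 : ℝ) ^ (n * η) ≤ codebookSize n Δ η := by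
  refine le_of_eq_of_le ?_ (Nat.le_ceil _)
  rw [← rpow_add two_pos]
  congr 1
  ring

theorem codebookSize_le {n : ℕ} {Δ η : ℝ} (hΔ : 0 ≤ Δ) (hη : 0 ≤ η)
    (hn : (2 : ℝ) ≤ (2 : ℝ) ^ (n * η)) :
    codebookSize n Δ η ≤ (2 : ℝ) ^ (n * (Δ + 4 * η)) :=
  calc (codebookSize n Δ η : ℝ) ≤ 2 * (2 : ℝ) ^ (n * (Δ + 3 * η)) :=
        natCeil_le_two_mul (one_le_rpow one_le_two (by positivity))
    _ ≤ (2 : ℝ) ^ (n * η) * (2 : ℝ) ^ (n * (Δ + 3 * η)) := by gcongr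
    _ = (2 : ℝ) ^ (n * (Δ + 4 * η)) := by
        rw [← rpow_add two_pos]
        congr 1
        ring

theorem two_mul_rpow_mul_codebookSize_sub_le {n : ℕ} {Δ Γ η : ℝ} (hΔ : 0 ≤ Δ) (hΓ : 0 ≤ Γ)
    (hη : 0 ≤ η) (hn : (2 : ℝ) ≤ (2 : ℝ) ^ (n * η)) :
    2 * (2 : ℝ) ^ (n * (Γ - Δ + 2 * η)) * codebookSize n Δ η - (2 : ℝ) ^ (n * (Γ + 7 * η)) ≤
      2 - (2 : ℝ) ^ (n * η) := by
  let x : ℝ := (2 : ℝ) ^ (n * (Γ + 6 * η))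
  have one_le : 1 ≤ x := one_le_rpow one_le_two (by positivity)
  have mean_le : (2 : ℝ) ^ (n * (Γ - Δ + 2 * η)) * codebookSize n Δ η ≤ x := by
    refine (mul_le_mul_of_nonneg_left (codebookSize_le hΔ hη hn) (by positivity)).trans_eq ?_
    rw [← rpow_add two_pos]
    congr 1
    ring
  have list_size : (2 : ℝ) ^ (n * (Γ + 7 * η)) = (2 : ℝ) ^ (n * η) * x := by
    rw [← rpow_add two_pos]
    congr 1
    ring
  rw [list_size]
  nlinarith [mul_le_mul_of_nonneg_left one_le (sub_nonneg.2 hn)]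

/-- The block length `n` is so large that neither covering all blocks over an alphabet of size `a`
nor bounding the lists of all blocks over an alphabet of size `b` fails. -/
structure IsLong (a b : ℕ) (η : ℝ) (n : ℕ) : Prop where
  two_le : (2 : ℝ) ≤ (2 : ℝ) ^ (n * η)
  covering_failure_lt : (a : ℝ) ^ n * exp (-(1 / 2 * (2 : ℝ) ^ (n * η))) < 1 / 2
  list_failure_lt : (b : ℝ) ^ n * exp (2 - (2 : ℝ) ^ (n * η)) < 1 / 2

theorem eventually_isLong (a b : ℕ) {η : ℝ} (hη : 0 < η) : ∀ᶠ n in atTop, IsLong a b η n := by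
  have covering := (tendsto_pow_mul_exp_neg_two_rpow a.cast_nonneg one_half_pos
    hη).eventually_lt_const one_half_pos
  have list := ((tendsto_pow_mul_exp_neg_two_rpow b.cast_nonneg one_pos hη).mul_const
    (exp 2)).eventually_lt_const (u := 1 / 2) (by norm_num)
  filter_upwards [eventually_two_le_rpow hη, covering, list] with n two_le covering list
  refine ⟨two_le, covering, lt_of_eq_of_lt ?_ list⟩
  rw [mul_assoc, ← exp_add]
  ring_nf

theorem IsLong.isLayer [Fintype 𝒲] [Fintype σ] (hq : ∀ ω, 0 ≤ q ω) {W : Ω → 𝒲} {y : 𝒲 → σ}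
    {V : Ω → β} {V' : Ω → β'} {ρ : β → β'} (hρ : ∀ ω, ρ (V ω) = V' ω) {η : ℝ} (hη : 0 ≤ η) {n : ℕ}
    (hn : IsLong (Fintype.card 𝒲) (Fintype.card σ) η n) {T : (Fin n → Ω) → Prop}
    (T_pos : ∀ ω, T ω → 0 < iid q ω)
    (T_typical : ∀ ω, T ω → InfoTypical q W V η ω ∧ InfoTypical q (fun ω => y (W ω)) V η ω)
    (T_typical' : ∀ ω, T ω → InfoTypical q W V' η ω ∧ InfoTypical q (fun ω => y (W ω)) V' η ω) :
    IsLayer (iid q) (fun ω t => W (ω t)) (fun w t => y (w t)) (fun ω t => V (ω t))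
      (fun ω t => V' (ω t)) (fun v t => ρ (v t)) T
      ((2 : ℝ) ^ (n * (mutualInfo q W V - mutualInfo q W V' + 2 * η)))
      ((2 : ℝ) ^ (n * (mutualInfo q (fun ω => y (W ω)) V' - mutualInfo q (fun ω => y (W ω)) V +
        2 * η)))
      (codebookSize n (mutualInfo q W V - mutualInfo q W V') η)
      ((2 : ℝ) ^ (n * (condMutualInfo q W V (fun ω => y (W ω)) -
        condMutualInfo q W V' (fun ω => y (W ω)) + 7 * η))) := by
  have factor (ω ω' : Ω) (h : V ω = V ω') : V' ω = V' ω' := by rw [← hρ ω, ← hρ ω', h]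
  have Δ_nonneg := sub_nonneg.2 (mutualInfo_mono_right hq W factor)
  have Γ_nonneg := sub_nonneg.2 (condMutualInfo_mono_right hq W (fun ω => y (W ω)) factor)
  have one_le := one_le_rpow (z := n * (mutualInfo q W V - mutualInfo q W V' + 2 * η)) one_le_two
    (by positivity)
  refine ⟨fun ω => funext fun t => hρ (ω t),
    fun ω hω => (T_typical ω hω).1.prob_iid_mul_le hq (T_typical' ω hω).1 (T_pos ω hω),
    fun ω hω => (T_typical' ω hω).2.prob_iid_mul_le hq (T_typical ω hω).2 (T_pos ω hω),
    one_le, by positivity, by positivity, ?_⟩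
  have covering := one_sub_pow_le_exp one_le (le_codebookSize n _ η)
  have list := exp_le_exp.2 (two_mul_rpow_mul_codebookSize_sub_le Δ_nonneg Γ_nonneg hη hn.two_le)
  have side_exponent : condMutualInfo q W V (fun ω => y (W ω)) -
      condMutualInfo q W V' (fun ω => y (W ω)) - (mutualInfo q W V - mutualInfo q W V') =
      mutualInfo q (fun ω => y (W ω)) V' - mutualInfo q (fun ω => y (W ω)) V := by
    rw [condMutualInfo_eq_mutualInfo_sub hq, condMutualInfo_eq_mutualInfo_sub hq]
    ring
  rw [side_exponent] at list
  simp only [Fintype.card_pi_const, Nat.cast_pow]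
  calc _ ≤ (Fintype.card 𝒲 : ℝ) ^ n * exp (-(1 / 2 * (2 : ℝ) ^ (n * η))) +
        (Fintype.card σ : ℝ) ^ n * exp (2 - (2 : ℝ) ^ (n * η)) := by gcongr
    _ < 1 := by linarith [hn.covering_failure_lt, hn.list_failure_lt]

theorem prod_range_le_rpow {f g : ℕ → ℝ} (hf : f 0 = 0) (hg : ∀ r, 0 ≤ g r) {c : ℝ} (hc : 0 ≤ c)
    {n : ℕ} (h : ∀ r, g r ≤ (2 : ℝ) ^ (n * (f (r + 1) - f r + c))) {s S : ℕ} (hs : s ≤ S) :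
    ∏ r ∈ range s, g r ≤ (2 : ℝ) ^ (n * (f s + S * c)) :=
  calc ∏ r ∈ range s, g r ≤ ∏ r ∈ range s, (2 : ℝ) ^ (n * (f (r + 1) - f r + c)) :=
        Finset.prod_le_prod (fun r _ => hg r) fun r _ => h r
    _ = (2 : ℝ) ^ (n * (f s + s * c)) := by
        rw [← rpow_sum_of_pos two_pos, ← Finset.mul_sum, Finset.sum_add_distrib,
          Finset.sum_range_sub]
        simp [hf]
    _ ≤ (2 : ℝ) ^ (n * (f s + S * c)) := by
        gcongr
        exact one_le_two

/-- The event `E`, together with typicality of the blocks of all words `V 0, …, V S` with the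
source block and with the side information. -/
def ChainTypical (q : Ω → ℝ) (W : Ω → 𝒲) (y : 𝒲 → σ) (V : ℕ → Ω → β) (S : ℕ) (η : ℝ)
    (E : (n : ℕ) → (Fin n → Ω) → Prop) (n : ℕ) (ω : Fin n → Ω) : Prop :=
  0 < iid q ω ∧ E n ω ∧
    ∀ s : Fin (S + 1), InfoTypical q W (V s) η ω ∧ InfoTypical q (fun ω => y (W ω)) (V s) η ω

theorem Negligible.not_chainTypical (hq : ∀ ω, 0 ≤ q ω) (hq1 : ∑ ω, q ω = 1) (W : Ω → 𝒲)
    (y : 𝒲 → σ) (V : ℕ → Ω → β) (S : ℕ) {η : ℝ} (hη : 0 < η)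
    {E : (n : ℕ) → (Fin n → Ω) → Prop} (hE : Negligible q fun n ω => ¬E n ω) :
    Negligible q fun n ω => ¬ChainTypical q W y V S η E n ω := by
  have atypical : Negligible q fun _ ω => ∃ s : Fin (S + 1),
      ¬InfoTypical q W (V s) η ω ∨ ¬InfoTypical q (fun ω => y (W ω)) (V s) η ω :=
    Negligible.exists hq fun s => (negligible_not_infoTypical hq hq1 W (V s) hη).or hq
      (negligible_not_infoTypical hq hq1 (fun ω => y (W ω)) (V s) hη)
  refine (hE.or hq atypical).mono hq fun n ω hpos h => ?_
  by_contra! hcon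
  exact h ⟨hpos, hcon⟩

/-- Superposition coding with lists: `C s` contains the words of level `s`, and `L s z` those that
remain possible once the side information `z` is known. -/
theorem exists_superposition_codebooks [Finite 𝒲] [Finite σ] [Finite β]
    (hq : ∀ ω, 0 ≤ q ω) (hq1 : ∑ ω, q ω = 1) (W : Ω → 𝒲) (y : 𝒲 → σ) {V : ℕ → Ω → β}
    {ρ : ℕ → β → β} (hρ : ∀ s ω, ρ s (V (s + 1) ω) = V s ω) {v₀ : β} (hV : ∀ ω, V 0 ω = v₀)
    {E : (n : ℕ) → (Fin n → Ω) → Prop} (hE : Negligible q fun n ω => ¬E n ω) (S : ℕ) {η : ℝ}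
    (hη : 0 < η) :
    ∃ good : (n : ℕ) → (Fin n → 𝒲) → Prop,
      (Negligible q fun n ω => ¬good n fun t => W (ω t)) ∧
      ∀ᶠ n : ℕ in atTop, ∃ (C : ℕ → Finset (Fin n → β)) (L : ℕ → (Fin n → σ) → Finset (Fin n → β)),
        (∀ s ≤ S, (#(C s) : ℝ) ≤ (2 : ℝ) ^ (n * (mutualInfo q W (V s) + S * (4 * η)))) ∧
        (∀ s ≤ S, ∀ z, (#(L s z) : ℝ) ≤
          (2 : ℝ) ^ (n * (condMutualInfo q W (V s) (fun ω => y (W ω)) + S * (7 * η)))) ∧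
        (∀ s, ∀ v ∈ C (s + 1), (fun t => ρ s (v t)) ∈ C s) ∧
        (∀ s, ∀ z, ∀ v ∈ L (s + 1) z, (fun t => ρ s (v t)) ∈ L s z) ∧
        ∀ w, good n w → ∃ v, v ∈ C S ∧ v ∈ L S (fun t => y (w t)) ∧
          ∃ ω : Fin n → Ω, E n ω ∧ (fun t => W (ω t)) = w ∧ (fun t => V S (ω t)) = v := by
  cases nonempty_fintype 𝒲
  cases nonempty_fintype σ
  have : Nonempty β := ⟨v₀⟩
  let T := ChainTypical q W y V S η E
  let δ : ℝ := 1 / 2 ^ (S + 1)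
  have pow_mul_δ : 2 ^ S * δ = 1 / 2 := by
    simp only [δ, pow_succ]
    field_simp
  let good (n : ℕ) (w : Fin n → 𝒲) : Prop := Likely (iid q) (fun (ω : Fin n → Ω) t => W (ω t))
    (fun ω t => V 0 (ω t)) (T n) δ w fun _ => v₀
  have not_good_negligible := (hE.not_chainTypical hq hq1 W y V S hη).not_likely hq
    (fun n ω (t : Fin n) => W (ω t)) (fun n ω (t : Fin n) => V 0 (ω t)) (δ := δ) (by positivity)
  refine ⟨good, by simpa only [good, T, hV] using not_good_negligible, ?_⟩
  filter_upwards [eventually_isLong (Fintype.card 𝒲) (Fintype.card σ) hη] with n hn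
  obtain ⟨C, L, hC, hL, hCρ, hLρ, covers⟩ := exists_tree (V := fun s ω t => V s (ω t))
    (ρ := fun s v t => ρ s (v t)) (S := S) (fun s hs => hn.isLayer
    (T := T n) (V := V (s + 1)) (V' := V s) hq (hρ s) hη.le (fun ω hω => hω.1)
    (fun ω hω => hω.2.2 ⟨s + 1, Nat.succ_lt_succ hs⟩) fun ω hω => hω.2.2 ⟨s, hs.le.trans_lt
      (Nat.lt_succ_self S)⟩) (iid_nonneg hq) (δ := δ) (by positivity)
    (pow_mul_δ.trans_lt (by norm_num)) fun _ => v₀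
  have side_zero : condMutualInfo q W (V 0) (fun ω => y (W ω)) = 0 := by
    rw [condMutualInfo_eq_mutualInfo_sub hq, funext hV, mutualInfo_const hq hq1,
      mutualInfo_const hq hq1, sub_zero]
  refine ⟨C, L, fun s hs => (hC s).trans ?_, fun s hs z => (hL s hs z).trans ?_, hCρ, hLρ,
    fun w hw => ?_⟩
  · refine prod_range_le_rpow (f := fun s => mutualInfo q W (V s)) ?_ (fun r => Nat.cast_nonneg _)
      (by positivity) (fun r => codebookSize_le (sub_nonneg.2 ?_) hη.le hn.two_le) hs
    · rw [funext hV, mutualInfo_const hq hq1]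
    · exact mutualInfo_mono_right hq W fun ω ω' h => by rw [← hρ r ω, ← hρ r ω', h]
  · exact prod_range_le_rpow (f := fun s => condMutualInfo q W (V s) (fun ω => y (W ω))) side_zero
      (fun r => by positivity) (by positivity) (fun r => le_rfl) hs
  · obtain ⟨v, hvC, hvL, likely⟩ := covers w hw
    obtain ⟨ω, hω, -, hωw, hωv⟩ := likely.exists (by rw [pow_mul_δ]; norm_num)
    exact ⟨v, hvC, hvL, ω, hω.2.1, hωw, hωv⟩

end Superposition

/-! ### The words that the users hold -/

section Words

variable {N m : ℕ} {𝒳 𝒴 : Type*} {𝒳h : Fin N → Type*}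

/-- Replace the letters of all but the last `s` users by those of the default word `v₀`; for `s = 0`
the auxiliary letter is replaced as well. -/
def mask (v₀ : ((i : Fin N) → 𝒳h i) × Fin m) (s : ℕ) (v : ((i : Fin N) → 𝒳h i) × Fin m) :
    ((i : Fin N) → 𝒳h i) × Fin m :=
  (fun i => if N ≤ i + s then v.1 i else v₀.1 i, if 0 < s then v.2 else v₀.2)

theorem mask_mask (v₀ : ((i : Fin N) → 𝒳h i) × Fin m) {s s' : ℕ} (h : s ≤ s')
    (v : ((i : Fin N) → 𝒳h i) × Fin m) : mask v₀ s (mask v₀ s' v) = mask v₀ s v := by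
  refine Prod.ext (funext fun i => ?_) ?_ <;> simp only [mask] <;> split_ifs <;> first | rfl | omega

/-- The letters that the word of the `s`-th user from the end carries. The last reconstruction is
never among them, because it is sent over the direct link. -/
def word (v₀ : ((i : Fin N) → 𝒳h i) × Fin m) (s : ℕ) (ω : Joint 𝒳 𝒴 𝒳h m) :
    ((i : Fin N) → 𝒳h i) × Fin m :=
  mask v₀ s (fun i => if (i : ℕ) + 1 < N then Joint.Xhat i ω else v₀.1 i, Joint.U ω)

theorem mask_word (v₀ : ((i : Fin N) → 𝒳h i) × Fin m) {s s' : ℕ} (h : s ≤ s')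
    (ω : Joint 𝒳 𝒴 𝒳h m) : mask v₀ s (word v₀ s' ω) = word v₀ s ω :=
  mask_mask v₀ h _

theorem word_zero (v₀ : ((i : Fin N) → 𝒳h i) × Fin m) (ω : Joint 𝒳 𝒴 𝒳h m) :
    word v₀ 0 ω = v₀ :=
  Prod.ext (funext fun i => if_neg i.isLt.not_ge) rfl

theorem word_fst (v₀ : ((i : Fin N) → 𝒳h i) × Fin m) {s : ℕ} {i : Fin N} (hs : N ≤ i + s)
    (hi : (i : ℕ) + 1 < N) (ω : Joint 𝒳 𝒴 𝒳h m) : (word v₀ s ω).1 i = Joint.Xhat i ω := by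
  simp only [word, mask, if_pos hs, if_pos hi]

theorem word_snd (v₀ : ((i : Fin N) → 𝒳h i) × Fin m) {s : ℕ} (hs : 0 < s)
    (ω : Joint 𝒳 𝒴 𝒳h m) : (word v₀ s ω).2 = Joint.U ω :=
  if_pos hs

theorem word_eq_iff (v₀ : ((i : Fin N) → 𝒳h i) × Fin m) (i : Fin N) (ω ω' : Joint 𝒳 𝒴 𝒳h m) :
    word v₀ (N - i) ω = word v₀ (N - i) ω' ↔
      tailOf Joint.Xhat Joint.U i ω = tailOf Joint.Xhat Joint.U i ω' := by
  have hi : 0 < N - (i : ℕ) := by omega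
  rw [Prod.ext_iff, word_snd v₀ hi, word_snd v₀ hi, tailOf, tailOf, Prod.mk.injEq]
  refine and_congr_left fun _ => ⟨fun h => funext fun j => ?_, fun h => funext fun j => ?_⟩
  · have level : N ≤ (j : Fin N) + (N - i) := by
      have : (i : ℕ) ≤ (j : Fin N) := j.2.1
      omega
    rw [← word_fst v₀ level j.2.2 ω, h, word_fst v₀ level j.2.2]
  · simp only [word, mask]
    split_ifs with level not_last
    · exact congrFun h ⟨j, by rw [Fin.le_def]; omega, not_last⟩
    · rfl
    · rfl

end Words

/-! ### Expected distortion of a code -/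

section Distortion

theorem sum_mul_le_add_mul_mass {Ω : Type*} [Fintype Ω] {Q : Ω → ℝ} (hQ : ∀ ω, 0 ≤ Q ω)
    (hQ1 : ∑ ω, Q ω = 1) {f : Ω → ℝ} {a B : ℝ} {E : Ω → Prop}
    (hB : ∀ ω, f ω ≤ a + B) (hE : ∀ ω, ¬E ω → f ω ≤ a) :
    ∑ ω, Q ω * f ω ≤ a + B * mass Q E := by
  classical
  calc ∑ ω, Q ω * f ω ≤ ∑ ω, (Q ω * a + B * if E ω then Q ω else 0) := by
        refine Finset.sum_le_sum fun ω _ => ?_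
        have := hQ ω
        split_ifs with h
        · nlinarith [hB ω]
        · nlinarith [hE ω h]
    _ = a + B * mass Q E := by
        rw [Finset.sum_add_distrib, ← Finset.sum_mul, hQ1, one_mul, ← Finset.mul_sum, mass]

namespace Code

variable {k l n : ℕ} {𝒳 𝒴 : Type*} [Fintype 𝒳] [Fintype 𝒴] {𝒳h : Fin (k + l) → Type*}
  {P : 𝒳 × 𝒴 → ℝ} {d : (i : Fin (k + l)) → 𝒳 → 𝒳h i → ℝ} {M : Fin (k + l + 1) → ℕ}
  {Ω : Type*} [Fintype Ω] {q : Ω → ℝ} {X : Ω → 𝒳} {Y : Ω → 𝒴}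

theorem expDistortion_eq_sum_iid (c : Code k l n 𝒳 𝒴 𝒳h M)
    (hP : ∀ x y, prob q (fun ω => (X ω, Y ω)) (x, y) = P (x, y)) (i : Fin (k + l)) :
    c.expDistortion P d i = ∑ ω, iid q ω * (1 / n * ∑ t, d i (X (ω t))
      (c.recon (fun t => X (ω t)) (fun t => Y (ω t)) i t)) := by
  obtain rfl : prob q (fun ω => (X ω, Y ω)) = P := funext fun z => hP z.1 z.2
  rw [expDistortion, sum_sum_eq_sum_pair, ← sum_prob_mul (iid q)
    (fun (ω : Fin n → Ω) t => (X (ω t), Y (ω t))) fun w => 1 / n * ∑ t, d i (w t).1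
      (c.recon (fun t => (w t).1) (fun t => (w t).2) i t)]
  exact Finset.sum_congr rfl fun w _ => by rw [prob_iid fun ω => (X ω, Y ω), iid]

theorem expDistortion_le (c : Code k l n 𝒳 𝒴 𝒳h M) (hn : 0 < n) (hq : ∀ ω, 0 ≤ q ω)
    (hq1 : ∑ ω, q ω = 1) (hP : ∀ x y, prob q (fun ω => (X ω, Y ω)) (x, y) = P (x, y))
    {i : Fin (k + l)} {a B : ℝ} (hB : ∀ x z, d i x z ≤ a + B)
    {good : (Fin n → 𝒳 × 𝒴) → Prop} (hgood : ∀ w, good w → ∑ t, d i (w t).1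
      (c.recon (fun t => (w t).1) (fun t => (w t).2) i t) ≤ n * a) :
    c.expDistortion P d i ≤
      a + B * mass (iid q) fun ω => ¬good fun t => (X (ω t), Y (ω t)) := by
  have hn_pos : (0 : ℝ) < n := Nat.cast_pos.2 hn
  rw [c.expDistortion_eq_sum_iid hP]
  refine sum_mul_le_add_mul_mass (iid_nonneg hq) (sum_iid hq1) (fun ω => ?_) fun ω hω => ?_
  all_goals rw [one_div, inv_mul_le_iff₀ hn_pos]
  · exact (Finset.sum_le_card_nsmul _ _ _ fun t _ => hB _ _).trans_eq (by simp [mul_add])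
  · exact hgood _ (not_not.1 hω)

end Code

theorem exists_distortion_le {ι 𝒳 : Type*} [Finite ι] [Finite 𝒳] {𝒳h : ι → Type*}
    [∀ i, Finite (𝒳h i)] (d : (i : ι) → 𝒳 → 𝒳h i → ℝ) :
    ∃ B : ℝ, ∀ i x z, d i x z ≤ B := by
  obtain ⟨B, hB⟩ := (Set.finite_range fun p : (i : ι) × 𝒳 × 𝒳h i => d p.1 p.2.1 p.2.2).bddAbove
  exact ⟨B, fun i x z => hB ⟨⟨i, x, z⟩, rfl⟩⟩

end Distortion

/-! ### Codes from nested code words -/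

section NestedCode

variable {k l n m : ℕ} {𝒳 𝒴 : Type*} {𝒳h : Fin (k + l) → Type*} {M : Fin (k + l + 1) → ℕ}

theorem word_mem_of_mask_mem {N S : ℕ} {𝒳h : Fin N → Type*} {v₀ : ((i : Fin N) → 𝒳h i) × Fin m}
    {C : ℕ → Finset (Fin n → ((i : Fin N) → 𝒳h i) × Fin m)}
    (hC : ∀ s, ∀ v ∈ C (s + 1), (fun t => mask v₀ s (v t)) ∈ C s) {ω : Fin n → Joint 𝒳 𝒴 𝒳h m}
    (h : (fun t => word v₀ S (ω t)) ∈ C S) {s : ℕ} (hs : s ≤ S) :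
    (fun t => word v₀ s (ω t)) ∈ C s := by
  induction hs using Nat.decreasingInduction with
  | self => exact h
  | of_succ s _ ih => simpa only [mask_word v₀ (Nat.le_succ s)] using hC s _ ih

theorem exists_code_of_words {e : Fin (k + l)} (he : (e : ℕ) + 1 = k + l) (hM : ∀ i, 0 < M i)
    {v₀ : ((i : Fin (k + l)) → 𝒳h i) × Fin m}
    {C : ℕ → Finset (Fin n → ((i : Fin (k + l)) → 𝒳h i) × Fin m)}
    {L : ℕ → (Fin n → 𝒴) → Finset (Fin n → ((i : Fin (k + l)) → 𝒳h i) × Fin m)}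
    (hL : ∀ i : Fin (k + l), (i : ℕ) < k → ∀ y, #(L (k + l - i) y) ≤ M i.castSucc)
    (hC : ∀ i : Fin (k + l), k ≤ (i : ℕ) → #(C (k + l - i)) ≤ M i.castSucc)
    (hCmask : ∀ s, ∀ v ∈ C (s + 1), (fun t => mask v₀ s (v t)) ∈ C s)
    (hLmask : ∀ s y, ∀ v ∈ L (s + 1) y, (fun t => mask v₀ s (v t)) ∈ L s y)
    (ω : (Fin n → 𝒳 × 𝒴) → Fin n → Joint 𝒳 𝒴 𝒳h m)
    (c : (Fin n → Fin m) → Fin (M (Fin.last (k + l))) → Fin n → 𝒳h e)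
    (sel : (Fin n → 𝒳 × 𝒴) → Fin (M (Fin.last (k + l)))) :
    ∃ code : Code k l n 𝒳 𝒴 𝒳h M, ∀ w, (fun t => word v₀ (k + l) (ω w t)) ∈ C (k + l) →
      (fun t => word v₀ (k + l) (ω w t)) ∈ L (k + l) (fun t => (w t).2) →
      (∀ i : Fin (k + l), (i : ℕ) + 1 < k + l →
        code.recon (fun t => (w t).1) (fun t => (w t).2) i = fun t => Joint.Xhat i (ω w t)) ∧
      code.recon (fun t => (w t).1) (fun t => (w t).2) e =
        c (fun t => Joint.U (ω w t)) (sel w) := by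
  classical
  have : Nonempty (Fin n → ((i : Fin (k + l)) → 𝒳h i) × Fin m) := ⟨fun _ => v₀⟩
  have level (i : Fin (k + l)) : k + l ≤ i + (k + l - i) := by omega
  let dec (i : Fin (k + l)) (v : Fin n → ((i : Fin (k + l)) → 𝒳h i) × Fin m)
      (j : Option (Fin (M (Fin.last (k + l))))) : Fin n → 𝒳h i :=
    if h : e = i then j.elim (fun _ => v₀.1 i) (h ▸ c fun t => (v t).2) else fun t => (v t).1 i
  obtain ⟨code, hcode⟩ := exists_code (n := n) (by omega) hM
    (Z := fun i o => if (i : ℕ) < k then o.elim ∅ (L (k + l - i)) else C (k + l - i))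
    (fun i o => by
      split_ifs with hi
      · cases o with
        | none => exact Nat.zero_le _
        | some y => exact hL i hi y
      · exact hC i (not_lt.1 hi))
    (ρ := fun i v t => mask v₀ (k + l - (i + 1)) (v t))
    (g := fun i x y t => word v₀ (k + l - i) (ω (fun t => (x t, y t)) t))
    (fun i x y => funext fun t => (mask_word v₀ (by omega) _).symm)
    (fun x y => sel fun t => (x t, y t)) dec
  refine ⟨code, fun w memC memL => ?_⟩
  have recon_eq := hcode (fun t => (w t).1) (fun t => (w t).2) fun i => by
    simp only [sideView]
    split_ifs with hi
    · exact word_mem_of_mask_mem (C := fun s => L s fun t => (w t).2)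
        (fun s => hLmask s _) memL (Nat.sub_le _ _)
    · exact word_mem_of_mask_mem hCmask memC (Nat.sub_le _ _)
  refine ⟨fun i hi => ?_, ?_⟩
  · have ne_last : e ≠ i := by rintro rfl; omega
    rw [recon_eq]
    simp only [dec, dif_neg ne_last, word_fst v₀ (level i) hi]
  · rw [recon_eq]
    simp only [dec, dif_pos, directView, if_pos he, Option.elim_some,
      word_snd v₀ (Nat.sub_pos_of_lt e.isLt)]

theorem exists_code_of_covers [Nonempty (Joint 𝒳 𝒴 𝒳h m)] {e : Fin (k + l)}
    (he : (e : ℕ) + 1 = k + l) (hM : ∀ i, 0 < M i) {v₀ : ((i : Fin (k + l)) → 𝒳h i) × Fin m}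
    {C : ℕ → Finset (Fin n → ((i : Fin (k + l)) → 𝒳h i) × Fin m)}
    {L : ℕ → (Fin n → 𝒴) → Finset (Fin n → ((i : Fin (k + l)) → 𝒳h i) × Fin m)}
    (hL : ∀ i : Fin (k + l), (i : ℕ) < k → ∀ y, #(L (k + l - i) y) ≤ M i.castSucc)
    (hC : ∀ i : Fin (k + l), k ≤ (i : ℕ) → #(C (k + l - i)) ≤ M i.castSucc)
    (hCmask : ∀ s, ∀ v ∈ C (s + 1), (fun t => mask v₀ s (v t)) ∈ C s)
    (hLmask : ∀ s y, ∀ v ∈ L (s + 1) y, (fun t => mask v₀ s (v t)) ∈ L s y)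
    {d : (i : Fin (k + l)) → 𝒳 → 𝒳h i → ℝ} {Δ : Fin (k + l) → ℝ}
    {good : (Fin n → 𝒳 × 𝒴) → Prop} {E : (Fin n → 𝒳) → (Fin n → Fin m) → Prop}
    (covers : ∀ w, good w → ∃ v, v ∈ C (k + l) ∧ v ∈ L (k + l) (fun t => (w t).2) ∧
      ∃ ω : Fin n → Joint 𝒳 𝒴 𝒳h m,
        ((∀ i, ∑ t, d i (Joint.X (ω t)) (Joint.Xhat i (ω t)) ≤ Δ i) ∧
          E (fun t => Joint.X (ω t)) fun t => Joint.U (ω t)) ∧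
        (fun t => (Joint.X (ω t), Joint.Y (ω t))) = w ∧ (fun t => word v₀ (k + l) (ω t)) = v)
    (direct : ∀ u, ∃ c : Fin (M (Fin.last (k + l))) → Fin n → 𝒳h e,
      ∀ x, E x u → ∃ j, ∑ t, d e (x t) (c j t) ≤ Δ e) :
    ∃ code : Code k l n 𝒳 𝒴 𝒳h M, ∀ w, good w → ∀ i,
      ∑ t, d i (w t).1 (code.recon (fun t => (w t).1) (fun t => (w t).2) i t) ≤ Δ i := by
  have : Nonempty (Fin (M (Fin.last (k + l)))) := ⟨⟨0, hM _⟩⟩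
  choose! v memC memL ω typical source words using covers
  choose c hc using direct
  have exists_index (w : Fin n → 𝒳 × 𝒴) (hw : good w) :
      ∃ j, ∑ t, d e (w t).1 (c (fun t => Joint.U (ω w t)) j t) ≤ Δ e :=
    hc _ _ (by simpa only [← congrFun (source w hw)] using (typical w hw).2)
  choose! sel hsel using exists_index
  obtain ⟨code, hcode⟩ := exists_code_of_words he hM hL hC hCmask hLmask ω c sel
  refine ⟨code, fun w hw i => ?_⟩
  obtain ⟨recon_eq, recon_last⟩ :=
    hcode w (words w hw ▸ memC w hw) (words w hw ▸ memL w hw)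
  by_cases hi : (i : ℕ) + 1 < k + l
  · rw [recon_eq i hi]
    simpa only [← congrFun (source w hw)] using (typical w hw).1 i
  · obtain rfl : i = e := Fin.ext (by omega)
    rw [recon_last]
    exact hsel w hw

end NestedCode

/-! ### Achievability -/

section Achievability

theorem mutualInfo_nonneg {Ω α β : Type*} [Fintype Ω] {q : Ω → ℝ} (hq : ∀ ω, 0 ≤ q ω)
    (hq1 : ∑ ω, q ω = 1) (A : Ω → α) (B : Ω → β) : 0 ≤ mutualInfo q A B := by
  rw [mutualInfo_eq_entropy hq]
  exact sub_nonneg.2 (entropy_pair_le_add hq hq1 A B)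

theorem condMutualInfo_pair_left {Ω α β γ : Type*} [Fintype Ω] {q : Ω → ℝ} (hq : ∀ ω, 0 ≤ q ω)
    (A : Ω → α) (B : Ω → β) (C : Ω → γ) :
    condMutualInfo q (fun ω => (A ω, C ω)) B C = condMutualInfo q A B C := by
  rw [condMutualInfo_eq_entropy hq, condMutualInfo_eq_entropy hq,
    entropy_congr (A := fun ω => ((A ω, C ω), C ω)) (B := fun ω => (A ω, C ω)) fun _ _ => by simp,
    entropy_congr (A := fun ω => ((A ω, C ω), B ω, C ω)) (B := fun ω => (A ω, B ω, C ω))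
      fun _ _ => by simp only [Prod.mk.injEq]; tauto]

theorem le_natFloor_rpow {S n : ℕ} {a b : ℝ} (hS : (S : ℝ) ≤ 2 ^ (n * a)) (hab : a ≤ b) :
    S ≤ ⌊(2 : ℝ) ^ (n * b)⌋₊ :=
  Nat.le_floor (hS.trans (rpow_le_rpow_of_exponent_le one_le_two (by gcongr)))

theorem rpow_le_natFloor_rpow {n : ℕ} {a b η : ℝ} (hn : (2 : ℝ) ≤ 2 ^ (n * η)) (ha : 0 ≤ a)
    (hab : a + η ≤ b) : (2 : ℝ) ^ (n * a) ≤ ⌊(2 : ℝ) ^ (n * b)⌋₊ := by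
  have one_le : (1 : ℝ) ≤ 2 ^ (n * a) := one_le_rpow one_le_two (by positivity)
  have double : 2 * (2 : ℝ) ^ (n * a) ≤ 2 ^ (n * b) :=
    calc 2 * (2 : ℝ) ^ (n * a) ≤ 2 ^ (n * η) * 2 ^ (n * a) := by gcongr
      _ = 2 ^ (n * (a + η)) := by rw [← rpow_add two_pos]; ring_nf
      _ ≤ 2 ^ (n * b) := rpow_le_rpow_of_exponent_le one_le_two (by gcongr)
  linarith [Nat.lt_floor_add_one ((2 : ℝ) ^ (n * b))]

namespace SatisfiesBounds

variable {k l : ℕ} {𝒳 𝒴 : Type*} {𝒳h : Fin (k + l) → Type*} {P : 𝒳 × 𝒴 → ℝ}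
  {d : (i : Fin (k + l)) → 𝒳 → 𝒳h i → ℝ} {D : Fin (k + l) → ℝ} {R : Fin (k + l + 1) → ℝ}

section AnySpace

variable {Ω 𝒰 : Type*} [Fintype Ω] {q : Ω → ℝ} {X : Ω → 𝒳} {Y : Ω → 𝒴}
  {Xh : (i : Fin (k + l)) → Ω → 𝒳h i} {U : Ω → 𝒰}

theorem rate_nonneg (h : SatisfiesBounds P d D R q X Y Xh U) (hkl : 0 < k + l)
    (hq : q ∈ stdSimplex ℝ Ω) (i : Fin (k + l + 1)) : 0 ≤ R i := by
  induction i using Fin.lastCases with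
  | last =>
    exact (condMutualInfo_nonneg hq.1 _ _ _).trans
      (h.rate_direct ⟨k + l - 1, Nat.sub_one_lt_of_lt hkl⟩ (Nat.sub_add_cancel hkl))
  | cast i =>
    rcases lt_or_ge (i : ℕ) k with side | plain
    · exact (condMutualInfo_nonneg hq.1 _ _ _).trans (h.rate_side i side)
    · exact (mutualInfo_nonneg hq.1 hq.2 _ _).trans (h.rate_plain i plain)

theorem negligible_distortion_gt (h : SatisfiesBounds P d D R q X Y Xh U)
    (hq : q ∈ stdSimplex ℝ Ω) {η : ℝ} (hη : 0 < η) :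
    Negligible q fun n ω => ∃ i, n * (D i + η) < ∑ t, d i (X (ω t)) (Xh i (ω t)) :=
  Negligible.exists hq.1 fun i => negligible_lt_sum hq.1 hq.2 (f := fun ω => d i (X ω) (Xh i ω))
    ((h.distortion i).trans_lt (lt_add_of_pos_right _ hη))

end AnySpace

variable [Fintype 𝒳] [Fintype 𝒴] [∀ i, Fintype (𝒳h i)] {m : ℕ} {q : Joint 𝒳 𝒴 𝒳h m → ℝ}

theorem condMutualInfo_word_le (h : SatisfiesBounds P d D R q Joint.X Joint.Y Joint.Xhat Joint.U)
    (hq : ∀ ω, 0 ≤ q ω) (v₀ : ((i : Fin (k + l)) → 𝒳h i) × Fin m) {i : Fin (k + l)}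
    (hi : (i : ℕ) < k) :
    condMutualInfo q (fun ω => (Joint.X ω, Joint.Y ω)) (word v₀ (k + l - i)) Joint.Y ≤
      R i.castSucc := by
  rw [condMutualInfo_pair_left hq]
  exact (condMutualInfo_congr q (fun _ _ => Iff.rfl) (word_eq_iff v₀ i)
    fun _ _ => Iff.rfl).trans_le (h.rate_side i hi)

theorem mutualInfo_word_le (h : SatisfiesBounds P d D R q Joint.X Joint.Y Joint.Xhat Joint.U)
    (v₀ : ((i : Fin (k + l)) → 𝒳h i) × Fin m) {i : Fin (k + l)} (hi : k ≤ (i : ℕ)) :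
    mutualInfo q (fun ω => (Joint.X ω, Joint.Y ω)) (word v₀ (k + l - i)) ≤ R i.castSucc :=
  (mutualInfo_congr q (fun _ _ => Iff.rfl) (word_eq_iff v₀ i)).trans_le (h.rate_plain i hi)

theorem eventually_exists_code (h : SatisfiesBounds P d D R q Joint.X Joint.Y Joint.Xhat Joint.U)
    (hkl : 0 < k + l) (hq : q ∈ stdSimplex ℝ (Joint 𝒳 𝒴 𝒳h m)) {η δ : ℝ} (hη : 0 < η)
    (hδ : (k + l : ℕ) * (7 * η) ≤ δ) :
    ∃ good : (n : ℕ) → (Fin n → 𝒳 × 𝒴) → Prop,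
      (Negligible q fun n ω => ¬good n fun t => (Joint.X (ω t), Joint.Y (ω t))) ∧
      ∀ᶠ n : ℕ in atTop, ∃ code : Code k l n 𝒳 𝒴 𝒳h fun i => ⌊(2 : ℝ) ^ (n * (R i + δ))⌋₊,
        ∀ w, good n w → ∀ i, ∑ t, d i (w t).1
          (code.recon (fun t => (w t).1) (fun t => (w t).2) i t) ≤ n * (D i + η) := by
  obtain ⟨e, he⟩ : ∃ e : Fin (k + l), (e : ℕ) + 1 = k + l :=
    ⟨⟨k + l - 1, Nat.sub_one_lt_of_lt hkl⟩, Nat.sub_add_cancel hkl⟩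
  have : Nonempty (Joint 𝒳 𝒴 𝒳h m) := nonempty_of_sum_eq_one hq.2
  let v₀ : ((i : Fin (k + l)) → 𝒳h i) × Fin m := (Classical.arbitrary (Joint 𝒳 𝒴 𝒳h m)).2.2
  have one_le_users : (1 : ℝ) ≤ (k + l : ℕ) := Nat.one_le_cast.2 hkl
  obtain ⟨E, hE, eventually_direct⟩ := exists_conditional_codebooks hq.1 hq.2 Joint.X
    (Joint.Xhat e) Joint.U (d e) (h.distortion e) hη
  have typical : Negligible q fun n ω =>
      ¬((∀ i, ∑ t, d i (Joint.X (ω t)) (Joint.Xhat i (ω t)) ≤ n * (D i + η)) ∧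
        E n (fun t => Joint.X (ω t)) fun t => Joint.U (ω t)) := by
    refine ((h.negligible_distortion_gt hq hη).or hq.1 hE).mono hq.1 fun n ω _ hcon => ?_
    by_contra! hnot
    exact hcon hnot
  obtain ⟨good, good_likely, eventually_nested⟩ := exists_superposition_codebooks hq.1 hq.2
    (fun ω => (Joint.X ω, Joint.Y ω)) Prod.snd (V := word v₀) (ρ := mask v₀)
    (fun s ω => mask_word v₀ (Nat.le_succ s) ω) (word_zero v₀) typical (k + l) hη
  refine ⟨good, good_likely, ?_⟩
  filter_upwards [eventually_direct, eventually_nested, eventually_two_le_rpow hη]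
    with n direct ⟨C, L, card_C, card_L, hC, hL, covers⟩ two_le
  have hM (i : Fin (k + l + 1)) : 0 < ⌊(2 : ℝ) ^ (n * (R i + δ))⌋₊ :=
    Nat.cast_pos.1 ((rpow_pos_of_pos two_pos _).trans_le
      (rpow_le_natFloor_rpow two_le le_rfl (by nlinarith [h.rate_nonneg hkl hq i])))
  refine exists_code_of_covers he hM (fun i hi y => ?_) (fun i hi => ?_) hC hL covers
    (direct _ (rpow_le_natFloor_rpow two_le
      (add_nonneg (condMutualInfo_nonneg hq.1 _ _ _) (by positivity)) ?_))
  · refine le_natFloor_rpow (card_L _ (Nat.sub_le _ _) y) ?_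
    linarith [h.condMutualInfo_word_le hq.1 v₀ hi]
  · refine le_natFloor_rpow (card_C _ (Nat.sub_le _ _)) ?_
    nlinarith [h.mutualInfo_word_le v₀ hi]
  · nlinarith [h.rate_direct e he]

end SatisfiesBounds

variable {k l : ℕ} {𝒳 𝒴 : Type*} [Fintype 𝒳] [Fintype 𝒴] {𝒳h : Fin (k + l) → Type*}
  [∀ i, Fintype (𝒳h i)] {P : 𝒳 × 𝒴 → ℝ} {d : (i : Fin (k + l)) → 𝒳 → 𝒳h i → ℝ}
  {D : Fin (k + l) → ℝ} {R : Fin (k + l + 1) → ℝ} {m : ℕ}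

theorem achievable_of_mem_infoRegion (hkl : 0 < k + l) (hR : R ∈ infoRegion P d D m) {δ : ℝ}
    (hδ : 0 < δ) : Achievable P d D fun i => R i + δ := by
  obtain ⟨q, hq, h⟩ := mem_infoRegion_iff.1 hR
  intro ε hε
  have : (0 : ℝ) < (k + l : ℕ) := Nat.cast_pos.2 hkl
  obtain ⟨η, hη, η_le, rate_loss⟩ :
      ∃ η : ℝ, 0 < η ∧ η ≤ ε / 2 ∧ (k + l : ℕ) * (7 * η) ≤ δ := by
    refine ⟨min (ε / 2) (δ / (7 * (k + l : ℕ))), by positivity, min_le_left _ _, ?_⟩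
    rw [← mul_assoc, mul_comm _ (7 : ℝ), ← le_div_iff₀' (by positivity)]
    exact min_le_right _ _
  obtain ⟨B, hB⟩ := exists_distortion_le fun i x z => d i x z - (D i + η)
  obtain ⟨good, bad_negligible, eventually_code⟩ := h.eventually_exists_code hkl hq hη rate_loss
  have bad_small : ∀ᶠ n in atTop, B * mass (iid q)
      (fun ω : Fin n → _ => ¬good n fun t => (Joint.X (ω t), Joint.Y (ω t))) < ε / 2 := by
    refine (bad_negligible.const_mul B).eventually_lt_const ?_
    rw [mul_zero]
    exact half_pos hε
  refine eventually_atTop.1 ?_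
  filter_upwards [eventually_code, bad_small, eventually_gt_atTop 0] with n ⟨code, hcode⟩ hbad hn
  refine ⟨_, code, fun i => Nat.floor_le (by positivity), fun i => ?_⟩
  have := code.expDistortion_le hn hq.1 hq.2 h.law
    (fun x z => sub_le_iff_le_add'.1 (hB i x z)) fun w hw => hcode w hw i
  linarith

end Achievability

/-! ### The achievable region -/

section Region

variable {k l : ℕ} {𝒳 𝒴 : Type*} [Fintype 𝒳] [Fintype 𝒴] {𝒳h : Fin (k + l) → Type*}
  [∀ i, Fintype (𝒳h i)] {P : 𝒳 × 𝒴 → ℝ} {d : (i : Fin (k + l)) → 𝒳 → 𝒳h i → ℝ}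
  {D : Fin (k + l) → ℝ}

theorem isClosed_exists_infoRegion_graph (P : 𝒳 × 𝒴 → ℝ)
    (d : (i : Fin (k + l)) → 𝒳 → 𝒳h i → ℝ) (b : ℕ) :
    IsClosed {z : (Fin (k + l + 1) → ℝ) × (Fin (k + l) → ℝ) |
      ∃ m ≤ b, z.1 ∈ infoRegion P d z.2 m} := by
  convert (Set.finite_Iic b).isClosed_biUnion fun m _ => isClosed_infoRegion_graph P d m
  ext z
  simp

theorem tendsto_add_one_div {ι : Type*} (a : ι → ℝ) :
    Tendsto (fun (j : ℕ) i => a i + 1 / ((j : ℝ) + 1)) atTop (𝓝 a) :=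
  tendsto_pi_nhds.2 fun i => by
    simpa only [add_zero] using
      tendsto_const_nhds.add (tendsto_one_div_add_atTop_nhds_zero_nat (𝕜 := ℝ))

theorem achievableRegion_subset (hl : 0 < l) (hP : P ∈ stdSimplex ℝ (𝒳 × 𝒴)) :
    achievableRegion P d D ⊆ {R | ∃ m, R ∈ infoRegion P d D m} := by
  let b := Fintype.card 𝒳 * Fintype.card 𝒴 * (∏ i, Fintype.card (𝒳h i)) + (k + l)
  have closed := isClosed_exists_infoRegion_graph P d b
  have achievable_subset : {R | Achievable P d D R} ⊆ {R | ∃ m ≤ b, R ∈ infoRegion P d D m} := by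
    intro R hR
    refine closed.mem_of_tendsto (tendsto_const_nhds.prodMk_nhds (tendsto_add_one_div D))
      (Eventually.of_forall fun j => ?_)
    obtain ⟨n₀, h⟩ := hR (1 / ((j : ℝ) + 1)) (by positivity)
    obtain ⟨M, c, hM, hc⟩ := h (n₀ + 1) (Nat.le_succ n₀)
    obtain ⟨m, hm⟩ := c.exists_mem_infoRegion hP hl (Nat.succ_pos n₀) hM hc
    exact exists_mem_infoRegion_le (Nat.add_pos_right k hl) hm
  refine (closure_minimal achievable_subset
    (closed.preimage (f := fun R => (R, D)) (by fun_prop))).trans ?_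
  exact fun R ⟨m, _, hm⟩ => ⟨m, hm⟩

theorem infoRegion_subset_achievableRegion (hkl : 0 < k + l) (m : ℕ) :
    infoRegion P d D m ⊆ achievableRegion P d D := fun R hR =>
  mem_closure_of_tendsto (tendsto_add_one_div R) (Eventually.of_forall fun _ =>
    achievable_of_mem_infoRegion hkl hR Nat.one_div_pos_of_nat)

theorem achievableRegion_eq (hl : 0 < l) (hP : P ∈ stdSimplex ℝ (𝒳 × 𝒴)) :
    achievableRegion P d D = {R | ∃ m, R ∈ infoRegion P d D m} :=
  (achievableRegion_subset hl hP).antisymm fun _ ⟨m, hm⟩ =>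
    infoRegion_subset_achievableRegion (Nat.add_pos_right k hl) m hm

end Region

end TriangularNetwork

end

theorem theorem6_general (k l : ℕ) (hl : 1 ≤ l)
    {𝒳 𝒴 : Type*} [Fintype 𝒳] [Fintype 𝒴]
    {𝒳h : Fin (k + l) → Type*} [∀ i, Fintype (𝒳h i)]
    (P : 𝒳 × 𝒴 → ℝ) (hP : P ∈ stdSimplex ℝ (𝒳 × 𝒴))
    (d : (i : Fin (k + l)) → 𝒳 → 𝒳h i → ℝ) (D : Fin (k + l) → ℝ) :
    TriangularNetwork.achievableRegion P d D =
        {R | ∃ m : ℕ, R ∈ TriangularNetwork.infoRegion P d D m} ∧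
    TriangularNetwork.achievableRegion P d D =
        {R | ∃ m : ℕ,
          m ≤ Fintype.card 𝒳 * Fintype.card 𝒴 * (∏ i, Fintype.card (𝒳h i)) + (k + l) ∧
          R ∈ TriangularNetwork.infoRegion P d D m} := by
  have region_eq := TriangularNetwork.achievableRegion_eq (d := d) (D := D) hl hP
  refine ⟨region_eq, region_eq.trans (Set.ext fun R => ⟨fun ⟨_, h⟩ => ?_, fun ⟨m, _, h⟩ => ⟨m, h⟩⟩)⟩
  exact TriangularNetwork.exists_mem_infoRegion_le (Nat.add_pos_right k hl) h

theorem theorem6 (k l : ℕ) (hl : 1 ≤ l)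
    {𝒳 𝒴 : Type*} [Fintype 𝒳] [Fintype 𝒴]
    {𝒳h : Fin (k + l) → Type*} [∀ i, Fintype (𝒳h i)]
    (P : 𝒳 × 𝒴 → ℝ) (hP : P ∈ stdSimplex ℝ (𝒳 × 𝒴))
    (d : (i : Fin (k + l)) → 𝒳 → 𝒳h i → ℝ) (hd : ∀ i x z, 0 ≤ d i x z)
    (D : Fin (k + l) → ℝ) :
    TriangularNetwork.achievableRegion P d D =
        {R | ∃ m : ℕ, R ∈ TriangularNetwork.infoRegion P d D m} ∧
    TriangularNetwork.achievableRegion P d D =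
        {R | ∃ m : ℕ,
          m ≤ Fintype.card 𝒳 * Fintype.card 𝒴 * (∏ i, Fintype.card (𝒳h i)) + (k + l) ∧
          R ∈ TriangularNetwork.infoRegion P d D m} :=
  theorem6_general k l hl P hP d D
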